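/- Let $\mathbb{H}$ be the quaternions with their euclidean metric, let $\omega=\frac{-1+i+j+k}{2}$ and $\zeta=\frac{1+i+j+k}{2}$, and regard $\mathbb{H}$ as the complex euclidean plane $\mathbb{C}^2$, with the copy $\mathbb{C}=\mathbb{R}+\mathbb{R}\omega\subset\mathbb{H}$ of the complex numbers acting by right multiplication and with the hermitian inner product $\langle v,w\rangle$ given by the orthogonal projection of $\bar v w$ to $\mathbb{C}$. A complex reflection is a map of the form $p+w\mapsto p+w-v(1-z)\langle v,w\rangle$ for all $w \in \mathbb{H}$, with $p\in\mathbb{H}$, $v\in\mathbb{H}$ of length $1$ and $z\in\mathbb{C}$ a root of unity, $z\neq 1$; its fixed points form its fixed hyperplane. Let $G=\mathrm{Refl}(\widetilde G_4)$ be the group of isometries of $\mathbb{H}$ generated by the three complex reflections $x\mapsto \zeta x\zeta$, $x\mapsto (i^{-1}\zeta i)x\zeta$ and $x\mapsto \zeta x\zeta+2$. The hyperplane complement of $G$ is the complement in $\mathbb{H}$ of the union of the fixed hyperplanes of all complex reflections in $G$; the space of regular points is the set of points of $\mathbb{H}$ with trivial stabilizer in $G$. Let $S$ be the set of points $x$ such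 that $\{x\}$ is an intersection of fixed hyperplanes of complex reflections in $G$. The Voronoi cell of $s\in S$ is the set of points that are at least as close to $s$ as to every other point of $S$, and the closed cells of the Voronoi cell structure are the nonempty faces, of all dimensions, of the Voronoi cells. The complement complex $K$ is the union of those closed cells that are disjoint from all fixed hyperplanes, and its vertices are the points $v$ such that $\{v\}$ is one of these cells. For $\epsilon>0$ let $K_1$ be the union of $K$ and the closed balls of radius $\epsilon$ centered at the vertices of $K$, let $K_2$ be $K_1$ with the vertices of $K$ removed, and let $K'$ be $K_1$ with the open balls of radius $\epsilon$ centered at the vertices of $K$ removed. All these spaces carry the subspace topology of $\mathbb{H}$. Proposition (Homotopy equivalences). For all sufficiently small $\epsilon>0$, the spaces $K$, $K_1$ and the hyperplane complement of $G$ are homotopy equivalent, and the spaces $K'$, $K_2$ and the space of regular points of $G$ are homotopy equivalent. -/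

import Mathlib

open scoped Quaternion ContinuousMap

namespace ReflG4

noncomputable section

/-! The quaternions `ℍ[ℝ]` with the complex structure determined by `ω`. The complex subalgebra
is the real span of `1` and `ω` and it acts on `ℍ[ℝ]` by right multiplication. -/

/-- The quaternion `ω = (-1 + i + j + k) / 2`. -/
def omega : ℍ[ℝ] := ⟨-1/2, 1/2, 1/2, 1/2⟩

/-- The quaternion `ζ = (1 + i + j + k) / 2`. -/
def zeta : ℍ[ℝ] := ⟨1/2, 1/2, 1/2, 1/2⟩

/-- The quaternion `i`. -/
def quatI : ℍ[ℝ] := ⟨0, 1, 0, 0⟩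

/-- The distinguished copy of the complex numbers, the real span of `1` and `ω`. -/
def complexLine : Submodule ℝ ℍ[ℝ] := Submodule.span ℝ {1, omega}

/-- The orthogonal projection of `ℍ[ℝ]` onto the complex subalgebra. The purely imaginary unit of
that subalgebra is `(i + j + k) / √3`. -/
def complexPart (x : ℍ[ℝ]) : ℍ[ℝ] :=
  ⟨x.re, (x.imI + x.imJ + x.imK) / 3, (x.imI + x.imJ + x.imK) / 3, (x.imI + x.imJ + x.imK) / 3⟩

/-- The hermitian inner product `⟨v, w⟩` of the right complex vector space `ℍ[ℝ]`, with values in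
the complex subalgebra, conjugate linear in the first and linear in the second variable. -/
def hermitian (v w : ℍ[ℝ]) : ℍ[ℝ] := complexPart (star v * w)

/-- A (nontrivial, proper) complex euclidean reflection: after a choice of an origin `p` it is the
map `w ↦ w - v (1 - z) ⟨v, w⟩`, where `v` is a unit vector and `z ≠ 1` is a complex number that is
a root of unity. Scalars act on the right. -/
def IsComplexReflection (f : ℍ[ℝ] → ℍ[ℝ]) : Prop :=
  ∃ p v z : ℍ[ℝ], ‖v‖ = 1 ∧ z ∈ complexLine ∧ z ≠ 1 ∧ (∃ n : ℕ, 0 < n ∧ z ^ n = 1) ∧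
    ∀ w : ℍ[ℝ], f (p + w) = p + (w - v * (1 - z) * hermitian v w)

lemma zeta_mem_unitary : zeta ∈ unitary ℍ[ℝ] := by
  have h0 : zeta.re = 1 / 2 := rfl
  have h1 : zeta.imI = 1 / 2 := rfl
  have h2 : zeta.imJ = 1 / 2 := rfl
  have h3 : zeta.imK = 1 / 2 := rfl
  rw [Unitary.mem_iff]
  constructor <;> ext <;> simp [h0, h1, h2, h3] <;> norm_num

lemma quatI_mem_unitary : quatI ∈ unitary ℍ[ℝ] := by
  have h0 : quatI.re = 0 := rfl
  have h1 : quatI.imI = 1 := rfl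
  have h2 : quatI.imJ = 0 := rfl
  have h3 : quatI.imK = 0 := rfl
  rw [Unitary.mem_iff]
  constructor <;> ext <;> simp [h0, h1, h2, h3]

/-- `ζ` as a unit quaternion. -/
def zetaU : unitary ℍ[ℝ] := ⟨zeta, zeta_mem_unitary⟩

/-- `i` as a unit quaternion. -/
def iU : unitary ℍ[ℝ] := ⟨quatI, quatI_mem_unitary⟩

/-- The euclidean isometry `x ↦ q x z + v` of `ℍ[ℝ]`, for unit quaternions `q` and `z`. -/
def euclideanMap (q z : unitary ℍ[ℝ]) (v : ℍ[ℝ]) : ℍ[ℝ] ≃ᵢ ℍ[ℝ] where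
  toFun x := (q : ℍ[ℝ]) * x * (z : ℍ[ℝ]) + v
  invFun y := star (q : ℍ[ℝ]) * (y - v) * star (z : ℍ[ℝ])
  left_inv x := by
    have hq := Unitary.coe_star_mul_self q
    have hz : (z : ℍ[ℝ]) * star (z : ℍ[ℝ]) = 1 := Unitary.coe_mul_star_self z
    calc star (q : ℍ[ℝ]) * ((q : ℍ[ℝ]) * x * (z : ℍ[ℝ]) + v - v) * star (z : ℍ[ℝ])
        = (star (q : ℍ[ℝ]) * (q : ℍ[ℝ])) * x * ((z : ℍ[ℝ]) * star (z : ℍ[ℝ])) := by noncomm_ring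
      _ = x := by rw [hq, hz, one_mul, mul_one]
  right_inv y := by
    have hq : (q : ℍ[ℝ]) * star (q : ℍ[ℝ]) = 1 := Unitary.coe_mul_star_self q
    have hz := Unitary.coe_star_mul_self z
    calc (q : ℍ[ℝ]) * (star (q : ℍ[ℝ]) * (y - v) * star (z : ℍ[ℝ])) * (z : ℍ[ℝ]) + v
        = ((q : ℍ[ℝ]) * star (q : ℍ[ℝ])) * (y - v) * (star (z : ℍ[ℝ]) * (z : ℍ[ℝ])) + v := by
          noncomm_ring
      _ = y := by rw [hq, hz, one_mul, mul_one, sub_add_cancel]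
  isometry_toFun := by
    refine Isometry.of_dist_eq fun x y => ?_
    have hq : ‖(q : ℍ[ℝ])‖ = 1 := CStarRing.norm_coe_unitary q
    have hz : ‖(z : ℍ[ℝ])‖ = 1 := CStarRing.norm_coe_unitary z
    have h : (q : ℍ[ℝ]) * x * (z : ℍ[ℝ]) + v - ((q : ℍ[ℝ]) * y * (z : ℍ[ℝ]) + v)
        = (q : ℍ[ℝ]) * (x - y) * (z : ℍ[ℝ]) := by noncomm_ring
    change dist ((q : ℍ[ℝ]) * x * (z : ℍ[ℝ]) + v) ((q : ℍ[ℝ]) * y * (z : ℍ[ℝ]) + v) = dist x y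
    rw [dist_eq_norm, dist_eq_norm, h, norm_mul, norm_mul, hq, hz, one_mul, mul_one]

/-- The reflection `r₁(x) = ζ x ζ`. -/
def r1 : ℍ[ℝ] ≃ᵢ ℍ[ℝ] := euclideanMap zetaU zetaU 0

/-- The reflection `rᵢ(x) = (i⁻¹ ζ i) x ζ`. -/
def ri : ℍ[ℝ] ≃ᵢ ℍ[ℝ] := euclideanMap (iU⁻¹ * zetaU * iU) zetaU 0

/-- The reflection `r₁'(x) = ζ x ζ + 2`. -/
def r1' : ℍ[ℝ] ≃ᵢ ℍ[ℝ] := euclideanMap zetaU zetaU 2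

/-- The complex euclidean reflection group of type `G̃₄`. -/
def reflGroup : Subgroup (ℍ[ℝ] ≃ᵢ ℍ[ℝ]) := Subgroup.closure {r1, ri, r1'}

/-- The union of the fixed hyperplanes of the complex reflections in `G`. -/
def hyperplaneUnion (G : Subgroup (ℍ[ℝ] ≃ᵢ ℍ[ℝ])) : Set ℍ[ℝ] :=
  {x | ∃ f ∈ G, IsComplexReflection f ∧ f x = x}

/-- The hyperplane complement of `G`. -/
def hyperplaneComplement (G : Subgroup (ℍ[ℝ] ≃ᵢ ℍ[ℝ])) : Set ℍ[ℝ] := (hyperplaneUnion G)ᶜ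

/-- The regular points of `G`: those whose stabilizer is trivial. -/
def regularPoints (G : Subgroup (ℍ[ℝ] ≃ᵢ ℍ[ℝ])) : Set ℍ[ℝ] := {x | ∀ f ∈ G, f x = x → f = 1}

/-- The `0`-dimensional intersections of fixed hyperplanes: points `x` such that some family of
fixed hyperplanes of complex reflections in `G` intersects exactly in `{x}`. -/
def isolatedIntersections (G : Subgroup (ℍ[ℝ] ≃ᵢ ℍ[ℝ])) : Set ℍ[ℝ] :=
  {x | ∃ R : Set (ℍ[ℝ] ≃ᵢ ℍ[ℝ]), (∀ f ∈ R, f ∈ G ∧ IsComplexReflection f) ∧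
    {y | ∀ f ∈ R, f y = y} = {x}}

/-- The (closed) Voronoi cell of `s` with respect to the set `S`. -/
def voronoiCell (S : Set ℍ[ℝ]) (s : ℍ[ℝ]) : Set ℍ[ℝ] := {x | ∀ t ∈ S, dist x s ≤ dist x t}

/-- The closed cells of the Voronoi cell structure of `G`: the nonempty faces, of all dimensions,
of the Voronoi cells around the `0`-dimensional intersections of fixed hyperplanes. The faces of a
convex polytope are its exposed faces, the polytope itself included. -/
def IsVoronoiFace (G : Subgroup (ℍ[ℝ] ≃ᵢ ℍ[ℝ])) (F : Set ℍ[ℝ]) : Prop :=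
  F.Nonempty ∧
    ∃ s ∈ isolatedIntersections G, IsExposed ℝ (voronoiCell (isolatedIntersections G) s) F

/-- The cells of the complement complex: the closed cells of the Voronoi cell structure that are
disjoint from all the fixed hyperplanes. -/
def IsComplementCell (G : Subgroup (ℍ[ℝ] ≃ᵢ ℍ[ℝ])) (F : Set ℍ[ℝ]) : Prop :=
  IsVoronoiFace G F ∧ Disjoint F (hyperplaneUnion G)

/-- The complement complex `K`. -/
def complementComplex (G : Subgroup (ℍ[ℝ] ≃ᵢ ℍ[ℝ])) : Set ℍ[ℝ] :=
  ⋃₀ {F | IsComplementCell G F}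

/-- The vertices of the complement complex `K`. -/
def complexVertices (G : Subgroup (ℍ[ℝ] ≃ᵢ ℍ[ℝ])) : Set ℍ[ℝ] := {v | IsComplementCell G {v}}

/-- The space `K₁`: the union of `K` with the closed `ε`-balls around its vertices. -/
def thickenedComplex (G : Subgroup (ℍ[ℝ] ≃ᵢ ℍ[ℝ])) (ε : ℝ) : Set ℍ[ℝ] :=
  complementComplex G ∪ ⋃ v ∈ complexVertices G, Metric.closedBall v ε

/-- The space `K₂`: the space `K₁` without the vertices of `K`. -/
def puncturedThickenedComplex (G : Subgroup (ℍ[ℝ] ≃ᵢ ℍ[ℝ])) (ε : ℝ) : Set ℍ[ℝ] :=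
  thickenedComplex G ε \ complexVertices G

/-- The modified complement complex `K'`: the space `K₁` without the open `ε`-balls around the
vertices of `K`. -/
def modifiedComplex (G : Subgroup (ℍ[ℝ] ≃ᵢ ℍ[ℝ])) (ε : ℝ) : Set ℍ[ℝ] :=
  thickenedComplex G ε \ ⋃ v ∈ complexVertices G, Metric.ball v ε

end

end ReflG4

/-! Everything is read off from two lattices, D₄ and the Hurwitz integers. Each element of the group
has the form x ↦ q ζᵏ x ζᵏ + 2h with q in the quaternion group and h Hurwitz, and a nontrivial one
with a fixed point fixes either a single Hurwitz integer or a wall, that is, a translate to a point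
of D₄ of one of four complex lines through the origin (`fixed_of_mem_reflGroup`). So the hyperplanes
are the walls, the isolated intersections are D₄, the Voronoi cells are 24-cells, the regular points
are the non-Hurwitz points off the walls, and the vertices of K are the Hurwitz integers off the
walls. The lattice points nearest to a point of a wall lie on that wall (`nearest_subset_wall`).
Hence K consists of the points whose nearest lattice points do not all lie on one wall
(`complementComplex_reflGroup`).

The 24 octahedral facets of a Voronoi cell fall into four rings of six, one around each line through
its centre. The line meets the cell in a hexagon with gauge `ringU + ringW`. Over a boundary point
of the hexagon the ring is the intersection of two opposite triangles, `ringS ≤ ringW` and `ringT ≤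
ringU`, which makes each facet a triangular antiprism. Off the walls, a point is projected radially
from the centre to the facets and then orthogonally away from the line to the lateral boundary of
the ring, which lies in K. These maps agree where chambers overlap (`chamberRetr_eq`) and glue to a
continuous `retr` that fixes K, moves points a bounded distance and is constant on each segment from
x to `retr x`. This gives the equivalence of K with the hyperplane complement.

Near a vertex K is star-shaped (`segment_subset_nearestComplex`). Collapsing the small balls gives K
≃ K₁, and pushing the punctured balls outwards gives K' ≃ K₂. For K₂ and the regular points, the
straight-line homotopy to `retr` is stopped short when its target is close to a vertex. It need not
preserve K₂, so it is preceded by a shrinking of the balls. This suffices because `retr` is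
continuous at the vertices, uniformly by periodicity under D₄ (`exists_forall_dist_retr_le`). -/

namespace ReflG4

/-! ### Homotopy equivalences from straight-line deformations -/

section Deformation

open Set Metric

variable {E : Type*} [NormedAddCommGroup E]

/-- A continuous family of maps between subsets of `E` gives a homotopy. -/
theorem homotopic_of_family {A B : Set E} (K : ℝ → E → E)
    (hK : ContinuousOn (fun p : ℝ × E => K p.1 p.2) (Icc 0 1 ×ˢ A))
    (hAB : ∀ t ∈ Icc (0 : ℝ) 1, ∀ x ∈ A, K t x ∈ B) (f g : C(A, B))
    (hf : ∀ x : A, (f x : E) = K 0 x) (hg : ∀ x : A, (g x : E) = K 1 x) : f.Homotopic g := by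
  refine ⟨⟨⟨fun p => ⟨K p.1 p.2, hAB _ p.1.2 _ p.2.2⟩, ?_⟩, ?_, ?_⟩⟩
  · refine Continuous.subtype_mk ?_ _
    exact hK.comp_continuous (f := fun p : unitInterval × A => ((p.1 : ℝ), (p.2 : E)))
      (by fun_prop) fun p => ⟨p.1.2, p.2.2⟩
  · intro x
    exact Subtype.ext (hf x).symm
  · intro x
    exact Subtype.ext (hg x).symm

/-- A weak deformation retraction of `X` into `A`, whose homotopy preserves `A` after
an initial deformation `Q` of `A`, gives a homotopy equivalence. -/
theorem nonempty_homotopyEquiv_of_deformation {A X : Set E} (hAX : A ⊆ X) (H Q : ℝ → E → E)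
    (hH : ContinuousOn (fun p : ℝ × E => H p.1 p.2) (Icc 0 1 ×ˢ X))
    (hQ : ContinuousOn (fun p : ℝ × E => Q p.1 p.2) (Icc 0 1 ×ˢ A))
    (H0 : ∀ x ∈ X, H 0 x = x) (HX : ∀ t ∈ Icc (0 : ℝ) 1, ∀ x ∈ X, H t x ∈ X)
    (H1 : ∀ x ∈ X, H 1 x ∈ A) (Q0 : ∀ x ∈ A, Q 0 x = x)
    (QA : ∀ t ∈ Icc (0 : ℝ) 1, ∀ x ∈ A, Q t x ∈ A)
    (HQ : ∀ t ∈ Icc (0 : ℝ) 1, ∀ x ∈ A, H t (Q 1 x) ∈ A) : Nonempty (A ≃ₕ X) := by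
  have one_mem : (1 : ℝ) ∈ Icc (0 : ℝ) 1 := ⟨zero_le_one, le_rfl⟩
  have hH1 : ContinuousOn (H 1) X :=
    hH.comp (f := fun x : E => ((1 : ℝ), x)) (by fun_prop) fun x hx => ⟨one_mem, hx⟩
  have hQ1 : ContinuousOn (Q 1) A :=
    hQ.comp (f := fun x : E => ((1 : ℝ), x)) (by fun_prop) fun x hx => ⟨one_mem, hx⟩
  let i : C(A, X) := ⟨fun x => ⟨x, hAX x.2⟩, by fun_prop⟩
  let r : C(X, A) := ⟨fun x => ⟨H 1 x, H1 x x.2⟩,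
    Continuous.subtype_mk (continuousOn_iff_continuous_domRestrict.1 hH1) _⟩
  let q : C(A, A) := ⟨fun x => ⟨Q 1 x, QA 1 one_mem x x.2⟩,
    Continuous.subtype_mk (continuousOn_iff_continuous_domRestrict.1 hQ1) _⟩
  let rq : C(A, A) := ⟨fun x => ⟨H 1 (Q 1 x), HQ 1 one_mem x x.2⟩,
    Continuous.subtype_mk (continuousOn_iff_continuous_domRestrict.1
      (hH1.comp hQ1 fun x hx => hAX (QA 1 one_mem x hx))) _⟩
  refine ⟨⟨i, r, ?_, ?_⟩⟩
  -- As `H t` need not preserve `A`, the homotopy from `H 1` to the identity on `A` makes a detour: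
  -- `H 1` to `H 1 ∘ Q 1` by varying `Q`, then to `Q 1` by running `H` backwards on the image of `Q
  -- 1`, then to the identity by running `Q` backwards.
  · have h1 : (ContinuousMap.id A).Homotopic q :=
      homotopic_of_family Q hQ QA _ _ (fun x => (Q0 x x.2).symm) fun x => rfl
    have h2 : q.Homotopic rq := by
      refine homotopic_of_family (fun t x => H t (Q 1 x)) ?_ HQ _ _
        (fun x => (H0 _ (hAX (QA 1 one_mem x x.2))).symm) fun x => rfl
      refine hH.comp (f := fun p : ℝ × E => (p.1, Q 1 p.2)) ?_
        fun p hp => ⟨hp.1, hAX (QA 1 one_mem _ hp.2)⟩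
      exact continuousOn_fst.prodMk (hQ1.comp continuousOn_snd fun p hp => hp.2)
    have h3 : (r.comp i).Homotopic rq := by
      refine homotopic_of_family (fun t x => H 1 (Q t x)) ?_
        (fun t ht x hx => H1 _ (hAX (QA t ht x hx))) _ _ (fun x => ?_) fun x => rfl
      · exact hH1.comp hQ fun p hp => hAX (QA _ hp.1 _ hp.2)
      · change H 1 x = H 1 (Q 0 x)
        rw [Q0 x x.2]
    exact h3.trans (h2.symm.trans h1.symm)
  · have h : (ContinuousMap.id X).Homotopic (i.comp r) :=
      homotopic_of_family H hH HX _ _ (fun x => (H0 x x.2).symm) fun x => rfl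
    exact h.symm

/-- The cut-off function that is `1` on `[0, ε]` and `0` on `[2ε, ∞)`. -/
noncomputable def cutoff (ε r : ℝ) : ℝ := max 0 (min 1 (2 - r / ε))

theorem cutoff_nonneg (ε r : ℝ) : 0 ≤ cutoff ε r := le_max_left _ _

theorem cutoff_le_one (ε r : ℝ) : cutoff ε r ≤ 1 := max_le zero_le_one (min_le_left _ _)

theorem cutoff_eq_one {ε r : ℝ} (hε : 0 < ε) (hr : r ≤ ε) : cutoff ε r = 1 := by
  have : r / ε ≤ 1 := (div_le_one hε).2 hr
  rw [cutoff, min_eq_left (by linarith), max_eq_right zero_le_one]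

theorem cutoff_eq_zero {ε r : ℝ} (hε : 0 < ε) (hr : 2 * ε ≤ r) : cutoff ε r = 0 := by
  have : 2 ≤ r / ε := (le_div_iff₀ hε).2 hr
  exact max_eq_left ((min_le_right _ _).trans (by linarith))

theorem eq_of_dist_lt_one_of_separated {V : Set E}
    (hV : V.Pairwise fun v w => 1 ≤ dist v w) {v w : E} (hv : v ∈ V) (hw : w ∈ V)
    (h : dist v w < 1) :
    v = w := by
  by_contra hne
  exact absurd (hV hv hw hne) (not_le.2 h)

theorem infDist_eq_of_separated {V : Set E} (hV : V.Pairwise fun v w => 1 ≤ dist v w) {v x : E}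
    (hv : v ∈ V)
    (hx : dist x v ≤ 1/2) : infDist x V = dist x v := by
  refine le_antisymm (infDist_le_dist_of_mem hv) ((le_infDist ⟨v, hv⟩).2 fun w hw => ?_)
  by_cases h : v = w
  · rw [h]
  · have h1 := hV hv hw h
    have := dist_triangle_left v w x
    linarith

variable [NormedSpace ℝ E]

/-- The vector field pointing radially away from the points of `V`, cut off at distance `2ε`. -/
noncomputable def radialField (V : Set E) (ε : ℝ) (x : E) : E :=
  ∑ᶠ v : V, cutoff ε (dist x v) • (x - v)

section Radial

variable {V : Set E} {ε : ℝ}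

/-- The points of `V` are 1-separated and `4ε < 1`, so the cut-offs of all other points vanish here.
-/
theorem radialField_of_dist_le (hV : V.Pairwise fun v w => 1 ≤ dist v w) (hε : 0 < ε)
    (hε' : ε < 1/8) {v x : E} (hv : v ∈ V) (hx : dist x v ≤ 2 * ε) :
    radialField V ε x = cutoff ε (dist x v) • (x - v) := by
  rw [radialField, finsum_eq_single _ (⟨v, hv⟩ : V)]
  intro w hw
  have : 2 * ε ≤ dist x w := by
    by_contra h
    refine hw (Subtype.ext (eq_of_dist_lt_one_of_separated hV w.2 hv ?_))
    have := dist_triangle_left (w : E) v x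
    simp only [not_le] at h
    linarith
  rw [cutoff_eq_zero hε this, zero_smul]

theorem radialField_of_forall_le (hε : 0 < ε) {x : E} (hx : ∀ v ∈ V, 2 * ε ≤ dist x v) :
    radialField V ε x = 0 := by
  rw [radialField]
  apply finsum_eq_zero_of_forall_eq_zero
  intro v
  rw [cutoff_eq_zero hε (hx v v.2), zero_smul]

theorem continuous_radialField (hV : V.Pairwise fun v w => 1 ≤ dist v w) (hε : 0 < ε)
    (hε' : ε < 1/8) : Continuous (radialField V ε) := by
  refine continuous_finsum (fun v => ?_) fun x => ?_
  · unfold cutoff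
    fun_prop
  -- A centre whose support meets this ball is within `1/4 + 2ε < 1/2` of `x`, and 1-separation
  -- allows at most one such centre.
  · refine ⟨ball x (1/4), ball_mem_nhds x (by norm_num), Set.Subsingleton.finite ?_⟩
    have key : ∀ v : V, ((Function.support fun x : E => cutoff ε (dist x v) • (x - (v : E))) ∩
        ball x (1/4)).Nonempty → dist x v < 1/2 := by
      rintro v ⟨y, hy, hyx⟩
      have h1 : dist y v < 2 * ε := by
        by_contra h
        exact hy (by simp [cutoff_eq_zero hε (not_lt.1 h)])
      have h2 : dist y x < 1/4 := hyx
      have := dist_triangle_left x (v : E) y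
      linarith
    intro v hv w hw
    have h1 := key v hv
    have h2 := key w hw
    have := dist_triangle_left (v : E) w x
    exact Subtype.ext (eq_of_dist_lt_one_of_separated hV v.2 w.2 (by linarith))

end Radial

variable {V K X : Set E}

section Thickened

variable {ε : ℝ}

/-- Shrinking towards the points of `V` preserves a set that is star-shaped around them. -/
theorem sub_radialField_mem (hV : V.Pairwise fun v w => 1 ≤ dist v w) (hε : 0 < ε)
    (hε' : ε < 1/8)
    (hstar : ∀ v ∈ V, ∀ x ∈ K, dist x v ≤ 2 * ε → segment ℝ v x ⊆ K)
    {t : ℝ} (ht : t ∈ Icc (0 : ℝ) 1) {x : E} (hx : x ∈ K) : x - t • radialField V ε x ∈ K := by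
  by_cases h : ∃ v ∈ V, dist x v ≤ 2 * ε
  · obtain ⟨v, hv, hxv⟩ := h
    rw [radialField_of_dist_le hV hε hε' hv hxv]
    refine hstar v hv x hx hxv ?_
    have h0 := cutoff_nonneg ε (dist x v)
    have h1 := cutoff_le_one ε (dist x v)
    refine ⟨t * cutoff ε (dist x v), 1 - t * cutoff ε (dist x v), mul_nonneg ht.1 h0, ?_, by ring,
      by module⟩
    nlinarith [ht.1, ht.2]
  · push Not at h
    rw [radialField_of_forall_le hε fun v hv => (h v hv).le, smul_zero, sub_zero]
    exact hx

theorem sub_radialField_mem_closedBall (hV : V.Pairwise fun v w => 1 ≤ dist v w) (hε : 0 < ε)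
    (hε' : ε < 1/8) {t : ℝ} {v x : E} (hv : v ∈ V) (hx : dist x v ≤ ε) :
    x - t • radialField V ε x = v + (1 - t) • (x - v) := by
  rw [radialField_of_dist_le hV hε hε' hv (by linarith), cutoff_eq_one hε hx]
  module

/-- Near `v` the map scales `x - v` by a factor in `(0, 1]`. The image of `x` stays within distance
1 of `v`, so the only point of `V` it could be is `v`, which would force `x = v`. -/
theorem sub_radialField_notMem (hV : V.Pairwise fun v w => 1 ≤ dist v w) (hε : 0 < ε)
    (hε' : ε < 1/8) {t : ℝ} (ht : 0 ≤ t) (ht' : t < 1) {x : E} (hx : x ∉ V) :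
    x - t • radialField V ε x ∉ V := by
  by_cases h : ∃ v ∈ V, dist x v ≤ 2 * ε
  · obtain ⟨v, hv, hxv⟩ := h
    rw [radialField_of_dist_le hV hε hε' hv hxv]
    intro hmem
    have h0 := cutoff_nonneg ε (dist x v)
    have h1 := cutoff_le_one ε (dist x v)
    have e : x - t • cutoff ε (dist x v) • (x - v) - v =
        (1 - t * cutoff ε (dist x v)) • (x - v) := by
      module
    have hc : 0 < 1 - t * cutoff ε (dist x v) := by nlinarith
    have hc' : 1 - t * cutoff ε (dist x v) ≤ 1 := by nlinarith
    have hd := eq_of_dist_lt_one_of_separated hV hmem hv (by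
      rw [dist_eq_norm, e, norm_smul, Real.norm_of_nonneg hc.le, ← dist_eq_norm]
      nlinarith [dist_nonneg (x := x) (y := v)])
    rw [← sub_eq_zero, e, smul_eq_zero] at hd
    rcases hd with hd | hd
    · exact hc.ne' hd
    · exact hx (sub_eq_zero.1 hd ▸ hv)
  · push Not at h
    rw [radialField_of_forall_le hε fun v hv => (h v hv).le, smul_zero, sub_zero]
    exact hx

theorem continuousOn_sub_radialField (hV : V.Pairwise fun v w => 1 ≤ dist v w) (hε : 0 < ε)
    (hε' : ε < 1/8) (c : ℝ) (s : Set (ℝ × E)) :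
    ContinuousOn (fun p : ℝ × E => p.2 - (c * p.1) • radialField V ε p.2) s := by
  have := continuous_radialField hV hε hε'
  fun_prop

/-- Collapsing the balls around the points of `V`. -/
theorem nonempty_homotopyEquiv_thickening (hVK : V ⊆ K)
    (hV : V.Pairwise fun v w => 1 ≤ dist v w) (hε : 0 < ε) (hε' : ε < 1/8)
    (hstar : ∀ v ∈ V, ∀ x ∈ K, dist x v ≤ 2 * ε → segment ℝ v x ⊆ K) :
    Nonempty (K ≃ₕ (K ∪ ⋃ v ∈ V, closedBall v ε : Set E)) := by
  have hK : ∀ t ∈ Icc (0 : ℝ) 1, ∀ x ∈ K, x - t • radialField V ε x ∈ K :=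
    fun t ht x hx => sub_radialField_mem hV hε hε' hstar ht hx
  have hcont := fun s => continuousOn_sub_radialField hV hε hε' 1 s
  simp only [one_mul] at hcont
  refine nonempty_homotopyEquiv_of_deformation subset_union_left
    (fun t x => x - t • radialField V ε x) (fun _ x => x) (hcont _) continuousOn_snd
    (fun x _ => by simp) ?_ ?_ (fun x _ => rfl) (fun t _ x hx => hx) hK
  · rintro t ht x (hx | hx)
    · exact Or.inl (hK t ht x hx)
    · simp only [mem_iUnion, mem_closedBall] at hx
      obtain ⟨v, hv, hxv⟩ := hx
      refine Or.inr (mem_biUnion hv ?_)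
      rw [sub_radialField_mem_closedBall hV hε hε' hv hxv, mem_closedBall, dist_eq_norm,
        add_sub_cancel_left, norm_smul, ← dist_eq_norm x v]
      have : ‖1 - t‖ ≤ 1 := by
        rw [Real.norm_of_nonneg (by linarith [ht.2])]
        linarith [ht.1]
      nlinarith [dist_nonneg (x := x) (y := v)]
  · rintro x (hx | hx)
    · exact hK 1 ⟨zero_le_one, le_rfl⟩ x hx
    · simp only [mem_iUnion, mem_closedBall] at hx
      obtain ⟨v, hv, hxv⟩ := hx
      rw [sub_radialField_mem_closedBall hV hε hε' hv hxv]
      simpa using hVK hv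

/-- Pushing the punctured balls to their boundary spheres. -/
theorem nonempty_homotopyEquiv_punctured (hVne : V.Nonempty)
    (hV : V.Pairwise fun v w => 1 ≤ dist v w) (hε : 0 < ε) (hε' : ε < 1/8) :
    Nonempty (((K ∪ ⋃ v ∈ V, closedBall v ε) \ ⋃ v ∈ V, ball v ε : Set E) ≃ₕ
      ((K ∪ ⋃ v ∈ V, closedBall v ε) \ V : Set E)) := by
  -- At `t = 1` the factor `ε / infDist x V` carries a point of a punctured ball to the boundary
  -- sphere. Truncation at 0 leaves all points at distance at least `ε` from `V` fixed.
  set P : ℝ → E → E := fun t x => x + (t * max 0 (ε / infDist x V - 1)) • radialField V ε x with hP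
  have hfix : ∀ t x, (∀ v ∈ V, ε ≤ dist x v) → P t x = x := by
    intro t x hx
    have h1 : ε ≤ infDist x V := (le_infDist hVne).2 fun v hv => hx v hv
    have h2 : ε / infDist x V ≤ 1 := (div_le_one (hε.trans_le h1)).2 h1
    simp only [hP]
    rw [max_eq_left (by linarith), mul_zero, zero_smul, add_zero]
  have hmove : ∀ t, ∀ v ∈ V, ∀ x, x ≠ v → dist x v ≤ ε →
      P t x = v + (1 + t * (ε / dist x v - 1)) • (x - v) := by
    intro t v hv x hxv hx
    simp only [hP]
    rw [infDist_eq_of_separated hV hv (by linarith), radialField_of_dist_le hV hε hε' hv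
      (by linarith), cutoff_eq_one hε hx, max_eq_right]
    · module
    · have := (one_le_div (dist_pos.2 hxv)).2 hx
      linarith
  have hdist : ∀ t, ∀ v ∈ V, ∀ x, x ≠ v → dist x v ≤ ε → 0 ≤ t →
      dist (P t x) v = (1 - t) * dist x v + t * ε := by
    intro t v hv x hxv hx ht
    have h0 := dist_pos.2 hxv
    have h1 := (one_le_div h0).2 hx
    rw [hmove t v hv x hxv hx, dist_eq_norm, add_sub_cancel_left, norm_smul, ← dist_eq_norm x v,
      Real.norm_of_nonneg (by nlinarith)]
    field_simp
    ring
  have hsub : ((K ∪ ⋃ v ∈ V, closedBall v ε) \ ⋃ v ∈ V, ball v ε : Set E) ⊆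
      (K ∪ ⋃ v ∈ V, closedBall v ε) \ V :=
    sdiff_subset_sdiff_right fun v hv => mem_biUnion hv (mem_ball_self hε)
  have hclosed : IsClosed V := isClosed_of_pairwise_le_dist zero_lt_one hV
  refine nonempty_homotopyEquiv_of_deformation hsub P (fun _ x => x) ?_ continuousOn_snd
    (fun x _ => by simp [hP]) ?_ ?_ (fun x _ => rfl) (fun t _ x hx => hx) ?_
  · have := continuous_radialField hV hε hε'
    have h1 : ContinuousOn (fun p : ℝ × E => ε / infDist p.2 V)
        (Icc 0 1 ×ˢ ((K ∪ ⋃ v ∈ V, closedBall v ε) \ V)) := by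
      refine continuousOn_const.div (by fun_prop) ?_
      rintro p ⟨-, -, hp⟩ h0
      exact hp ((hclosed.mem_iff_infDist_zero hVne).2 h0)
    exact continuousOn_snd.add ((continuousOn_fst.mul (continuousOn_const.sup
      (h1.sub continuousOn_const))).smul (by fun_prop))
  · rintro t ht x ⟨hx, hxV⟩
    by_cases h : ∃ v ∈ V, dist x v ≤ ε
    · obtain ⟨v, hv, hxv⟩ := h
      have hne : x ≠ v := fun h => hxV (h ▸ hv)
      have hd := hdist t v hv x hne hxv ht.1
      have h0 := dist_pos.2 hne
      have h1 : dist (P t x) v ≤ ε := by nlinarith [ht.1, ht.2]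
      refine ⟨Or.inr (mem_biUnion hv h1), fun hmem => ?_⟩
      have := eq_of_dist_lt_one_of_separated hV hmem hv (by linarith)
      rw [this, dist_self] at hd
      nlinarith [ht.1, ht.2]
    · push Not at h
      rw [hfix t x fun v hv => (h v hv).le]
      exact ⟨hx, hxV⟩
  · rintro x ⟨hx, hxV⟩
    by_cases h : ∃ v ∈ V, dist x v ≤ ε
    · obtain ⟨v, hv, hxv⟩ := h
      have hne : x ≠ v := fun h => hxV (h ▸ hv)
      have hd := hdist 1 v hv x hne hxv zero_le_one
      have hd' : dist (P 1 x) v = ε := by linarith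
      refine ⟨Or.inr (mem_biUnion hv hd'.le), fun hmem => ?_⟩
      simp only [mem_iUnion, mem_ball] at hmem
      obtain ⟨w, hw, hxw⟩ := hmem
      have := dist_triangle_left v w (P 1 x)
      rw [eq_of_dist_lt_one_of_separated hV hv hw (by linarith)] at hd'
      linarith
    · push Not at h
      rw [hfix 1 x fun v hv => (h v hv).le]
      refine ⟨hx, ?_⟩
      simp only [mem_iUnion, mem_ball, not_exists, not_lt]
      exact fun v hv => (h v hv).le
  · rintro t - x ⟨hx, hx'⟩
    have : ∀ v ∈ V, ε ≤ dist x v := by simpa using hx'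
    rw [hfix t x this]
    exact ⟨hx, hx'⟩

end Thickened

/-- A retraction along segments onto a subset is a homotopy equivalence. -/
theorem nonempty_homotopyEquiv_of_retraction (hKX : K ⊆ X) (ρ : E → E) (hρ : ContinuousOn ρ X)
    (hρK : ∀ x ∈ X, ρ x ∈ K) (hfix : ∀ x ∈ K, ρ x = x)
    (hseg : ∀ x ∈ X, ∀ t ∈ Icc (0 : ℝ) 1, x + t • (ρ x - x) ∈ X) : Nonempty (K ≃ₕ X) := by
  refine nonempty_homotopyEquiv_of_deformation hKX (fun t x => x + t • (ρ x - x)) (fun _ x => x)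
    ?_ continuousOn_snd (fun x _ => by simp) (fun t ht x hx => hseg x hx t ht) (fun x hx => ?_)
    (fun x _ => rfl) (fun t _ x hx => hx) ?_
  · have : ContinuousOn (fun p : ℝ × E => ρ p.2) (Icc 0 1 ×ˢ X) :=
      hρ.comp continuousOn_snd fun p hp => hp.2
    fun_prop
  · simpa using hρK x hx
  · intro t _ x hx
    simpa [hfix x hx] using hx

/-- The punctured version of `nonempty_homotopyEquiv_of_retraction`: the homotopy along the
segments to the retraction stops short of the points of `V`. -/
theorem nonempty_homotopyEquiv_of_retraction_punctured {ε : ℝ} (hVK : V ⊆ K) (hKX : K ⊆ X)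
    (hVne : V.Nonempty) (hV : V.Pairwise fun v w => 1 ≤ dist v w) (hε : 0 < ε) (hε' : ε < 1/8)
    (hstar : ∀ v ∈ V, ∀ x ∈ K, dist x v ≤ 2 * ε → segment ℝ v x ⊆ K)
    (hball : ∀ v ∈ V, closedBall v ε ⊆ X)
    (ρ : E → E) (hρ : ContinuousOn ρ X)
    (hρK : ∀ x ∈ X, ρ x ∈ K) (hfix : ∀ x ∈ K, ρ x = x)
    (hseg : ∀ x ∈ X, ∀ t ∈ Icc (0 : ℝ) 1, x + t • (ρ x - x) ∈ X)
    (hray : ∀ x ∈ X, ∀ t ∈ Icc (0 : ℝ) 1, ρ (x + t • (ρ x - x)) = ρ x)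
    {R : ℝ} (hR : ∀ x ∈ X, dist x (ρ x) ≤ R)
    {δ : ℝ} (hδ : 0 < δ) (hnear : ∀ v ∈ V, ∀ x ∈ X, dist x v ≤ δ → dist (ρ x) v ≤ ε) :
    Nonempty (((K ∪ ⋃ v ∈ V, closedBall v ε) \ V : Set E) ≃ₕ (X \ V : Set E)) := by
  have hclosed : IsClosed V := isClosed_of_pairwise_le_dist zero_lt_one hV
  have hR0 : 0 ≤ R := by
    obtain ⟨v, hv⟩ := hVne
    exact dist_nonneg.trans (hR v (hKX (hVK hv)))
  -- Chosen so that `η + η * R = ε`: a stopped path ends within `η * R` of `ρ x`, which is itself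
  -- within `η` of `V`.
  set η : ℝ := ε / (1 + R) with hη
  have hη0 : 0 < η := by positivity
  have hηR : η + η * R = ε := by
    rw [hη]; field_simp
  have hη1 : η < 1 := by nlinarith
  -- The fraction of the segment to `ρ x` that is traversed: all of it if `ρ x` is at distance at
  -- least `η` from `V`, and `1 - η` if `ρ x` lies in `V`.
  set θ : E → ℝ := fun x => 1 - max 0 (η - infDist (ρ x) V) with hθ
  have hθ0 : ∀ x, 0 ≤ θ x := fun x => by
    have : max 0 (η - infDist (ρ x) V) ≤ 1 :=
      max_le zero_le_one (by linarith [infDist_nonneg (x := ρ x) (s := V)])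
    simp only [hθ]; linarith
  have hθ1 : ∀ x, θ x ≤ 1 := fun x => by
    have := le_max_left 0 (η - infDist (ρ x) V)
    simp only [hθ]; linarith
  have htθ : ∀ t ∈ Icc (0 : ℝ) 1, ∀ x, t * θ x ∈ Icc (0 : ℝ) 1 := fun t ht x =>
    ⟨mul_nonneg ht.1 (hθ0 x), mul_le_one₀ ht.2 (hθ0 x) (hθ1 x)⟩
  have hHX : ∀ t ∈ Icc (0 : ℝ) 1, ∀ x ∈ X \ V, x + (t * θ x) • (ρ x - x) ∈ X \ V := by
    rintro t ht x ⟨hx, hxV⟩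
    refine ⟨hseg x hx _ (htθ t ht x), fun hmem => ?_⟩
    -- A point of `V` on the path is fixed by `ρ`, so `hray` identifies it with `ρ x`. In that case
    -- the path stops strictly before its end, unless it is constant.
    have h1 := hray x hx _ (htθ t ht x)
    rw [hfix _ (hVK hmem)] at h1
    have h2 : (1 - t * θ x) • (x - ρ x) = 0 := by
      have : (1 - t * θ x) • (x - ρ x) = x + (t * θ x) • (ρ x - x) - ρ x := by module
      rw [this, h1, sub_self]
    rw [h1] at hmem
    rcases smul_eq_zero.1 h2 with h2 | h2
    · have h3 : infDist (ρ x) V = 0 := (hclosed.mem_iff_infDist_zero hVne).1 hmem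
      have h4 : θ x = 1 - η := by simp only [hθ, h3, sub_zero, max_eq_right hη0.le]
      rw [h4] at h2
      nlinarith [ht.1, ht.2]
    · rw [sub_eq_zero] at h2
      exact hxV (h2 ▸ hmem)
  -- Shrinking the balls by `1 - t₀` brings them within `δ` of their centres. Then `hnear` keeps the
  -- image under `ρ` in the same `ε`-ball, and convexity keeps the path there. Since `t₀ < 1`, the
  -- punctures are not hit.
  obtain ⟨t₀, ht₀, ht₀', ht₀δ⟩ : ∃ t₀ : ℝ, 0 ≤ t₀ ∧ t₀ < 1 ∧ (1 - t₀) * ε ≤ δ := by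
    refine ⟨1 - min 1 (δ / ε), ?_, ?_, ?_⟩
    · linarith [min_le_left 1 (δ / ε)]
    · linarith [lt_min one_pos (div_pos hδ hε)]
    · have h := min_le_right 1 (δ / ε)
      rw [le_div_iff₀ hε] at h
      linarith
  have htt : ∀ t ∈ Icc (0 : ℝ) 1, 0 ≤ t₀ * t ∧ t₀ * t < 1 := fun t ht =>
    ⟨mul_nonneg ht₀ ht.1, by nlinarith [ht.1, ht.2]⟩
  refine nonempty_homotopyEquiv_of_deformation ?_ (fun t x => x + (t * θ x) • (ρ x - x))
    (fun t x => x - (t₀ * t) • radialField V ε x) ?_ (continuousOn_sub_radialField hV hε hε' t₀ _)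
    (fun x _ => by simp) hHX ?_ (fun x _ => by simp) ?_ ?_
  · refine sdiff_subset_sdiff_left (union_subset hKX ?_)
    exact iUnion₂_subset hball
  · have h1 : ContinuousOn (fun p : ℝ × E => ρ p.2) (Icc 0 1 ×ˢ (X \ V)) :=
      hρ.comp continuousOn_snd fun p hp => hp.2.1
    have h2 : ContinuousOn (fun p : ℝ × E => infDist (ρ p.2) V) (Icc 0 1 ×ˢ (X \ V)) :=
      (continuous_infDist_pt V).comp_continuousOn h1
    simp only [hθ]
    exact continuousOn_snd.add ((continuousOn_fst.mul (continuousOn_const.sub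
      (continuousOn_const.sup (continuousOn_const.sub h2)))).smul (h1.sub continuousOn_snd))
  · rintro x hx
    refine ⟨?_, (hHX 1 ⟨zero_le_one, le_rfl⟩ x hx).2⟩
    rw [one_mul]
    by_cases h : η ≤ infDist (ρ x) V
    · have : θ x = 1 := by simp only [hθ]; rw [max_eq_left (by linarith), sub_zero]
      rw [this, one_smul, add_sub_cancel]
      exact Or.inl (hρK x hx.1)
    · obtain ⟨v, hv, hxv⟩ := (infDist_lt_iff hVne).1 (not_le.1 h)
      refine Or.inr (mem_biUnion hv ?_)
      rw [mem_closedBall, dist_eq_norm]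
      have e : x + θ x • (ρ x - x) - v = (1 - θ x) • (x - ρ x) + (ρ x - v) := by module
      have h1 : 1 - θ x ≤ η := by
        simp only [hθ, sub_sub_cancel]
        exact max_le hη0.le (by linarith [infDist_nonneg (x := ρ x) (s := V)])
      have h2 := hR x hx.1
      have h3 : ‖(1 - θ x) • (x - ρ x)‖ ≤ η * R := by
        rw [norm_smul, Real.norm_of_nonneg (by linarith [hθ1 x]), ← dist_eq_norm]
        exact mul_le_mul h1 h2 dist_nonneg hη0.le
      rw [e]
      refine (norm_add_le _ _).trans ?_
      rw [dist_eq_norm] at hxv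
      linarith
  · rintro t ht x ⟨hx | hx, hxV⟩
    · exact ⟨Or.inl (sub_radialField_mem hV hε hε' hstar ⟨(htt t ht).1, (htt t ht).2.le⟩ hx),
        sub_radialField_notMem hV hε hε' (htt t ht).1 (htt t ht).2 hxV⟩
    · refine ⟨Or.inr ?_, sub_radialField_notMem hV hε hε' (htt t ht).1 (htt t ht).2 hxV⟩
      simp only [mem_iUnion, mem_closedBall] at hx
      obtain ⟨v, hv, hxv⟩ := hx
      refine mem_biUnion hv ?_
      rw [sub_radialField_mem_closedBall hV hε hε' hv hxv, mem_closedBall, dist_eq_norm,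
        add_sub_cancel_left, norm_smul, ← dist_eq_norm x v,
        Real.norm_of_nonneg (by linarith [(htt t ht).2])]
      nlinarith [dist_nonneg (x := x) (y := v), (htt t ht).1]
  · rintro t ht x ⟨hx, hxV⟩
    have hnot := sub_radialField_notMem hV hε hε' ht₀ ht₀' hxV
    rw [mul_one]
    by_cases h : ∃ v ∈ V, dist x v ≤ ε
    · obtain ⟨v, hv, hxv⟩ := h
      have e := sub_radialField_mem_closedBall hV hε hε' (t := t₀) hv hxv
      set y := x - t₀ • radialField V ε x with hy
      have hyv : dist y v ≤ (1 - t₀) * ε := by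
        rw [e, dist_eq_norm, add_sub_cancel_left, norm_smul, ← dist_eq_norm x v,
          Real.norm_of_nonneg (by linarith)]
        exact mul_le_mul_of_nonneg_left hxv (by linarith)
      have hyε : y ∈ closedBall v ε := hyv.trans (by nlinarith)
      have hyX : y ∈ X := hball v hv hyε
      have hρy : ρ y ∈ closedBall v ε := hnear v hv y hyX (hyv.trans ht₀δ)
      refine ⟨Or.inr (mem_biUnion hv ?_), (hHX t ht y ⟨hyX, hnot⟩).2⟩
      have hc := (convex_closedBall v ε).add_smul_sub_mem hyε hρy (htθ t ht y)
      exact hc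
    · have hxK : x ∈ K := by
        rcases hx with hx | hx
        · exact hx
        · exact absurd (by simpa using hx) h
      have hyK := sub_radialField_mem hV hε hε' hstar ⟨ht₀, ht₀'.le⟩ hxK
      rw [hfix _ hyK, sub_self, smul_zero, add_zero]
      exact ⟨Or.inl hyK, hnot⟩

end Deformation

end ReflG4

namespace ReflG4

/-! ### The lattice `D₄` and the 24-cell -/

/-- The quaternion with the given coordinates. -/
def quat (a b c d : ℝ) : ℍ[ℝ] := ⟨a, b, c, d⟩

@[simp] theorem re_quat (a b c d : ℝ) : (quat a b c d).re = a := rfl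

@[simp] theorem imI_quat (a b c d : ℝ) : (quat a b c d).imI = b := rfl

@[simp] theorem imJ_quat (a b c d : ℝ) : (quat a b c d).imJ = c := rfl

@[simp] theorem imK_quat (a b c d : ℝ) : (quat a b c d).imK = d := rfl

theorem norm_sq_eq (x : ℍ[ℝ]) : ‖x‖ ^ 2 = x.re ^ 2 + x.imI ^ 2 + x.imJ ^ 2 + x.imK ^ 2 := by
  rw [sq, ← Quaternion.normSq_eq_norm_mul_self, Quaternion.normSq_def']

/-- The lattice `D₄` of integral quaternions with even coordinate sum. -/
def latticeD4 : AddSubgroup ℍ[ℝ] where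
  carrier := {x | ∃ a b c d : ℤ, (x.re = a ∧ x.imI = b ∧ x.imJ = c ∧ x.imK = d) ∧
    Even (a + b + c + d)}
  zero_mem' := ⟨0, 0, 0, 0, by simp, by simp⟩
  add_mem' := by
    rintro x y ⟨a, b, c, d, ⟨h1, h2, h3, h4⟩, h⟩ ⟨a', b', c', d', ⟨h1', h2', h3', h4'⟩, h'⟩
    refine ⟨a + a', b + b', c + c', d + d', ?_, ?_⟩
    · simp [h1, h2, h3, h4, h1', h2', h3', h4']
    · grind
  neg_mem' := by
    rintro x ⟨a, b, c, d, ⟨h1, h2, h3, h4⟩, h⟩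
    refine ⟨-a, -b, -c, -d, ?_, ?_⟩
    · simp [h1, h2, h3, h4]
    · grind

/-- The Voronoi cell of the origin in the lattice `D₄`. -/
def cell24 : Set ℍ[ℝ] := {y | (|y.re| + |y.imI| ≤ 1 ∧ |y.re| + |y.imJ| ≤ 1 ∧ |y.re| + |y.imK| ≤ 1) ∧
  |y.imI| + |y.imJ| ≤ 1 ∧ |y.imI| + |y.imK| ≤ 1 ∧ |y.imJ| + |y.imK| ≤ 1}

/-- The quaternions `1, i, j, k`. -/
def frame : Fin 4 → ℍ[ℝ] := ![1, quat 0 1 0 0, quat 0 0 1 0, quat 0 0 0 1]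

theorem frame_zero_mul (y : ℍ[ℝ]) : frame 0 * y = y := by simp [frame]

theorem frame_one_mul (y : ℍ[ℝ]) : frame 1 * y = quat (-y.imI) y.re (-y.imK) y.imJ := by
  ext <;> simp [frame]

theorem frame_two_mul (y : ℍ[ℝ]) : frame 2 * y = quat (-y.imJ) y.imK y.re (-y.imI) := by
  ext <;> simp [frame]

theorem frame_three_mul (y : ℍ[ℝ]) : frame 3 * y = quat (-y.imK) (-y.imJ) y.imI y.re := by
  ext <;> simp [frame]

theorem star_frame_mul_frame (a : Fin 4) : star (frame a) * frame a = 1 := by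
  fin_cases a <;> ext <;> simp [frame]

theorem frame_mul_star_frame (a : Fin 4) : frame a * star (frame a) = 1 := by
  fin_cases a <;> ext <;> simp [frame]

theorem frame_mul_star_frame_mul (a : Fin 4) (y : ℍ[ℝ]) : frame a * (star (frame a) * y) = y := by
  rw [← mul_assoc, frame_mul_star_frame, one_mul]

theorem star_frame_mul_frame_mul (a : Fin 4) (y : ℍ[ℝ]) : star (frame a) * (frame a * y) = y := by
  rw [← mul_assoc, star_frame_mul_frame, one_mul]

theorem norm_frame_mul (a : Fin 4) (y : ℍ[ℝ]) : ‖frame a * y‖ = ‖y‖ := by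
  refine (pow_left_inj₀ (norm_nonneg _) (norm_nonneg _) two_ne_zero).1 ?_
  rw [norm_sq_eq, norm_sq_eq]
  fin_cases a
  · simp [frame_zero_mul]
  · simp [frame_one_mul]; ring
  · simp [frame_two_mul]; ring
  · simp [frame_three_mul]; ring

theorem norm_star_frame_mul (a : Fin 4) (y : ℍ[ℝ]) : ‖star (frame a) * y‖ = ‖y‖ := by
  rw [← norm_frame_mul a, frame_mul_star_frame_mul]

theorem frame_mul_mem_cell24 {a : Fin 4} {y : ℍ[ℝ]} : frame a * y ∈ cell24 ↔ y ∈ cell24 := by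
  fin_cases a
  · simp [frame_zero_mul]
  · simp [frame_one_mul, cell24, add_comm]; tauto
  · simp [frame_two_mul, cell24, add_comm]; tauto
  · simp [frame_three_mul, cell24, add_comm]; tauto

theorem frame_mul_mem_latticeD4 (a : Fin 4) {y : ℍ[ℝ]} (hy : y ∈ latticeD4) :
    frame a * y ∈ latticeD4 := by
  obtain ⟨p, q, r, s, ⟨h1, h2, h3, h4⟩, h⟩ := hy
  fin_cases a
  · exact ⟨p, q, r, s, by simp [frame_zero_mul, *], h⟩
  · exact ⟨-q, p, -s, r, by simp [frame_one_mul, *], by grind⟩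
  · exact ⟨-r, s, p, -q, by simp [frame_two_mul, *], by grind⟩
  · exact ⟨-s, -r, q, p, by simp [frame_three_mul, *], by grind⟩

theorem star_frame_mul_mem_latticeD4 (a : Fin 4) {y : ℍ[ℝ]} (hy : y ∈ latticeD4) :
    star (frame a) * y ∈ latticeD4 := by
  have h : star (frame a) * y = frame a * y ∨ star (frame a) * y = -(frame a * y) := by
    fin_cases a
    · left; simp [frame]
    · right; ext <;> simp [frame]
    · right; ext <;> simp [frame]
    · right; ext <;> simp [frame]
  rcases h with h | h
  · rw [h]; exact frame_mul_mem_latticeD4 a hy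
  · rw [h]; exact neg_mem (frame_mul_mem_latticeD4 a hy)

/-- The left side is at most `2 * z0 * n0 + (2 - 2 * z0) * (n1 + n2 + n3)`, a convex combination of
`n0 + n1 + n2 + n3` and `2 * n0` with weights `2 - 2 * z0` and `2 * z0 - 1`. Both are at most the
sum of squares; for `2 * n0` with `n0 = 1` this uses the parity. -/
theorem two_mul_le_sum_sq_aux {z0 z1 z2 z3 : ℝ} {n0 n1 n2 n3 : ℤ}
    (h0 : 1/2 ≤ z0) (h0' : z0 ≤ 1) (h1 : z1 ≤ 1 - z0) (h2 : z2 ≤ 1 - z0) (h3 : z3 ≤ 1 - z0)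
    (k0 : 0 ≤ n0) (k1 : 0 ≤ n1) (k2 : 0 ≤ n2) (k3 : 0 ≤ n3) (he : Even (n0 + n1 + n2 + n3)) :
    2 * (z0 * n0 + z1 * n1 + z2 * n2 + z3 * n3) ≤ (n0 ^ 2 + n1 ^ 2 + n2 ^ 2 + n3 ^ 2 : ℝ) := by
  have hsq : ∀ n : ℤ, 0 ≤ n → n ≤ n ^ 2 := fun n hn => by
    rcases hn.eq_or_lt with h | h
    · simp [← h]
    · nlinarith
  have hA : n0 + n1 + n2 + n3 ≤ n0 ^ 2 + n1 ^ 2 + n2 ^ 2 + n3 ^ 2 := by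
    linarith [hsq n0 k0, hsq n1 k1, hsq n2 k2, hsq n3 k3]
  have hB : 2 * n0 ≤ n0 ^ 2 + n1 ^ 2 + n2 ^ 2 + n3 ^ 2 := by
    obtain ⟨m, hm⟩ := he
    by_cases h : 2 ≤ n0
    · nlinarith [sq_nonneg n1, sq_nonneg n2, sq_nonneg n3]
    · by_cases h' : n0 = 1
      · subst h'
        have : 1 ≤ n1 + n2 + n3 := by omega
        linarith [hsq n1 k1, hsq n2 k2, hsq n3 k3]
      · have : n0 = 0 := by omega
        subst this
        nlinarith [sq_nonneg n1, sq_nonneg n2, sq_nonneg n3]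
  have hA' : (n0 + n1 + n2 + n3 : ℝ) ≤ n0 ^ 2 + n1 ^ 2 + n2 ^ 2 + n3 ^ 2 := by exact_mod_cast hA
  have hB' : (2 * n0 : ℝ) ≤ n0 ^ 2 + n1 ^ 2 + n2 ^ 2 + n3 ^ 2 := by exact_mod_cast hB
  have k1' : (0 : ℝ) ≤ n1 := by exact_mod_cast k1
  have k2' : (0 : ℝ) ≤ n2 := by exact_mod_cast k2
  have k3' : (0 : ℝ) ≤ n3 := by exact_mod_cast k3
  have e1 := mul_le_mul_of_nonneg_right h1 k1'
  have e2 := mul_le_mul_of_nonneg_right h2 k2'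
  have e3 := mul_le_mul_of_nonneg_right h3 k3'
  have e4 := mul_le_mul_of_nonneg_left hA' (show 0 ≤ 2 - 2 * z0 by linarith)
  have e5 := mul_le_mul_of_nonneg_left hB' (show 0 ≤ 2 * z0 - 1 by linarith)
  nlinarith

/-- The inequalities for the 24 shortest lattice vectors imply those for all lattice vectors. After
passing to absolute values, either some coordinate of `y` is at least 1/2 and the previous lemma
applies, or all are at most 1/2 and `n ≤ n ^ 2` suffices in each coordinate. -/
theorem two_mul_inner_le_of_mem_cell24 {y : ℍ[ℝ]} (hy : y ∈ cell24) {e : ℍ[ℝ]}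
    (he : e ∈ latticeD4) :
    2 * (y.re * e.re + y.imI * e.imI + y.imJ * e.imJ + y.imK * e.imK) ≤ ‖e‖ ^ 2 := by
  obtain ⟨a, b, c, d, ⟨h1, h2, h3, h4⟩, hev⟩ := he
  obtain ⟨⟨c1, c2, c3⟩, c4, c5, c6⟩ := hy
  have habs : ∀ (z : ℝ) (n : ℤ), z * n ≤ |z| * (|n| : ℤ) := fun z n => by
    rw [Int.cast_abs, ← abs_mul]; exact le_abs_self _
  have hev' : Even (|a| + |b| + |c| + |d|) := by
    have h : ∀ n : ℤ, Even |n| ↔ Even n := fun n => even_abs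
    simp only [Int.even_add, h] at hev ⊢
    exact hev
  have hsq : ∀ n : ℤ, ((|n| : ℤ) : ℝ) ^ 2 = (n : ℝ) ^ 2 := fun n => by
    rw [Int.cast_abs, sq_abs]
  rw [norm_sq_eq, h1, h2, h3, h4, ← hsq a, ← hsq b, ← hsq c, ← hsq d]
  refine (mul_le_mul_of_nonneg_left (add_le_add (add_le_add (add_le_add (habs y.re a)
    (habs y.imI b)) (habs y.imJ c)) (habs y.imK d)) zero_le_two).trans ?_
  have n0 := abs_nonneg y.re
  have n1 := abs_nonneg y.imI
  have n2 := abs_nonneg y.imJ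
  have n3 := abs_nonneg y.imK
  have k0 := abs_nonneg a
  have k1 := abs_nonneg b
  have k2 := abs_nonneg c
  have k3 := abs_nonneg d
  clear hsq habs h1 h2 h3 h4 hev
  generalize |y.re| = z0 at *
  generalize |y.imI| = z1 at *
  generalize |y.imJ| = z2 at *
  generalize |y.imK| = z3 at *
  generalize |a| = a' at *
  generalize |b| = b' at *
  generalize |c| = c' at *
  generalize |d| = d' at *
  rcases le_total (1/2) z0 with h | h
  · exact two_mul_le_sum_sq_aux h (by linarith) (by linarith) (by linarith) (by linarith)
      k0 k1 k2 k3 hev'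
  rcases le_total (1/2) z1 with h' | h'
  · have := two_mul_le_sum_sq_aux (z0 := z1) (z1 := z0) (z2 := z2) (z3 := z3) h' (by linarith)
      (by linarith) (by linarith) (by linarith) k1 k0 k2 k3 (by grind)
    linarith
  rcases le_total (1/2) z2 with h'' | h''
  · have := two_mul_le_sum_sq_aux (z0 := z2) (z1 := z0) (z2 := z1) (z3 := z3) h'' (by linarith)
      (by linarith) (by linarith) (by linarith) k2 k0 k1 k3 (by grind)
    linarith
  rcases le_total (1/2) z3 with h3' | h3'
  · have := two_mul_le_sum_sq_aux (z0 := z3) (z1 := z0) (z2 := z1) (z3 := z2) h3' (by linarith)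
      (by linarith) (by linarith) (by linarith) k3 k0 k1 k2 (by grind)
    linarith
  have hsq' : ∀ n : ℤ, 0 ≤ n → ∀ z : ℝ, z ≤ 1/2 → 2 * (z * n) ≤ (n : ℝ) ^ 2 := fun n hn z hz => by
    have h1 : n ≤ n ^ 2 := by
      rcases hn.eq_or_lt with h | h
      · simp [← h]
      · nlinarith
    have h2 : (n : ℝ) ≤ (n : ℝ) ^ 2 := by exact_mod_cast h1
    have h3 : (0 : ℝ) ≤ n := by exact_mod_cast hn
    nlinarith
  linarith [hsq' a' k0 z0 h, hsq' b' k1 z1 h', hsq' c' k2 z2 h'', hsq' d' k3 z3 h3']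

theorem dist_sq_sub_dist_sq (x d t : ℍ[ℝ]) : dist x t ^ 2 - dist x d ^ 2 = ‖t - d‖ ^ 2 -
    2 * ((x - d).re * (t - d).re + (x - d).imI * (t - d).imI + (x - d).imJ * (t - d).imJ
      + (x - d).imK * (t - d).imK) := by
  rw [dist_eq_norm, dist_eq_norm, norm_sq_eq, norm_sq_eq, norm_sq_eq]
  simp
  ring

theorem mem_voronoiCell_latticeD4_iff_inner {x d : ℍ[ℝ]} (hd : d ∈ latticeD4) :
    x ∈ voronoiCell (latticeD4 : Set ℍ[ℝ]) d ↔ ∀ e ∈ latticeD4,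
      2 * ((x - d).re * e.re + (x - d).imI * e.imI + (x - d).imJ * e.imJ + (x - d).imK * e.imK)
        ≤ ‖e‖ ^ 2 := by
  constructor
  · intro h e he
    have h1 := h (e + d) (add_mem he hd)
    have h2 := dist_sq_sub_dist_sq x d (e + d)
    rw [add_sub_cancel_right] at h2
    nlinarith [pow_le_pow_left₀ dist_nonneg h1 2]
  · intro h t ht
    have h1 := h (t - d) (sub_mem ht hd)
    have h2 := dist_sq_sub_dist_sq x d t
    exact (pow_le_pow_iff_left₀ dist_nonneg dist_nonneg two_ne_zero).1 (by linarith)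

/-- For the forward direction only the 24 shortest vectors, with two entries ±1, have to be tested.
-/
theorem mem_voronoiCell_latticeD4_iff {x d : ℍ[ℝ]} (hd : d ∈ latticeD4) :
    x ∈ voronoiCell (latticeD4 : Set ℍ[ℝ]) d ↔ x - d ∈ cell24 := by
  rw [mem_voronoiCell_latticeD4_iff_inner hd]
  refine ⟨fun h => ?_, fun h e he => two_mul_inner_le_of_mem_cell24 h he⟩
  have h' : ∀ a b c d' : ℤ, Even (a + b + c + d') → 2 * ((x - d).re * a + (x - d).imI * b +
      (x - d).imJ * c + (x - d).imK * d') ≤ (a ^ 2 + b ^ 2 + c ^ 2 + d' ^ 2 : ℝ) := by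
    intro a b c d' hev
    have := h (quat a b c d') ⟨a, b, c, d', by simp, hev⟩
    rwa [norm_sq_eq] at this
  generalize x - d = y at h'
  have hab : ∀ s t : ℝ, s + t ≤ 1 → s - t ≤ 1 → -s + t ≤ 1 → -s - t ≤ 1 → |s| + |t| ≤ 1 := by
    intro s t _ _ _ _
    rcases abs_cases s with ⟨h, _⟩ | ⟨h, _⟩ <;> rcases abs_cases t with ⟨h', _⟩ | ⟨h', _⟩ <;>
      linarith
  refine ⟨⟨?_, ?_, ?_⟩, ?_, ?_, ?_⟩
  all_goals apply hab
  · have := h' 1 1 0 0 (by decide); push_cast at this; linarith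
  · have := h' 1 (-1) 0 0 (by decide); push_cast at this; linarith
  · have := h' (-1) 1 0 0 (by decide); push_cast at this; linarith
  · have := h' (-1) (-1) 0 0 (by decide); push_cast at this; linarith
  · have := h' 1 0 1 0 (by decide); push_cast at this; linarith
  · have := h' 1 0 (-1) 0 (by decide); push_cast at this; linarith
  · have := h' (-1) 0 1 0 (by decide); push_cast at this; linarith
  · have := h' (-1) 0 (-1) 0 (by decide); push_cast at this; linarith
  · have := h' 1 0 0 1 (by decide); push_cast at this; linarith
  · have := h' 1 0 0 (-1) (by decide); push_cast at this; linarith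
  · have := h' (-1) 0 0 1 (by decide); push_cast at this; linarith
  · have := h' (-1) 0 0 (-1) (by decide); push_cast at this; linarith
  · have := h' 0 1 1 0 (by decide); push_cast at this; linarith
  · have := h' 0 1 (-1) 0 (by decide); push_cast at this; linarith
  · have := h' 0 (-1) 1 0 (by decide); push_cast at this; linarith
  · have := h' 0 (-1) (-1) 0 (by decide); push_cast at this; linarith
  · have := h' 0 1 0 1 (by decide); push_cast at this; linarith
  · have := h' 0 1 0 (-1) (by decide); push_cast at this; linarith
  · have := h' 0 (-1) 0 1 (by decide); push_cast at this; linarith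
  · have := h' 0 (-1) 0 (-1) (by decide); push_cast at this; linarith
  · have := h' 0 0 1 1 (by decide); push_cast at this; linarith
  · have := h' 0 0 1 (-1) (by decide); push_cast at this; linarith
  · have := h' 0 0 (-1) 1 (by decide); push_cast at this; linarith
  · have := h' 0 0 (-1) (-1) (by decide); push_cast at this; linarith

/-- The set of points of `D₄` that are nearest to `x`. -/
def nearest (x : ℍ[ℝ]) : Set ℍ[ℝ] := {d | d ∈ latticeD4 ∧ x - d ∈ cell24}

theorem mem_nearest_iff_voronoiCell {x d : ℍ[ℝ]} :
    d ∈ nearest x ↔ d ∈ latticeD4 ∧ x ∈ voronoiCell (latticeD4 : Set ℍ[ℝ]) d :=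
  and_congr_right fun h => (mem_voronoiCell_latticeD4_iff h).symm

/-- The basic fixed line of a linear reflection. -/
def basicLine : Submodule ℝ ℍ[ℝ] where
  carrier := {y | y.re = 0 ∧ y.imI + y.imJ + y.imK = 0}
  zero_mem' := by simp
  add_mem' := by
    rintro x y ⟨h1, h2⟩ ⟨h3, h4⟩
    refine ⟨by simp [h1, h3], ?_⟩
    simp only [Quaternion.imI_add, Quaternion.imJ_add, Quaternion.imK_add]
    linarith
  smul_mem' := by
    rintro c x ⟨h1, h2⟩
    refine ⟨by simp [h1], ?_⟩
    simp only [Quaternion.imI_smul, Quaternion.imJ_smul, Quaternion.imK_smul, smul_eq_mul]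
    linear_combination c * h2

theorem mem_basicLine {y : ℍ[ℝ]} : y ∈ basicLine ↔ y.re = 0 ∧ y.imI + y.imJ + y.imK = 0 := Iff.rfl

/-- The translates to points of `D₄` of the fixed lines of the linear reflections. -/
def wall (d : ℍ[ℝ]) (a : Fin 4) : Set ℍ[ℝ] := {x | frame a * (x - d) ∈ basicLine}

/-- The union of all fixed hyperplanes, described via the lattice. -/
def walls : Set ℍ[ℝ] := {x | ∃ d ∈ latticeD4, ∃ a, x ∈ wall d a}

theorem eq_zero_of_frame_mul_mem_basicLine {a b : Fin 4} (hab : a ≠ b) {y : ℍ[ℝ]}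
    (ha : frame a * y ∈ basicLine) (hb : frame b * y ∈ basicLine) : y = 0 := by
  rw [mem_basicLine] at ha hb
  fin_cases a <;> fin_cases b <;> first | exact absurd rfl hab | skip
  all_goals
    simp [frame_zero_mul, frame_one_mul, frame_two_mul, frame_three_mul] at ha hb
    obtain ⟨h1, h2⟩ := ha
    obtain ⟨h3, h4⟩ := hb
    ext <;> simp <;> linarith

/-- If the real part `a` of `e` were nonzero, it would be ±1 and the imaginary parts of `y` and `e`
would agree, so the coordinate sum of `e` would be odd. So `a = 0` and `b + c + d` is even; adding
the pairwise bounds shows that its absolute value is at most 3/2, hence it is zero. -/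
theorem mem_basicLine_of_sub_mem_cell24 {y e : ℍ[ℝ]} (hy : y ∈ basicLine) (he : e ∈ latticeD4)
    (hye : y - e ∈ cell24) : e ∈ basicLine := by
  obtain ⟨a, b, c, d, ⟨h1, h2, h3, h4⟩, hev⟩ := he
  obtain ⟨k1, k2⟩ := hy
  obtain ⟨⟨c1, c2, c3⟩, c4, c5, c6⟩ := hye
  simp only [Quaternion.re_sub, Quaternion.imI_sub, Quaternion.imJ_sub, Quaternion.imK_sub,
    k1, h1, h2, h3, h4, zero_sub, abs_neg] at c1 c2 c3 c4 c5 c6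
  obtain ⟨m, hm⟩ := hev
  have ha : a = 0 := by
    by_contra ha
    have h : (1 : ℝ) ≤ |(a : ℝ)| := by exact_mod_cast Int.one_le_abs ha
    have e1 := abs_nonpos_iff.1 (show |y.imI - b| ≤ 0 by linarith)
    have e2 := abs_nonpos_iff.1 (show |y.imJ - c| ≤ 0 by linarith)
    have e3 := abs_nonpos_iff.1 (show |y.imK - d| ≤ 0 by linarith)
    have hs : (b + c + d : ℝ) = 0 := by linarith
    have hs' : b + c + d = 0 := by exact_mod_cast hs
    have ha1 : |(a : ℝ)| ≤ 1 := by linarith [abs_nonneg (y.imI - b)]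
    have ha1' : |a| ≤ 1 := by exact_mod_cast ha1
    rw [abs_le] at ha1'
    omega
  have h : |((b + c + d : ℤ) : ℝ)| < 2 := by
    have e : ((b + c + d : ℤ) : ℝ) = -((y.imI - b) + (y.imJ - c) + (y.imK - d)) := by
      push_cast; linarith
    rw [e, abs_neg]
    have := abs_add_three (y.imI - b) (y.imJ - c) (y.imK - d)
    linarith
  have h' : |b + c + d| < 2 := by exact_mod_cast h
  rw [abs_lt] at h'
  have hs : b + c + d = 0 := by omega
  refine ⟨by rw [h1, ha]; simp, ?_⟩
  rw [h2, h3, h4]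
  exact_mod_cast hs

/-- This turns the position of a face relative to the walls into a condition on its nearest lattice
points. -/
theorem nearest_subset_wall {x d : ℍ[ℝ]} {a : Fin 4} (hd : d ∈ latticeD4) (hx : x ∈ wall d a) :
    nearest x ⊆ wall d a := by
  rintro e ⟨he, hxe⟩
  refine mem_basicLine_of_sub_mem_cell24 hx (frame_mul_mem_latticeD4 a (sub_mem he hd)) ?_
  rw [← mul_sub, sub_sub_sub_cancel_right]
  exact frame_mul_mem_cell24.2 hxe

theorem wall_eq_of_mem {d e : ℍ[ℝ]} {a : Fin 4} (he : e ∈ wall d a) : wall d a = wall e a := by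
  ext x
  have h : frame a * (x - d) = frame a * (x - e) + frame a * (e - d) := by
    rw [← mul_add]; congr 1; abel
  change frame a * (x - d) ∈ basicLine ↔ frame a * (x - e) ∈ basicLine
  rw [h]
  exact basicLine.add_mem_iff_left he

/-- Two different points lie on at most one wall. -/
theorem wall_unique {d e x y : ℍ[ℝ]} {a b : Fin 4} (hxy : x ≠ y) (hx : x ∈ wall d a)
    (hy : y ∈ wall d a) (hx' : x ∈ wall e b) (hy' : y ∈ wall e b) : a = b := by
  by_contra hab
  have h : ∀ (c : Fin 4) (f : ℍ[ℝ]), x ∈ wall f c → y ∈ wall f c →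
      frame c * (x - y) ∈ basicLine := by
    intro c f h1 h2
    have := basicLine.sub_mem h1 h2
    rwa [← mul_sub, sub_sub_sub_cancel_right] at this
  exact hxy (sub_eq_zero.1 (eq_zero_of_frame_mul_mem_basicLine hab (h a d hx hy) (h b e hx' hy')))

end ReflG4

/-! ### Inner-product form of the 24-cell and its decomposition into rings -/

namespace ReflG4

noncomputable section

theorem inner_eq_coord (x y : ℍ[ℝ]) :
    inner ℝ x y = x.re * y.re + x.imI * y.imI + x.imJ * y.imJ + x.imK * y.imK := by
  rw [Quaternion.inner_def]
  simp

theorem two_mul_inner_le {y : ℍ[ℝ]} (hy : y ∈ cell24) {e : ℍ[ℝ]} (he : e ∈ latticeD4) :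
    2 * inner ℝ y e ≤ ‖e‖ ^ 2 := by
  rw [inner_eq_coord]
  exact two_mul_inner_le_of_mem_cell24 hy he

theorem mem_cell24_iff_inner {y : ℍ[ℝ]} :
    y ∈ cell24 ↔ ∀ e ∈ latticeD4, 2 * inner ℝ y e ≤ ‖e‖ ^ 2 := by
  have h1 := mem_voronoiCell_latticeD4_iff (x := y) (zero_mem latticeD4)
  have h2 := mem_voronoiCell_latticeD4_iff_inner (x := y) (zero_mem latticeD4)
  rw [sub_zero] at h1 h2
  rw [← h1, h2]
  simp only [inner_eq_coord]

/-- The points of the cell of the origin for which `e` is nearest as well. -/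
theorem sub_mem_cell24_iff {y e : ℍ[ℝ]} (hy : y ∈ cell24) (he : e ∈ latticeD4) :
    y - e ∈ cell24 ↔ ‖e‖ ^ 2 ≤ 2 * inner ℝ y e := by
  constructor
  · intro h
    have := two_mul_inner_le h (neg_mem he)
    rw [inner_neg_right, inner_sub_left, real_inner_self_eq_norm_sq, norm_neg] at this
    linarith
  · intro h
    refine mem_cell24_iff_inner.2 fun f hf => ?_
    have h1 := two_mul_inner_le hy (add_mem he hf)
    rw [inner_add_right, norm_add_sq_real] at h1
    rw [inner_sub_left]
    linarith

/-! ### The ring of octahedra around a fixed line -/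

/-- The average of the imaginary coordinates. -/
def mean (y : ℍ[ℝ]) : ℝ := (y.imI + y.imJ + y.imK) / 3

/-- Upper extent along the basic line. -/
def ringU (y : ℍ[ℝ]) : ℝ := max y.imI (max y.imJ y.imK) - mean y

/-- Lower extent along the basic line. -/
def ringW (y : ℍ[ℝ]) : ℝ := mean y - min y.imI (min y.imJ y.imK)

/-- A triangular norm orthogonal to the basic line. -/
def ringS (y : ℍ[ℝ]) : ℝ := max (|y.re| + mean y) (-2 * mean y)

/-- The opposite triangular norm orthogonal to the basic line. -/
def ringT (y : ℍ[ℝ]) : ℝ := max (|y.re| - mean y) (2 * mean y)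

/-- The part of the 24-cell near the basic line: a union of pyramids over a ring of six
octahedral facets. -/
def ringCell : Set ℍ[ℝ] := {y | ringS y ≤ ringW y ∧ ringT y ≤ ringU y ∧ ringU y + ringW y ≤ 1}

/-- Rescaling by `α` along the basic line and by `β` orthogonally to it. -/
def mix (α β : ℝ) (y : ℍ[ℝ]) : ℍ[ℝ] :=
  quat (β * y.re) (α * (y.imI - mean y) + β * mean y) (α * (y.imJ - mean y) + β * mean y)
    (α * (y.imK - mean y) + β * mean y)

theorem mean_mix (α β : ℝ) (y : ℍ[ℝ]) : mean (mix α β y) = β * mean y := by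
  simp only [mean, mix, imI_quat, imJ_quat, imK_quat]
  ring

theorem ringU_mix {α : ℝ} (hα : 0 ≤ α) (β : ℝ) (y : ℍ[ℝ]) : ringU (mix α β y) = α * ringU y := by
  rw [ringU, mean_mix, ringU]
  simp only [mix, imI_quat, imJ_quat, imK_quat, max_add_add_right, ← mul_max_of_nonneg _ _ hα,
    max_sub_sub_right]
  ring

theorem ringW_mix {α : ℝ} (hα : 0 ≤ α) (β : ℝ) (y : ℍ[ℝ]) : ringW (mix α β y) = α * ringW y := by
  rw [ringW, mean_mix, ringW]
  simp only [mix, imI_quat, imJ_quat, imK_quat, min_add_add_right, ← mul_min_of_nonneg _ _ hα,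
    min_sub_sub_right]
  ring

theorem ringS_mix (α : ℝ) {β : ℝ} (hβ : 0 ≤ β) (y : ℍ[ℝ]) : ringS (mix α β y) = β * ringS y := by
  rw [ringS, mean_mix, ringS, mul_max_of_nonneg _ _ hβ]
  simp only [mix, re_quat, abs_mul, abs_of_nonneg hβ]
  congr 1 <;> ring

theorem ringT_mix (α : ℝ) {β : ℝ} (hβ : 0 ≤ β) (y : ℍ[ℝ]) : ringT (mix α β y) = β * ringT y := by
  rw [ringT, mean_mix, ringT, mul_max_of_nonneg _ _ hβ]
  simp only [mix, re_quat, abs_mul, abs_of_nonneg hβ]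
  congr 1 <;> ring

theorem mix_mix (α β α' β' : ℝ) (y : ℍ[ℝ]) :
    mix α β (mix α' β' y) = mix (α * α') (β * β') y := by
  ext <;> simp only [mix, re_quat, imI_quat, imJ_quat, imK_quat, mean] <;> ring

theorem mix_self (α : ℝ) (y : ℍ[ℝ]) : mix α α y = α • y := by
  ext <;> simp [mix, mean] <;> ring

theorem mix_one_one (y : ℍ[ℝ]) : mix 1 1 y = y := by
  rw [mix_self, one_smul]

theorem mix_sub (α β : ℝ) (x y : ℍ[ℝ]) : mix α β (x - y) = mix α β x - mix α β y := by
  ext <;> simp [mix, mean] <;> ring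

theorem add_smul_mix_sub (t α β : ℝ) (y : ℍ[ℝ]) :
    y + t • (mix α β y - y) = mix (1 - t + t * α) (1 - t + t * β) y := by
  ext <;> simp [mix, mean] <;> ring

theorem mix_of_mem_basicLine (α β : ℝ) {y : ℍ[ℝ]} (hy : y ∈ basicLine) : mix α β y = α • y := by
  obtain ⟨h1, h2⟩ := hy
  have h3 : mean y = 0 := by rw [mean, h2, zero_div]
  ext <;> simp [mix, h1, h3]

theorem mix_mem_basicLine_iff (α : ℝ) {β : ℝ} (hβ : β ≠ 0) {y : ℍ[ℝ]} :
    mix α β y ∈ basicLine ↔ y ∈ basicLine := by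
  rw [mem_basicLine, mem_basicLine]
  have h : (mix α β y).imI + (mix α β y).imJ + (mix α β y).imK =
      β * (y.imI + y.imJ + y.imK) := by
    simp only [mix, imI_quat, imJ_quat, imK_quat, mean]; ring
  rw [h]
  simp [mix, hβ]

theorem mix_zero_mem_basicLine (α : ℝ) (y : ℍ[ℝ]) : mix α 0 y ∈ basicLine := by
  refine ⟨by simp [mix], ?_⟩
  simp only [mix, imI_quat, imJ_quat, imK_quat, mean]; ring

theorem ringU_nonneg (y : ℍ[ℝ]) : 0 ≤ ringU y := by
  have h1 := le_max_left y.imI (max y.imJ y.imK)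
  have h2 := (le_max_left y.imJ y.imK).trans (le_max_right y.imI _)
  have h3 := (le_max_right y.imJ y.imK).trans (le_max_right y.imI _)
  simp only [ringU, mean]
  linarith

theorem ringW_nonneg (y : ℍ[ℝ]) : 0 ≤ ringW y := by
  have h1 := min_le_left y.imI (min y.imJ y.imK)
  have h2 := (min_le_right y.imI (min y.imJ y.imK)).trans (min_le_left _ _)
  have h3 := (min_le_right y.imI (min y.imJ y.imK)).trans (min_le_right _ _)
  simp only [ringW, mean]
  linarith

theorem ringS_pos {y : ℍ[ℝ]} (hy : y ∉ basicLine) : 0 < ringS y := by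
  by_contra h
  have h1 := (le_max_left _ _).trans (not_lt.1 h)
  have h2 := (le_max_right _ _).trans (not_lt.1 h)
  have h3 := abs_nonneg y.re
  refine hy ⟨abs_nonpos_iff.1 (by linarith), ?_⟩
  simp only [mean] at h1 h2
  linarith

theorem ringT_pos {y : ℍ[ℝ]} (hy : y ∉ basicLine) : 0 < ringT y := by
  by_contra h
  have h1 := (le_max_left _ _).trans (not_lt.1 h)
  have h2 := (le_max_right _ _).trans (not_lt.1 h)
  have h3 := abs_nonneg y.re
  refine hy ⟨abs_nonpos_iff.1 (by linarith), ?_⟩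
  simp only [mean] at h1 h2
  linarith

theorem ringU_add_ringW (y : ℍ[ℝ]) :
    ringU y + ringW y = max y.imI (max y.imJ y.imK) - min y.imI (min y.imJ y.imK) := by
  simp only [ringU, ringW]; ring

/-- Each defining form of the 24-cell is at most `ringU + ringW`: for instance `|re| + imI` is at
most `(|re| + mean) + ringU`, and `-(imI + imJ) = imK - 3 * mean` is at most `-2 * mean + ringU`. -/
theorem ringCell_subset_cell24 : ringCell ⊆ cell24 := by
  rintro y ⟨h1, h2, h3⟩
  rw [ringU_add_ringW] at h3
  have a1 := (le_max_left _ _).trans h1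
  have a2 := (le_max_right _ _).trans h1
  have a3 := (le_max_left _ _).trans h2
  have a4 := (le_max_right _ _).trans h2
  simp only [ringW, ringU, mean] at a1 a2 a3 a4
  have m1 := le_max_left y.imI (max y.imJ y.imK)
  have m2 := (le_max_left y.imJ y.imK).trans (le_max_right y.imI _)
  have m3 := (le_max_right y.imJ y.imK).trans (le_max_right y.imI _)
  have n1 := min_le_left y.imI (min y.imJ y.imK)
  have n2 := (min_le_right y.imI (min y.imJ y.imK)).trans (min_le_left _ _)
  have n3 := (min_le_right y.imI (min y.imJ y.imK)).trans (min_le_right _ _)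
  refine ⟨⟨?_, ?_, ?_⟩, ?_, ?_, ?_⟩
  · rcases abs_cases y.imI with ⟨h, _⟩ | ⟨h, _⟩ <;> linarith
  · rcases abs_cases y.imJ with ⟨h, _⟩ | ⟨h, _⟩ <;> linarith
  · rcases abs_cases y.imK with ⟨h, _⟩ | ⟨h, _⟩ <;> linarith
  · rcases abs_cases y.imI with ⟨h, _⟩ | ⟨h, _⟩ <;>
      rcases abs_cases y.imJ with ⟨h', _⟩ | ⟨h', _⟩ <;> linarith
  · rcases abs_cases y.imI with ⟨h, _⟩ | ⟨h, _⟩ <;>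
      rcases abs_cases y.imK with ⟨h', _⟩ | ⟨h', _⟩ <;> linarith
  · rcases abs_cases y.imJ with ⟨h, _⟩ | ⟨h, _⟩ <;>
      rcases abs_cases y.imK with ⟨h', _⟩ | ⟨h', _⟩ <;> linarith

theorem ringU_add_ringW_le_one {y : ℍ[ℝ]} (hy : y ∈ cell24) : ringU y + ringW y ≤ 1 := by
  obtain ⟨-, h1, h2, h3⟩ := hy
  rw [ringU_add_ringW]
  have a1 := abs_le.1 (le_refl |y.imI|)
  have a2 := abs_le.1 (le_refl |y.imJ|)
  have a3 := abs_le.1 (le_refl |y.imK|)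
  have b1 := abs_nonneg y.imI
  have b2 := abs_nonneg y.imJ
  have b3 := abs_nonneg y.imK
  rcases max_choice y.imI (max y.imJ y.imK) with h | h <;>
    rcases max_choice y.imJ y.imK with h' | h' <;>
    rcases min_choice y.imI (min y.imJ y.imK) with k | k <;>
    rcases min_choice y.imJ y.imK with k' | k' <;>
    rw [h, k] <;> (try rw [h']) <;> (try rw [k']) <;> linarith

theorem imI_sub_imJ_le (y : ℍ[ℝ]) : |y.imI - y.imJ| ≤ ringU y + ringW y ∧
    |y.imI - y.imK| ≤ ringU y + ringW y ∧ |y.imJ - y.imK| ≤ ringU y + ringW y := by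
  rw [ringU_add_ringW]
  have m1 := le_max_left y.imI (max y.imJ y.imK)
  have m2 := (le_max_left y.imJ y.imK).trans (le_max_right y.imI _)
  have m3 := (le_max_right y.imJ y.imK).trans (le_max_right y.imI _)
  have n1 := min_le_left y.imI (min y.imJ y.imK)
  have n2 := (min_le_right y.imI (min y.imJ y.imK)).trans (min_le_left _ _)
  have n3 := (min_le_right y.imI (min y.imJ y.imK)).trans (min_le_right _ _)
  refine ⟨abs_le.2 ⟨?_, ?_⟩, abs_le.2 ⟨?_, ?_⟩, abs_le.2 ⟨?_, ?_⟩⟩ <;> linarith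

/-- Conversely, if the hexagon gauge dominates all six sums, cancelling `ringU` or `ringW` from
these bounds gives the inequalities of the ring. Thus a ring consists of the points where the
largest form of the cell comes from a lattice vector on the basic line. -/
theorem mem_ringCell_of_le {y : ℍ[ℝ]} (hy : y ∈ cell24)
    (h : ∀ z, (z = |y.re| + |y.imI| ∨ z = |y.re| + |y.imJ| ∨ z = |y.re| + |y.imK| ∨
      z = |y.imI| + |y.imJ| ∨ z = |y.imI| + |y.imK| ∨ z = |y.imJ| + |y.imK|) →
      z ≤ ringU y + ringW y) : y ∈ ringCell := by
  refine ⟨?_, ?_, ringU_add_ringW_le_one hy⟩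
  all_goals
    rw [ringU_add_ringW] at h
    have g1 := h _ (Or.inl rfl)
    have g2 := h _ (Or.inr (Or.inl rfl))
    have g3 := h _ (Or.inr (Or.inr (Or.inl rfl)))
    have g4 := h _ (Or.inr (Or.inr (Or.inr (Or.inl rfl))))
    have g5 := h _ (Or.inr (Or.inr (Or.inr (Or.inr (Or.inl rfl)))))
    have g6 := h _ (Or.inr (Or.inr (Or.inr (Or.inr (Or.inr rfl)))))
    have a1 := abs_le.1 (le_refl |y.imI|)
    have a2 := abs_le.1 (le_refl |y.imJ|)
    have a3 := abs_le.1 (le_refl |y.imK|)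
    refine max_le ?_ ?_ <;> simp only [ringU, ringW, mean] <;>
    rcases max_choice y.imI (max y.imJ y.imK) with h | h <;>
    rcases max_choice y.imJ y.imK with h' | h' <;>
    rcases min_choice y.imI (min y.imJ y.imK) with k | k <;>
    rcases min_choice y.imJ y.imK with k' | k' <;>
    linarith

/-- The 24-cell is the union of four rings. -/
theorem exists_frame_mul_mem_ringCell {y : ℍ[ℝ]} (hy : y ∈ cell24) :
    ∃ a, frame a * y ∈ ringCell := by
  have hy' := fun a => (frame_mul_mem_cell24 (a := a)).2 hy
  obtain ⟨z, hz, hmax⟩ : ∃ z ∈ ({|y.re| + |y.imI|, |y.re| + |y.imJ|, |y.re| + |y.imK|,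
      |y.imI| + |y.imJ|, |y.imI| + |y.imK|, |y.imJ| + |y.imK|} : Finset ℝ),
      ∀ w ∈ ({|y.re| + |y.imI|, |y.re| + |y.imJ|, |y.re| + |y.imK|,
      |y.imI| + |y.imJ|, |y.imI| + |y.imK|, |y.imJ| + |y.imK|} : Finset ℝ), w ≤ z :=
    Finset.exists_max_image _ id (by simp)
  simp only [Finset.mem_insert, Finset.mem_singleton, forall_eq_or_imp, forall_eq] at hz hmax
  obtain ⟨g1, g2, g3, g4, g5, g6⟩ := hmax
  -- The largest sum is the value at `y` of a form `±y_p ± y_q`. Each such form becomes a difference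
  -- of two imaginary coordinates after multiplication by a suitable `frame a`, as each of the four
  -- lines carries six of the 24 shortest vectors.
  have key : ∃ a, z ≤ ringU (frame a * y) + ringW (frame a * y) := by
    obtain ⟨b1, b2, b3⟩ := imI_sub_imJ_le (frame 0 * y)
    obtain ⟨c1, c2, c3⟩ := imI_sub_imJ_le (frame 1 * y)
    obtain ⟨d1, d2, d3⟩ := imI_sub_imJ_le (frame 2 * y)
    obtain ⟨e1, e2, e3⟩ := imI_sub_imJ_le (frame 3 * y)
    by_contra hcon
    push Not at hcon
    have l0 := hcon 0
    have l1 := hcon 1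
    have l2 := hcon 2
    have l3 := hcon 3
    replace b1 := abs_lt.1 (b1.trans_lt l0)
    replace b2 := abs_lt.1 (b2.trans_lt l0)
    replace b3 := abs_lt.1 (b3.trans_lt l0)
    replace c1 := abs_lt.1 (c1.trans_lt l1)
    replace c2 := abs_lt.1 (c2.trans_lt l1)
    replace c3 := abs_lt.1 (c3.trans_lt l1)
    replace d1 := abs_lt.1 (d1.trans_lt l2)
    replace d2 := abs_lt.1 (d2.trans_lt l2)
    replace d3 := abs_lt.1 (d3.trans_lt l2)
    replace e1 := abs_lt.1 (e1.trans_lt l3)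
    replace e2 := abs_lt.1 (e2.trans_lt l3)
    replace e3 := abs_lt.1 (e3.trans_lt l3)
    simp only [frame_zero_mul, frame_one_mul, frame_two_mul, frame_three_mul, imI_quat, imJ_quat,
      imK_quat] at b1 b2 b3 c1 c2 c3 d1 d2 d3 e1 e2 e3
    clear hcon l0 l1 l2 l3 hy hy' g1 g2 g3 g4 g5 g6
    rcases hz with hz | hz | hz | hz | hz | hz
    · rcases abs_choice y.re with h | h <;> rcases abs_choice y.imI with h' | h' <;>
        rw [h, h'] at hz <;> linarith
    · rcases abs_choice y.re with h | h <;> rcases abs_choice y.imJ with h' | h' <;>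
        rw [h, h'] at hz <;> linarith
    · rcases abs_choice y.re with h | h <;> rcases abs_choice y.imK with h' | h' <;>
        rw [h, h'] at hz <;> linarith
    · rcases abs_choice y.imI with h | h <;> rcases abs_choice y.imJ with h' | h' <;>
        rw [h, h'] at hz <;> linarith
    · rcases abs_choice y.imI with h | h <;> rcases abs_choice y.imK with h' | h' <;>
        rw [h, h'] at hz <;> linarith
    · rcases abs_choice y.imJ with h | h <;> rcases abs_choice y.imK with h' | h' <;>
        rw [h, h'] at hz <;> linarith
  obtain ⟨a, ha⟩ := key
  refine ⟨a, mem_ringCell_of_le (hy' a) fun w hw => le_trans ?_ ha⟩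
  revert hw
  fin_cases a <;>
    simp only [Fin.zero_eta, Fin.mk_one, Fin.reduceFinMk, frame_zero_mul, frame_one_mul,
      frame_two_mul, frame_three_mul, re_quat, imI_quat, imJ_quat, imK_quat, abs_neg] <;>
    rintro (h | h | h | h | h | h) <;> linarith

end

end ReflG4

/-! ### Nearest lattice points on the boundary of a ring -/

namespace ReflG4

noncomputable section

theorem sub_quat_mem_cell24 {y : ℍ[ℝ]} (hy : y ∈ cell24) {a b c d : ℤ}
    (hev : Even (a + b + c + d))
    (h : (a ^ 2 + b ^ 2 + c ^ 2 + d ^ 2 : ℝ) ≤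
      2 * (y.re * a + y.imI * b + y.imJ * c + y.imK * d)) :
    quat a b c d ∈ latticeD4 ∧ y - quat a b c d ∈ cell24 := by
  have h' : quat a b c d ∈ latticeD4 := ⟨a, b, c, d, by simp, hev⟩
  refine ⟨h', (sub_mem_cell24_iff hy h').2 ?_⟩
  rw [norm_sq_eq, inner_eq_coord]
  exact h

/-- The vector with entry 1 at the largest and -1 at the smallest imaginary coordinate lies on the
basic line, and its inequality is an equality at `y`. -/
theorem exists_sub_mem_cell24_of_gauge_eq_one {y : ℍ[ℝ]} (hy : y ∈ cell24)
    (hg : ringU y + ringW y = 1) :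
    ∃ e ∈ latticeD4, e ∈ basicLine ∧ e ≠ 0 ∧ y - e ∈ cell24 := by
  rw [ringU_add_ringW] at hg
  have key : ∀ b c d : ℤ, b + c + d = 0 → (b ≠ 0 ∨ c ≠ 0) → (b ^ 2 + c ^ 2 + d ^ 2 : ℝ) ≤
      2 * (y.imI * b + y.imJ * c + y.imK * d) →
      ∃ e ∈ latticeD4, e ∈ basicLine ∧ e ≠ 0 ∧ y - e ∈ cell24 := by
    intro b c d h0 h1 h2
    obtain ⟨h3, h4⟩ := sub_quat_mem_cell24 hy (a := 0) (b := b) (c := c) (d := d)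
      (by rw [zero_add, h0]; exact ⟨0, rfl⟩) (by push_cast; linarith)
    refine ⟨_, h3, ⟨by simp, ?_⟩, fun h => ?_, h4⟩
    · simp only [imI_quat, imJ_quat, imK_quat]
      exact_mod_cast h0
    · have e1 := congrArg (fun q : ℍ[ℝ] => q.imI) h
      have e2 := congrArg (fun q : ℍ[ℝ] => q.imJ) h
      simp only [imI_quat, imJ_quat, Quaternion.imI_zero, Quaternion.imJ_zero,
        Int.cast_eq_zero] at e1 e2
      tauto
  rcases max_choice y.imI (max y.imJ y.imK) with h | h <;>
    rcases max_choice y.imJ y.imK with h' | h' <;>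
    rcases min_choice y.imI (min y.imJ y.imK) with k | k <;>
    rcases min_choice y.imJ y.imK with k' | k' <;>
    first
    | exact key 1 (-1) 0 (by norm_num) (by norm_num) (by push_cast; linarith)
    | exact key 1 0 (-1) (by norm_num) (by norm_num) (by push_cast; linarith)
    | exact key 0 1 (-1) (by norm_num) (by norm_num) (by push_cast; linarith)
    | exact key (-1) 1 0 (by norm_num) (by norm_num) (by push_cast; linarith)
    | exact key (-1) 0 1 (by norm_num) (by norm_num) (by push_cast; linarith)
    | exact key 0 (-1) 1 (by norm_num) (by norm_num) (by push_cast; linarith)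

/-- Replacing `ringW` by `ringS` in the gauge gives `ringU + ringS = 1`, which says that `|re|` plus
the largest imaginary coordinate, or minus the sum of the other two, equals 1. Either way a shortest
vector off the line is tight. The case of `ringT` is symmetric. -/
theorem exists_sub_mem_cell24_notMem_basicLine {y : ℍ[ℝ]} (hy : y ∈ cell24)
    (hg : ringU y + ringW y = 1) (h : ringS y = ringW y ∨ ringT y = ringU y) :
    ∃ e ∈ latticeD4, e ∉ basicLine ∧ y - e ∈ cell24 := by
  have key : ∀ a b c d : ℤ, Even (a + b + c + d) → (a ≠ 0 ∨ b + c + d ≠ 0) →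
      (a ^ 2 + b ^ 2 + c ^ 2 + d ^ 2 : ℝ) ≤
      2 * (y.re * a + y.imI * b + y.imJ * c + y.imK * d) →
      ∃ e ∈ latticeD4, e ∉ basicLine ∧ y - e ∈ cell24 := by
    intro a b c d h0 h1 h2
    obtain ⟨h3, h4⟩ := sub_quat_mem_cell24 hy h0 h2
    refine ⟨_, h3, fun ⟨k1, k2⟩ => ?_, h4⟩
    simp only [re_quat, imI_quat, imJ_quat, imK_quat] at k1 k2
    norm_cast at k1 k2
    tauto
  rcases h with h | h
  · have hS : ringU y + ringS y = 1 := by linarith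
    simp only [ringU, ringS, mean] at hS
    rcases max_choice (|y.re| + (y.imI + y.imJ + y.imK) / 3)
      (-2 * ((y.imI + y.imJ + y.imK) / 3)) with k | k <;> rw [k] at hS
    · rcases abs_choice y.re with k' | k' <;> rw [k'] at hS <;>
      rcases max_choice y.imI (max y.imJ y.imK) with h | h <;>
      rcases max_choice y.imJ y.imK with h' | h' <;>
      first
      | exact key 1 1 0 0 (by decide) (by norm_num) (by push_cast; linarith)
      | exact key 1 0 1 0 (by decide) (by norm_num) (by push_cast; linarith)
      | exact key 1 0 0 1 (by decide) (by norm_num) (by push_cast; linarith)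
      | exact key (-1) 1 0 0 (by decide) (by norm_num) (by push_cast; linarith)
      | exact key (-1) 0 1 0 (by decide) (by norm_num) (by push_cast; linarith)
      | exact key (-1) 0 0 1 (by decide) (by norm_num) (by push_cast; linarith)
    · rcases max_choice y.imI (max y.imJ y.imK) with h | h <;>
      rcases max_choice y.imJ y.imK with h' | h' <;>
      first
      | exact key 0 0 (-1) (-1) (by decide) (by norm_num) (by push_cast; linarith)
      | exact key 0 (-1) 0 (-1) (by decide) (by norm_num) (by push_cast; linarith)
      | exact key 0 (-1) (-1) 0 (by decide) (by norm_num) (by push_cast; linarith)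
  · have hS : ringT y + ringW y = 1 := by linarith
    simp only [ringW, ringT, mean] at hS
    rcases max_choice (|y.re| - (y.imI + y.imJ + y.imK) / 3)
      (2 * ((y.imI + y.imJ + y.imK) / 3)) with k | k <;> rw [k] at hS
    · rcases abs_choice y.re with k' | k' <;> rw [k'] at hS <;>
      rcases min_choice y.imI (min y.imJ y.imK) with h | h <;>
      rcases min_choice y.imJ y.imK with h' | h' <;>
      first
      | exact key 1 (-1) 0 0 (by decide) (by norm_num) (by push_cast; linarith)
      | exact key 1 0 (-1) 0 (by decide) (by norm_num) (by push_cast; linarith)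
      | exact key 1 0 0 (-1) (by decide) (by norm_num) (by push_cast; linarith)
      | exact key (-1) (-1) 0 0 (by decide) (by norm_num) (by push_cast; linarith)
      | exact key (-1) 0 (-1) 0 (by decide) (by norm_num) (by push_cast; linarith)
      | exact key (-1) 0 0 (-1) (by decide) (by norm_num) (by push_cast; linarith)
    · rcases min_choice y.imI (min y.imJ y.imK) with h | h <;>
      rcases min_choice y.imJ y.imK with h' | h' <;>
      first
      | exact key 0 0 1 1 (by decide) (by norm_num) (by push_cast; linarith)
      | exact key 0 1 0 1 (by decide) (by norm_num) (by push_cast; linarith)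
      | exact key 0 1 1 0 (by decide) (by norm_num) (by push_cast; linarith)

theorem mix_mem_ringCell {y : ℍ[ℝ]} {α β : ℝ} (hα : 0 ≤ α) (hβ : 0 ≤ β)
    (h1 : β * ringS y ≤ α * ringW y) (h2 : β * ringT y ≤ α * ringU y)
    (h3 : α * (ringU y + ringW y) ≤ 1) : mix α β y ∈ ringCell := by
  refine ⟨?_, ?_, ?_⟩
  · rwa [ringS_mix _ hβ, ringW_mix hα]
  · rwa [ringT_mix _ hβ, ringU_mix hα]
  · rwa [ringU_mix hα, ringW_mix hα, ← mul_add]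

/-- In the interior of the cell, the centre is the only nearest lattice point. -/
theorem eq_zero_of_sub_mem_cell24 {y e : ℍ[ℝ]} (hy : y ∈ ringCell) (hg : ringU y + ringW y < 1)
    (he : e ∈ latticeD4) (hye : y - e ∈ cell24) : e = 0 := by
  have hg0 := add_nonneg (ringU_nonneg y) (ringW_nonneg y)
  set g := ringU y + ringW y with hgdef
  -- As `g < 1`, the factor `2 / (1 + g)` exceeds 1 while the gauge stays at most 1. A nonzero
  -- lattice vector tight at `y` would violate its inequality at this multiple.
  have hc : (2 / (1 + g)) • y ∈ cell24 := by
    rw [← mix_self]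
    have h0 : 0 ≤ 2 / (1 + g) := by positivity
    refine ringCell_subset_cell24 (mix_mem_ringCell h0 h0 (mul_le_mul_of_nonneg_left hy.1 h0)
      (mul_le_mul_of_nonneg_left hy.2.1 h0) ?_)
    rw [← hgdef, div_mul_eq_mul_div, div_le_one (by linarith)]
    linarith
  have h1 := two_mul_inner_le hc he
  have h2 := (sub_mem_cell24_iff (ringCell_subset_cell24 hy) he).1 hye
  rw [real_inner_smul_left] at h1
  have h3 : 1 < 2 / (1 + g) := by rw [lt_div_iff₀ (by linarith)]; linarith
  have h4 : ‖e‖ ^ 2 ≤ 0 := by nlinarith [sq_nonneg ‖e‖]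
  have h5 : ‖e‖ = 0 := by nlinarith [norm_nonneg e, sq_nonneg ‖e‖]
  exact norm_eq_zero.1 h5

/-- Away from the lateral boundary of the ring, all nearest lattice points are on the
basic line. -/
theorem mem_basicLine_of_sub_mem_cell24_of_lt {y e : ℍ[ℝ]} (hy : y ∈ ringCell) {c : ℝ}
    (hc : 1 < c) (h1 : c * ringS y ≤ ringW y) (h2 : c * ringT y ≤ ringU y)
    (he : e ∈ latticeD4) (hye : y - e ∈ cell24) : e ∈ basicLine := by
  -- The point `y` is a proper convex combination of its projection `mix 1 0 y` to the line and the
  -- point `mix 1 c y` further out, both in the cell. A vector tight at `y` is then tight at the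
  -- projection, where all nearest lattice points are on the line.
  have hp : mix 1 0 y ∈ cell24 := ringCell_subset_cell24 (mix_mem_ringCell zero_le_one le_rfl
    (by simpa using ringW_nonneg y) (by simpa using ringU_nonneg y) (by simpa using hy.2.2))
  have hq : mix 1 c y ∈ cell24 := ringCell_subset_cell24 (mix_mem_ringCell zero_le_one
    (by linarith) (by simpa using h1) (by simpa using h2) (by simpa using hy.2.2))
  have hcomb : c • y = (c - 1) • mix 1 0 y + mix 1 c y := by
    ext <;> simp [mix, mean] <;> ring
  have a1 := two_mul_inner_le hp he
  have a2 := two_mul_inner_le hq he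
  have a3 := (sub_mem_cell24_iff (ringCell_subset_cell24 hy) he).1 hye
  have a4 : c * inner ℝ y e = (c - 1) * inner ℝ (mix 1 0 y) e + inner ℝ (mix 1 c y) e := by
    rw [← real_inner_smul_left, hcomb, inner_add_left, real_inner_smul_left]
  have a5 : ‖e‖ ^ 2 ≤ 2 * inner ℝ (mix 1 0 y) e := by
    by_contra h
    nlinarith
  exact mem_basicLine_of_sub_mem_cell24 (mix_zero_mem_basicLine 1 y) he
    ((sub_mem_cell24_iff hp he).2 a5)

/-- In a triple with maximum `M` and spread 1, at least two entries lie in `{M, M - 1}` and the sum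
lies between `3 * M - 2` and `3 * M - 1`. Two such pairs of positions share an index, so the maxima
differ by an integer; the sums agree, so they differ by less than 1. This makes `ringU` independent
of the choice of nearest lattice point on a wall. -/
theorem max_sub_int_eq {a b c : ℝ} {p q r : ℤ} (hs : p + q + r = 0)
    (h1 : max a (max b c) - min a (min b c) = 1)
    (h2 : max (a - p) (max (b - q) (c - r)) - min (a - p) (min (b - q) (c - r)) = 1) :
    max (a - p) (max (b - q) (c - r)) = max a (max b c) := by
  have key : ∀ x y z : ℝ, max x (max y z) - min x (min y z) = 1 → ∃ M, M = max x (max y z) ∧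
      (3 * M - 2 ≤ x + y + z ∧ x + y + z ≤ 3 * M - 1) ∧
      (((x = M ∨ x = M - 1) ∧ (y = M ∨ y = M - 1)) ∨ ((x = M ∨ x = M - 1) ∧ (z = M ∨ z = M - 1)) ∨
        ((y = M ∨ y = M - 1) ∧ (z = M ∨ z = M - 1))) := by
    intro x y z h
    refine ⟨_, rfl, ?_⟩
    rcases le_total x y with h3 | h3 <;> rcases le_total y z with h4 | h4 <;>
      rcases le_total x z with h5 | h5 <;> simp only [h3, h4, h5, max_eq_left, max_eq_right,
        min_eq_left, min_eq_right] at h ⊢ <;> refine ⟨⟨by linarith, by linarith⟩, ?_⟩ <;> grind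
  obtain ⟨M, hM, ⟨h3, h4⟩, h5⟩ := key _ _ _ h1
  obtain ⟨M', hM', ⟨h3', h4'⟩, h5'⟩ := key _ _ _ h2
  rw [← hM, ← hM']
  have hs' : (p + q + r : ℝ) = 0 := by exact_mod_cast hs
  have hn : ∃ n : ℤ, M' - M = n := by
    have aux : ∀ (x : ℝ) (n : ℤ), (x = M ∨ x = M - 1) → (x - n = M' ∨ x - n = M' - 1) →
        ∃ n : ℤ, M' - M = n := by
      rintro x n (h | h) (h' | h')
      · exact ⟨-n, by push_cast; linarith⟩
      · exact ⟨-n + 1, by push_cast; linarith⟩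
      · exact ⟨-n - 1, by push_cast; linarith⟩
      · exact ⟨-n, by push_cast; linarith⟩
    rcases h5 with ⟨e1, e2⟩ | ⟨e1, e2⟩ | ⟨e1, e2⟩ <;>
      rcases h5' with ⟨e1', e2'⟩ | ⟨e1', e2'⟩ | ⟨e1', e2'⟩ <;>
      first
      | exact aux _ _ e1 e1'
      | exact aux _ _ e1 e2'
      | exact aux _ _ e2 e1'
      | exact aux _ _ e2 e2'
  obtain ⟨n, hn⟩ := hn
  have b1 : (n : ℝ) < 1 := by linarith
  have b2 : (-1 : ℝ) < n := by linarith
  have b1' : n < 1 := by exact_mod_cast b1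
  have b2' : -1 < n := by exact_mod_cast b2
  have : n = 0 := by omega
  rw [this] at hn
  push_cast at hn
  linarith

theorem mean_sub_of_mem_basicLine {y f : ℍ[ℝ]} (hf : f ∈ basicLine) : mean (y - f) = mean y := by
  simp only [mean, Quaternion.imI_sub, Quaternion.imJ_sub, Quaternion.imK_sub]
  linarith [hf.2]

theorem ringS_sub_of_mem_basicLine {y f : ℍ[ℝ]} (hf : f ∈ basicLine) :
    ringS (y - f) = ringS y := by
  rw [ringS, ringS, mean_sub_of_mem_basicLine hf, Quaternion.re_sub, hf.1, sub_zero]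

theorem ringT_sub_of_mem_basicLine {y f : ℍ[ℝ]} (hf : f ∈ basicLine) :
    ringT (y - f) = ringT y := by
  rw [ringT, ringT, mean_sub_of_mem_basicLine hf, Quaternion.re_sub, hf.1, sub_zero]

theorem ringU_sub_of_mem_basicLine {y f : ℍ[ℝ]} (hf : f ∈ basicLine) (hf' : f ∈ latticeD4)
    (h1 : ringU y + ringW y = 1) (h2 : ringU (y - f) + ringW (y - f) = 1) :
    ringU (y - f) = ringU y := by
  rw [ringU_add_ringW] at h1 h2
  rw [ringU, ringU, mean_sub_of_mem_basicLine hf]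
  obtain ⟨a, b, c, d, ⟨e1, e2, e3, e4⟩, -⟩ := hf'
  have hs := hf.2
  simp only [Quaternion.imI_sub, Quaternion.imJ_sub, Quaternion.imK_sub, e2, e3, e4] at h2 hs ⊢
  rw [max_sub_int_eq (by exact_mod_cast hs) h1 h2]

/-! ### The retraction of a ring onto its lateral boundary -/

/-- The ratio by which a point can be moved away from the basic line. -/
def ringRatio (y : ℍ[ℝ]) : ℝ := min (ringW y / ringS y) (ringU y / ringT y)

/-- Radial projection from the centre, followed by the projection away from the basic line. -/
def ringRetr (y : ℍ[ℝ]) : ℍ[ℝ] :=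
  mix (1 / (ringU y + ringW y)) (ringRatio y / (ringU y + ringW y)) y

section

variable {y : ℍ[ℝ]}

theorem ringU_pos (hy : y ∈ ringCell) (hy' : y ∉ basicLine) : 0 < ringU y :=
  (ringT_pos hy').trans_le hy.2.1

theorem ringW_pos (hy : y ∈ ringCell) (hy' : y ∉ basicLine) : 0 < ringW y :=
  (ringS_pos hy').trans_le hy.1

theorem gauge_pos (hy : y ∈ ringCell) (hy' : y ∉ basicLine) : 0 < ringU y + ringW y :=
  add_pos (ringU_pos hy hy') (ringW_pos hy hy')

theorem one_le_ringRatio (hy : y ∈ ringCell) (hy' : y ∉ basicLine) : 1 ≤ ringRatio y :=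
  le_min ((one_le_div (ringS_pos hy')).2 hy.1) ((one_le_div (ringT_pos hy')).2 hy.2.1)

theorem ringRatio_mul_ringS_le (hy' : y ∉ basicLine) : ringRatio y * ringS y ≤ ringW y :=
  (le_div_iff₀ (ringS_pos hy')).1 (min_le_left _ _)

theorem ringRatio_mul_ringT_le (hy' : y ∉ basicLine) : ringRatio y * ringT y ≤ ringU y :=
  (le_div_iff₀ (ringT_pos hy')).1 (min_le_right _ _)

theorem ringRatio_mul_eq (hy' : y ∉ basicLine) :
    ringRatio y * ringS y = ringW y ∨ ringRatio y * ringT y = ringU y := by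
  rcases min_choice (ringW y / ringS y) (ringU y / ringT y) with h | h
  · left; rw [ringRatio, h, div_mul_cancel₀ _ (ringS_pos hy').ne']
  · right; rw [ringRatio, h, div_mul_cancel₀ _ (ringT_pos hy').ne']

theorem mix_mem_ringCell_of_le (hy' : y ∉ basicLine) {α β : ℝ} (hα : 0 ≤ α)
    (hβ : 0 ≤ β) (hβα : β ≤ ringRatio y * α) (hg : α * (ringU y + ringW y) ≤ 1) :
    mix α β y ∈ ringCell := by
  refine mix_mem_ringCell hα hβ ?_ ?_ hg
  · have := ringRatio_mul_ringS_le hy'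
    nlinarith [ringS_pos hy']
  · have := ringRatio_mul_ringT_le hy'
    nlinarith [ringT_pos hy']

/-- The ratio is multiplied by `α / β` and the gauge by `α`, so both rescalings cancel. Hence the
retraction is constant along rays from the centre and along segments orthogonal to the line. -/
theorem ringRetr_mix (hy : y ∈ ringCell) (hy' : y ∉ basicLine) {α β : ℝ} (hα : 0 < α)
    (hβ : 0 < β) : ringRetr (mix α β y) = ringRetr y := by
  have hg := gauge_pos hy hy'
  have hS := ringS_pos hy'
  have hT := ringT_pos hy'
  have hratio : ringRatio (mix α β y) = α / β * ringRatio y := by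
    rw [ringRatio, ringS_mix _ hβ.le, ringT_mix _ hβ.le, ringU_mix hα.le, ringW_mix hα.le,
      ringRatio, mul_min_of_nonneg _ _ (by positivity), mul_div_mul_comm, mul_div_mul_comm]
  rw [ringRetr, hratio, ringU_mix hα.le, ringW_mix hα.le, ← mul_add, mix_mix, ringRetr]
  congr 1 <;> field_simp

theorem ringRetr_mem_ringCell (hy : y ∈ ringCell) (hy' : y ∉ basicLine) :
    ringRetr y ∈ ringCell := by
  have hg := gauge_pos hy hy'
  have hr := one_le_ringRatio hy hy'
  refine mix_mem_ringCell_of_le hy' (by positivity) (by positivity) ?_ ?_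
  · rw [mul_one_div]
  · rw [one_div_mul_cancel hg.ne']

theorem gauge_ringRetr (hy : y ∈ ringCell) (hy' : y ∉ basicLine) :
    ringU (ringRetr y) + ringW (ringRetr y) = 1 := by
  have hg := gauge_pos hy hy'
  rw [ringRetr, ringU_mix (by positivity), ringW_mix (by positivity), ← mul_add,
    one_div_mul_cancel hg.ne']

theorem ringRetr_lateral (hy : y ∈ ringCell) (hy' : y ∉ basicLine) :
    ringS (ringRetr y) = ringW (ringRetr y) ∨ ringT (ringRetr y) = ringU (ringRetr y) := by
  have hg := gauge_pos hy hy'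
  have hr := one_le_ringRatio hy hy'
  rw [ringRetr, ringU_mix (by positivity), ringW_mix (by positivity), ringS_mix _ (by positivity),
    ringT_mix _ (by positivity)]
  rcases ringRatio_mul_eq hy' with h | h
  · left; rw [← h]; ring
  · right; rw [← h]; ring

theorem ringRetr_eq_self (hg : ringU y + ringW y = 1) (hr : ringRatio y = 1) : ringRetr y = y := by
  rw [ringRetr, hg, hr, div_one, mix_one_one]

/-- The segment from a point to its image under the retraction. -/
theorem segment_ringRetr (hy : y ∈ ringCell) (hy' : y ∉ basicLine) {t : ℝ}
    (ht : t ∈ Set.Icc (0 : ℝ) 1) :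
    y + t • (ringRetr y - y) ∈ ringCell ∧ y + t • (ringRetr y - y) ∉ basicLine ∧
      ringRetr (y + t • (ringRetr y - y)) = ringRetr y := by
  obtain ⟨h0, h1⟩ := ht
  have hg := gauge_pos hy hy'
  have hg1 := hy.2.2
  have hr := one_le_ringRatio hy hy'
  -- All points of the segment are of the form `mix α β y` with positive `α` and `β`.
  rw [ringRetr, add_smul_mix_sub]
  have ha : 1 ≤ 1 / (ringU y + ringW y) := (one_le_div hg).2 hg1
  have hb : 1 ≤ ringRatio y / (ringU y + ringW y) := (one_le_div hg).2 (hg1.trans hr)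
  have hα : 0 < 1 - t + t * (1 / (ringU y + ringW y)) := by nlinarith
  have hβ : 0 < 1 - t + t * (ringRatio y / (ringU y + ringW y)) := by nlinarith
  refine ⟨mix_mem_ringCell_of_le hy' hα.le hβ.le ?_ ?_, ?_, ringRetr_mix hy hy' hα hβ⟩
  · have e : ringRatio y * (1 - t + t * (1 / (ringU y + ringW y))) =
      ringRatio y * (1 - t) + t * (ringRatio y / (ringU y + ringW y)) := by ring
    rw [e]
    nlinarith
  · have e : (1 - t + t * (1 / (ringU y + ringW y))) * (ringU y + ringW y) =
      (1 - t) * (ringU y + ringW y) + t := by field_simp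
    rw [e]
    nlinarith
  · rwa [mix_mem_basicLine_iff _ hβ.ne']

end

theorem continuous_mean : Continuous mean := by
  unfold mean
  have := Quaternion.continuous_imI
  have := Quaternion.continuous_imJ
  have := Quaternion.continuous_imK
  fun_prop

theorem continuous_ringU : Continuous ringU := by
  unfold ringU
  have := Quaternion.continuous_imI
  have := Quaternion.continuous_imJ
  have := Quaternion.continuous_imK
  have := continuous_mean
  fun_prop

theorem continuous_ringW : Continuous ringW := by
  unfold ringW
  have := Quaternion.continuous_imI
  have := Quaternion.continuous_imJ
  have := Quaternion.continuous_imK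
  have := continuous_mean
  fun_prop

theorem continuous_ringS : Continuous ringS := by
  unfold ringS
  have := Quaternion.continuous_re
  have := continuous_mean
  fun_prop

theorem continuous_ringT : Continuous ringT := by
  unfold ringT
  have := Quaternion.continuous_re
  have := continuous_mean
  fun_prop

theorem isClosed_ringCell : IsClosed ringCell :=
  (isClosed_le continuous_ringS continuous_ringW).inter
    ((isClosed_le continuous_ringT continuous_ringU).inter
      (isClosed_le (continuous_ringU.add continuous_ringW) continuous_const))

theorem mix_eq_smul_add_smul (α β : ℝ) (y : ℍ[ℝ]) :
    mix α β y = α • y + (β - α) • quat y.re (mean y) (mean y) (mean y) := by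
  ext <;> simp [mix] <;> ring

theorem quat_eq (a b c d : ℝ) : quat a b c d =
    a • quat 1 0 0 0 + b • quat 0 1 0 0 + c • quat 0 0 1 0 + d • quat 0 0 0 1 := by
  ext <;> simp

theorem continuousOn_ringRetr : ContinuousOn ringRetr (ringCell \ basicLine) := by
  have hU := continuous_ringU.continuousOn (s := ringCell \ basicLine)
  have hW := continuous_ringW.continuousOn (s := ringCell \ basicLine)
  have hS := continuous_ringS.continuousOn (s := ringCell \ basicLine)
  have hT := continuous_ringT.continuousOn (s := ringCell \ basicLine)
  have hg : ∀ y ∈ ringCell \ (basicLine : Set ℍ[ℝ]), ringU y + ringW y ≠ 0 :=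
    fun y hy => (gauge_pos hy.1 hy.2).ne'
  have hratio : ContinuousOn ringRatio (ringCell \ basicLine) :=
    (hW.div hS fun y hy => (ringS_pos hy.2).ne').inf (hU.div hT fun y hy => (ringT_pos hy.2).ne')
  have hq : Continuous fun y : ℍ[ℝ] => quat y.re (mean y) (mean y) (mean y) := by
    have := Quaternion.continuous_re
    have := continuous_mean
    simp only [fun y : ℍ[ℝ] => quat_eq y.re (mean y) (mean y) (mean y)]
    fun_prop
  have e : ringRetr = fun y => (1 / (ringU y + ringW y)) • y +
      (ringRatio y / (ringU y + ringW y) - 1 / (ringU y + ringW y)) •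
        quat y.re (mean y) (mean y) (mean y) := by
    funext y
    rw [ringRetr, mix_eq_smul_add_smul]
  rw [e]
  have h1 := continuousOn_const (c := (1 : ℝ)).div (hU.add hW) hg
  exact (h1.smul continuousOn_id).add (((hratio.div (hU.add hW) hg).sub h1).smul hq.continuousOn)

end

end ReflG4

/-! ### Chambers and the global retraction -/

namespace ReflG4

noncomputable section

open Set

/-- The part of the Voronoi cell of `d` near the wall `wall d a`. -/
def chamber (d : ℍ[ℝ]) (a : Fin 4) : Set ℍ[ℝ] := {x | frame a * (x - d) ∈ ringCell}

/-- The retraction of `ringCell`, transported to a chamber. -/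
def chamberRetr (d : ℍ[ℝ]) (a : Fin 4) (x : ℍ[ℝ]) : ℍ[ℝ] :=
  d + star (frame a) * ringRetr (frame a * (x - d))

theorem frame_mul_chamberRetr_sub (d : ℍ[ℝ]) (a : Fin 4) (x : ℍ[ℝ]) :
    frame a * (chamberRetr d a x - d) = ringRetr (frame a * (x - d)) := by
  rw [chamberRetr, add_sub_cancel_left, frame_mul_star_frame_mul]

theorem sub_frame_mem_cell24_iff {d e x : ℍ[ℝ]} {a : Fin 4} :
    frame a * (x - d) - frame a * (e - d) ∈ cell24 ↔ x - e ∈ cell24 := by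
  rw [← mul_sub, sub_sub_sub_cancel_right, frame_mul_mem_cell24]

theorem mem_nearest_of_mem_chamber {d x : ℍ[ℝ]} {a : Fin 4} (hd : d ∈ latticeD4)
    (hx : x ∈ chamber d a) : d ∈ nearest x :=
  ⟨hd, frame_mul_mem_cell24.1 (ringCell_subset_cell24 hx)⟩

theorem self_mem_wall (d : ℍ[ℝ]) (a : Fin 4) : d ∈ wall d a := by
  change frame a * (d - d) ∈ basicLine
  rw [sub_self, mul_zero]
  exact zero_mem _

/-- Nearest lattice points in the ring coordinates of a chamber. -/
theorem exists_mem_nearest_iff {d x : ℍ[ℝ]} {a : Fin 4} (hd : d ∈ latticeD4) (P : ℍ[ℝ] → Prop) :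
    (∃ e ∈ nearest x, P (frame a * (e - d))) ↔
      ∃ e ∈ latticeD4, P e ∧ frame a * (x - d) - e ∈ cell24 := by
  constructor
  · rintro ⟨e, ⟨he, hxe⟩, hP⟩
    exact ⟨_, frame_mul_mem_latticeD4 a (sub_mem he hd), hP, sub_frame_mem_cell24_iff.2 hxe⟩
  · rintro ⟨e, he, hP, hxe⟩
    have h : frame a * (d + star (frame a) * e - d) = e := by
      rw [add_sub_cancel_left, frame_mul_star_frame_mul]
    refine ⟨d + star (frame a) * e, ⟨add_mem hd (star_frame_mul_mem_latticeD4 a he), ?_⟩, ?_⟩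
    · rw [← sub_frame_mem_cell24_iff (d := d) (a := a), h]
      exact hxe
    · rwa [h]

theorem frame_mul_eq_zero_iff {a : Fin 4} {y : ℍ[ℝ]} : frame a * y = 0 ↔ y = 0 := by
  rw [← norm_eq_zero, norm_frame_mul, norm_eq_zero]

theorem exists_nearest_mem_wall {d x : ℍ[ℝ]} {a : Fin 4} (hd : d ∈ latticeD4)
    (hx : x ∈ chamber d a)
    (hg : ringU (frame a * (x - d)) + ringW (frame a * (x - d)) = 1) :
    ∃ e ∈ nearest x, e ∈ wall d a ∧ e ≠ d := by
  obtain ⟨e, he, h1, h2, h3⟩ :=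
    exists_sub_mem_cell24_of_gauge_eq_one (ringCell_subset_cell24 hx) hg
  obtain ⟨f, hf, hf1, hf2⟩ := (exists_mem_nearest_iff (x := x) (a := a) hd
    fun f => f ∈ basicLine ∧ f ≠ 0).2 ⟨e, he, ⟨h1, h2⟩, h3⟩
  refine ⟨f, hf, hf1, fun h => hf2 ?_⟩
  rw [h, sub_self, mul_zero]

/-- A boundary point has, besides `d`, another nearest lattice point on `wall d a`, and two distinct
points lie on at most one wall. -/
theorem wall_eq_of_nearest_subset {d e x : ℍ[ℝ]} {a b : Fin 4} (hd : d ∈ latticeD4)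
    (hx : x ∈ chamber d a)
    (hg : ringU (frame a * (x - d)) + ringW (frame a * (x - d)) = 1)
    (hN : nearest x ⊆ wall e b) : b = a ∧ wall e b = wall d a := by
  obtain ⟨f, hf, hfw, hfd⟩ := exists_nearest_mem_wall hd hx hg
  have hd' := hN (mem_nearest_of_mem_chamber hd hx)
  obtain rfl := wall_unique hfd (hN hf) hd' hfw (self_mem_wall d a)
  exact ⟨rfl, wall_eq_of_mem hd'⟩

/-- Radial projection from `d` to the boundary of its cell reduces questions about a chamber to
points of gauge 1. The factor is a variable so that the projections of two chambers with equal
gauges can be compared. -/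
theorem scale_mem_chamber {d x : ℍ[ℝ]} {a : Fin 4} (hx : x ∈ chamber d a) (hx' : x ∉ wall d a)
    {c : ℝ} (hc : c = 1 / (ringU (frame a * (x - d)) + ringW (frame a * (x - d)))) :
    0 < c ∧ d + c • (x - d) ∈ chamber d a ∧ d + c • (x - d) ∉ wall d a ∧
      ringU (frame a * (d + c • (x - d) - d)) + ringW (frame a * (d + c • (x - d) - d)) = 1 ∧
      chamberRetr d a (d + c • (x - d)) = chamberRetr d a x := by
  have hx0 : frame a * (x - d) ∈ ringCell := hx
  have hx0' : frame a * (x - d) ∉ basicLine := hx'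
  have hg := gauge_pos hx0 hx0'
  have e : frame a * (d + c • (x - d) - d) = mix c c (frame a * (x - d)) := by
    rw [mix_self, add_sub_cancel_left, mul_smul_comm]
  have hc0 : 0 < c := hc ▸ one_div_pos.2 hg
  have hr := one_le_ringRatio hx0 hx0'
  refine ⟨hc0, ?_, ?_, ?_, ?_⟩
  · change frame a * _ ∈ ringCell
    rw [e]
    refine mix_mem_ringCell_of_le hx0' hc0.le hc0.le (by nlinarith) ?_
    rw [hc, one_div_mul_cancel hg.ne']
  · change frame a * _ ∉ basicLine
    rwa [e, mix_mem_basicLine_iff _ hc0.ne']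
  · rw [e, ringU_mix hc0.le, ringW_mix hc0.le, ← mul_add, hc, one_div_mul_cancel hg.ne']
  · rw [chamberRetr, e, ringRetr_mix hx0 hx0' hc0 hc0, chamberRetr]

/-- Within a chamber there is only one wall. -/
theorem mem_wall_of_mem_walls {d x : ℍ[ℝ]} {a : Fin 4} (hd : d ∈ latticeD4)
    (hx : x ∈ chamber d a) (hxw : x ∈ walls) : x ∈ wall d a := by
  by_contra hx'
  obtain ⟨e, he, b, hxb⟩ := hxw
  have hdb : d ∈ wall e b := nearest_subset_wall he hxb (mem_nearest_of_mem_chamber hd hx)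
  rw [wall_eq_of_mem hdb] at hxb
  obtain ⟨hc, h1, h2, h3, -⟩ := scale_mem_chamber hx hx' rfl
  set c := 1 / (ringU (frame a * (x - d)) + ringW (frame a * (x - d)))
  -- A wall through `d` is invariant under scaling from `d`, so it contains the boundary point,
  -- whose nearest lattice points determine the wall.
  have h4 : d + c • (x - d) ∈ wall d b := by
    change frame b * (d + c • (x - d) - d) ∈ basicLine
    rw [add_sub_cancel_left, mul_smul_comm]
    exact basicLine.smul_mem c hxb
  obtain ⟨rfl, -⟩ := wall_eq_of_nearest_subset hd h1 h3 (nearest_subset_wall hd h4)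
  exact hx' hxb

/-- The complement complex in terms of nearest lattice points. -/
def nearestComplex : Set ℍ[ℝ] := {x | ∀ d ∈ latticeD4, ∀ a, ¬ nearest x ⊆ wall d a}

theorem disjoint_nearestComplex_walls {x : ℍ[ℝ]} (hx : x ∈ nearestComplex) : x ∉ walls := by
  rintro ⟨d, hd, a, hxa⟩
  exact hx d hd a (nearest_subset_wall hd hxa)

theorem notMem_basicLine_of_notMem_walls {d x : ℍ[ℝ]} {a : Fin 4} (hd : d ∈ latticeD4)
    (hx : x ∉ walls) : frame a * (x - d) ∉ basicLine :=
  fun h => hx ⟨d, hd, a, h⟩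

/-- If the gauge were less than 1, `d` would be the only nearest lattice point; if the ratio
exceeded 1, all nearest points would be on the line. Both contradict membership in the complex. -/
theorem ringRatio_eq_one_of_mem_nearestComplex {d x : ℍ[ℝ]} {a : Fin 4} (hd : d ∈ latticeD4)
    (hx : x ∈ chamber d a) (hxK : x ∈ nearestComplex) :
    ringU (frame a * (x - d)) + ringW (frame a * (x - d)) = 1 ∧
      ringRatio (frame a * (x - d)) = 1 := by
  have hx0 : frame a * (x - d) ∈ ringCell := hx
  have hx0' := notMem_basicLine_of_notMem_walls (a := a) hd (disjoint_nearestComplex_walls hxK)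
  obtain ⟨e, he, hew⟩ := not_subset.1 (hxK d hd a)
  have he' := frame_mul_mem_latticeD4 a (sub_mem he.1 hd)
  have hye := sub_frame_mem_cell24_iff (d := d) (a := a).2 he.2
  constructor
  · by_contra h
    have h0 := eq_zero_of_sub_mem_cell24 hx0 (lt_of_le_of_ne hx0.2.2 h) he' hye
    apply hew
    change frame a * (e - d) ∈ basicLine
    rw [h0]
    exact zero_mem _
  · by_contra h
    have h1 := lt_of_le_of_ne (one_le_ringRatio hx0 hx0') (Ne.symm h)
    exact hew (mem_basicLine_of_sub_mem_cell24_of_lt hx0 h1 (ringRatio_mul_ringS_le hx0')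
      (ringRatio_mul_ringT_le hx0') he' hye)

theorem chamberRetr_eq_self {d x : ℍ[ℝ]} {a : Fin 4} (hd : d ∈ latticeD4)
    (hx : x ∈ chamber d a) (hxK : x ∈ nearestComplex) : chamberRetr d a x = x := by
  obtain ⟨h1, h2⟩ := ringRatio_eq_one_of_mem_nearestComplex hd hx hxK
  rw [chamberRetr, ringRetr_eq_self h1 h2, star_frame_mul_frame_mul, add_sub_cancel]

/-- At gauge 1 the only wall that could contain all nearest points is `wall d a`, and on the lateral
boundary some nearest point lies off it. -/
theorem mem_nearestComplex_of_lateral {d x : ℍ[ℝ]} {a : Fin 4} (hd : d ∈ latticeD4)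
    (hx : x ∈ chamber d a)
    (hg : ringU (frame a * (x - d)) + ringW (frame a * (x - d)) = 1)
    (hl : ringS (frame a * (x - d)) = ringW (frame a * (x - d)) ∨
      ringT (frame a * (x - d)) = ringU (frame a * (x - d))) : x ∈ nearestComplex := by
  intro e _ b hN
  obtain ⟨rfl, hw⟩ := wall_eq_of_nearest_subset hd hx hg hN
  obtain ⟨f, hf, hf', hyf⟩ :=
    exists_sub_mem_cell24_notMem_basicLine (ringCell_subset_cell24 hx) hg hl
  obtain ⟨f', h1, h2⟩ := (exists_mem_nearest_iff (x := x) hd fun f => f ∉ basicLine).2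
    ⟨f, hf, hf', hyf⟩
  have h3 := hN h1
  rw [hw] at h3
  exact h2 h3

theorem chamberRetr_mem {d x : ℍ[ℝ]} {a : Fin 4} (hd : d ∈ latticeD4)
    (hx : x ∈ chamber d a) (hxU : x ∉ walls) :
    chamberRetr d a x ∈ chamber d a ∧ chamberRetr d a x ∈ nearestComplex := by
  have hx0 : frame a * (x - d) ∈ ringCell := hx
  have hx0' := notMem_basicLine_of_notMem_walls (a := a) hd hxU
  have h : chamberRetr d a x ∈ chamber d a := by
    change frame a * _ ∈ ringCell
    rw [frame_mul_chamberRetr_sub]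
    exact ringRetr_mem_ringCell hx0 hx0'
  refine ⟨h, mem_nearestComplex_of_lateral hd h ?_ ?_⟩ <;> rw [frame_mul_chamberRetr_sub]
  · exact gauge_ringRetr hx0 hx0'
  · exact ringRetr_lateral hx0 hx0'

/-- On the complex both maps are the identity. Elsewhere the nearest points lie on one wall, which
must be the wall of both chambers, so `e - d` is a lattice vector along the common line. Translation
by it preserves `ringU`, `ringW`, `ringS` and `ringT` at such points, so it commutes with the
retraction. -/
theorem chamberRetr_eq_of_gauge_eq_one {d e x : ℍ[ℝ]} {a b : Fin 4} (hd : d ∈ latticeD4)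
    (he : e ∈ latticeD4) (hxd : x ∈ chamber d a) (hxe : x ∈ chamber e b)
    (hgd : ringU (frame a * (x - d)) + ringW (frame a * (x - d)) = 1)
    (hge : ringU (frame b * (x - e)) + ringW (frame b * (x - e)) = 1) :
    chamberRetr d a x = chamberRetr e b x := by
  by_cases hxK : x ∈ nearestComplex
  · rw [chamberRetr_eq_self hd hxd hxK, chamberRetr_eq_self he hxe hxK]
  · simp only [nearestComplex, mem_ofPred_eq, not_forall, not_not] at hxK
    obtain ⟨f, _, c, hN⟩ := hxK
    obtain ⟨rfl, h1⟩ := wall_eq_of_nearest_subset hd hxd hgd hN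
    obtain ⟨rfl, h2⟩ := wall_eq_of_nearest_subset he hxe hge hN
    have hed : e ∈ wall d c := by
      rw [← h1, h2]; exact self_mem_wall e c
    have hed' : frame c * (e - d) ∈ basicLine := hed
    have hlat := frame_mul_mem_latticeD4 c (sub_mem he hd)
    have hy : frame c * (x - e) = frame c * (x - d) - frame c * (e - d) := by
      rw [← mul_sub]; congr 1; abel
    set y := frame c * (x - d) with hydef
    rw [hy] at hge
    have hU := ringU_sub_of_mem_basicLine hed' hlat hgd hge
    have hW : ringW (y - frame c * (e - d)) = ringW y := by linarith
    have hratio : ringRatio (y - frame c * (e - d)) = ringRatio y := by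
      rw [ringRatio, ringRatio, hU, hW, ringS_sub_of_mem_basicLine hed',
        ringT_sub_of_mem_basicLine hed']
    have hretr : ringRetr (y - frame c * (e - d)) = ringRetr y - frame c * (e - d) := by
      rw [ringRetr, ringRetr, hratio, hU, hW, hgd, mix_sub, mix_of_mem_basicLine _ _ hed', div_one,
        one_smul]
    rw [chamberRetr, chamberRetr, hy, hretr, mul_sub (star (frame c)) (ringRetr y),
      star_frame_mul_frame_mul]
    abel

/-- After division by its gauge in the direction `a` the point is still in the cell, on which all
four gauges are at most 1. -/
theorem gauge_le_of_mem_chamber {d x : ℍ[ℝ]} {a b : Fin 4} (hxa : x ∈ chamber d a)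
    (hx' : x ∉ wall d a) : ringU (frame b * (x - d)) + ringW (frame b * (x - d)) ≤
      ringU (frame a * (x - d)) + ringW (frame a * (x - d)) := by
  have hg : 0 < ringU (frame a * (x - d)) + ringW (frame a * (x - d)) := gauge_pos hxa hx'
  obtain ⟨hc, h1, -⟩ := scale_mem_chamber hxa hx' rfl
  have h2 : frame b * (d + (1 / (ringU (frame a * (x - d)) + ringW (frame a * (x - d)))) •
      (x - d) - d) ∈ cell24 :=
    frame_mul_mem_cell24.2 (frame_mul_mem_cell24.1 (ringCell_subset_cell24 h1))
  rw [add_sub_cancel_left, mul_smul_comm, ← mix_self] at h2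
  have h3 := ringU_add_ringW_le_one h2
  rw [ringU_mix hc.le, ringW_mix hc.le, ← mul_add, one_div_mul_eq_div, div_le_one hg] at h3
  exact h3

/-- The retractions of different chambers agree. -/
theorem chamberRetr_eq {d e x : ℍ[ℝ]} {a b : Fin 4} (hd : d ∈ latticeD4)
    (he : e ∈ latticeD4) (hxd : x ∈ chamber d a) (hxe : x ∈ chamber e b) (hx : x ∉ walls) :
    chamberRetr d a x = chamberRetr e b x := by
  have hxa : x ∉ wall d a := fun h => hx ⟨d, hd, a, h⟩
  have hxb : x ∉ wall e b := fun h => hx ⟨e, he, b, h⟩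
  by_cases hde : d = e
  -- With a common centre the two gauges agree, so both radial projections give the same boundary
  -- point. With different centres there are two nearest lattice points, so both gauges are already
  -- 1.
  · subst hde
    have hg := le_antisymm (gauge_le_of_mem_chamber (b := b) hxd hxa)
      (gauge_le_of_mem_chamber (b := a) hxe hxb)
    obtain ⟨-, h1, -, h3, h4⟩ := scale_mem_chamber hxd hxa rfl
    obtain ⟨-, k1, -, k3, k4⟩ := scale_mem_chamber hxe hxb
      (c := 1 / (ringU (frame a * (x - d)) + ringW (frame a * (x - d)))) (by rw [hg])
    rw [← h4, ← k4]
    exact chamberRetr_eq_of_gauge_eq_one hd hd h1 k1 h3 k3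
  · have aux : ∀ {d e : ℍ[ℝ]} {a b : Fin 4}, d ∈ latticeD4 → e ∈ latticeD4 → x ∈ chamber d a →
        x ∈ chamber e b → d ≠ e →
        ringU (frame a * (x - d)) + ringW (frame a * (x - d)) = 1 := by
      intro d e a b hd he hxd hxe hde
      by_contra h
      have hxd0 : frame a * (x - d) ∈ ringCell := hxd
      have h0 := eq_zero_of_sub_mem_cell24 hxd0 (lt_of_le_of_ne hxd0.2.2 h)
        (frame_mul_mem_latticeD4 a (sub_mem he hd))
        (sub_frame_mem_cell24_iff.2 (mem_nearest_of_mem_chamber he hxe).2)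
      rw [frame_mul_eq_zero_iff, sub_eq_zero] at h0
      exact hde h0.symm
    exact chamberRetr_eq_of_gauge_eq_one hd he hxd hxe (aux hd he hxd hxe hde)
      (aux he hd hxe hxd (Ne.symm hde))

theorem one_le_norm_of_mem_latticeD4 {e : ℍ[ℝ]} (he : e ∈ latticeD4) (h0 : e ≠ 0) :
    1 ≤ ‖e‖ := by
  obtain ⟨a, b, c, d, ⟨h1, h2, h3, h4⟩, -⟩ := he
  have hn : ‖e‖ ^ 2 = ((a ^ 2 + b ^ 2 + c ^ 2 + d ^ 2 : ℤ) : ℝ) := by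
    rw [norm_sq_eq, h1, h2, h3, h4]; push_cast; ring
  have hpos : (0 : ℝ) < ((a ^ 2 + b ^ 2 + c ^ 2 + d ^ 2 : ℤ) : ℝ) := by
    rw [← hn]; have := norm_pos_iff.2 h0; positivity
  have h5 : 1 ≤ a ^ 2 + b ^ 2 + c ^ 2 + d ^ 2 := by exact_mod_cast hpos
  have h6 : (1 : ℝ) ≤ ‖e‖ ^ 2 := by rw [hn]; exact_mod_cast h5
  nlinarith [norm_nonneg e]

theorem pairwise_latticeD4 :
    (latticeD4 : Set ℍ[ℝ]).Pairwise fun d e => 1 ≤ dist d e := by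
  intro d hd e he hde
  rw [dist_eq_norm]
  exact one_le_norm_of_mem_latticeD4 (sub_mem hd he) (sub_ne_zero.2 hde)

theorem isClosed_latticeD4 : IsClosed (latticeD4 : Set ℍ[ℝ]) :=
  Metric.isClosed_of_pairwise_le_dist zero_lt_one pairwise_latticeD4

instance : ProperSpace ℍ[ℝ] := FiniteDimensional.proper ℝ ℍ[ℝ]

theorem exists_mem_nearest (x : ℍ[ℝ]) : ∃ d, d ∈ nearest x := by
  obtain ⟨d, hd, h⟩ := isClosed_latticeD4.exists_infDist_eq_dist ⟨0, zero_mem latticeD4⟩ x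
  refine ⟨d, mem_nearest_iff_voronoiCell.2 ⟨hd, fun t ht => ?_⟩⟩
  rw [← h]
  exact Metric.infDist_le_dist_of_mem ht

theorem exists_mem_chamber_of_mem_nearest {d x : ℍ[ℝ]} (h : d ∈ nearest x) :
    ∃ a, x ∈ chamber d a := exists_frame_mul_mem_ringCell h.2

theorem norm_le_two_of_mem_cell24 {y : ℍ[ℝ]} (hy : y ∈ cell24) : ‖y‖ ≤ 2 := by
  obtain ⟨⟨h1, -, -⟩, -, -, h2⟩ := hy
  have hsq : ∀ t : ℝ, |t| ≤ 1 → t ^ 2 ≤ 1 := fun t ht => (sq_le_one_iff_abs_le_one t).2 ht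
  have a0 := abs_nonneg y.re
  have a1 := abs_nonneg y.imI
  have a2 := abs_nonneg y.imJ
  have a3 := abs_nonneg y.imK
  have h : ‖y‖ ^ 2 ≤ 2 ^ 2 := by
    rw [norm_sq_eq]
    linarith [hsq y.re (by linarith), hsq y.imI (by linarith), hsq y.imJ (by linarith),
      hsq y.imK (by linarith)]
  exact (pow_le_pow_iff_left₀ (norm_nonneg _) zero_le_two two_ne_zero).1 h

theorem dist_le_two_of_mem_nearest {d x : ℍ[ℝ]} (h : d ∈ nearest x) : dist x d ≤ 2 := by
  rw [dist_eq_norm]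
  exact norm_le_two_of_mem_cell24 h.2

open Classical in
/-- The retraction of the complement of the walls onto the complement complex. -/
def retr (x : ℍ[ℝ]) : ℍ[ℝ] :=
  if h : ∃ p : latticeD4 × Fin 4, x ∈ chamber p.1 p.2 then
    chamberRetr h.choose.1 h.choose.2 x else x

theorem retr_eq {d x : ℍ[ℝ]} {a : Fin 4} (hd : d ∈ latticeD4) (hx : x ∈ chamber d a)
    (hxU : x ∉ walls) : retr x = chamberRetr d a x := by
  have h : ∃ p : latticeD4 × Fin 4, x ∈ chamber p.1 p.2 := ⟨(⟨d, hd⟩, a), hx⟩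
  rw [retr, dif_pos h]
  exact chamberRetr_eq h.choose.1.2 hd h.choose_spec hx hxU

theorem exists_mem_chamber (x : ℍ[ℝ]) : ∃ d ∈ latticeD4, ∃ a, x ∈ chamber d a := by
  obtain ⟨d, hd⟩ := exists_mem_nearest x
  exact ⟨d, hd.1, exists_mem_chamber_of_mem_nearest hd⟩

theorem retr_mem {x : ℍ[ℝ]} (hx : x ∉ walls) : retr x ∈ nearestComplex := by
  obtain ⟨d, hd, a, hxa⟩ := exists_mem_chamber x
  rw [retr_eq hd hxa hx]
  exact (chamberRetr_mem hd hxa hx).2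

theorem retr_eq_self {x : ℍ[ℝ]} (hx : x ∈ nearestComplex) : retr x = x := by
  obtain ⟨d, hd, a, hxa⟩ := exists_mem_chamber x
  rw [retr_eq hd hxa (disjoint_nearestComplex_walls hx), chamberRetr_eq_self hd hxa hx]

/-- The segment stays in the chamber and off its own wall, and a chamber meets no other wall
elsewhere. -/
theorem retr_segment {x : ℍ[ℝ]} (hx : x ∉ walls) {t : ℝ} (ht : t ∈ Icc (0 : ℝ) 1) :
    x + t • (retr x - x) ∉ walls ∧ retr (x + t • (retr x - x)) = retr x := by
  obtain ⟨d, hd, a, hxa⟩ := exists_mem_chamber x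
  rw [retr_eq hd hxa hx]
  have h0 := notMem_basicLine_of_notMem_walls (a := a) hd hx
  obtain ⟨h1, h2, h3⟩ := segment_ringRetr hxa h0 ht
  have e : frame a * (x + t • (chamberRetr d a x - x) - d) =
      frame a * (x - d) + t • (ringRetr (frame a * (x - d)) - frame a * (x - d)) := by
    rw [← frame_mul_chamberRetr_sub, ← mul_sub, sub_sub_sub_cancel_right, ← mul_smul_comm,
      ← mul_add]
    congr 1; abel
  rw [← e] at h1 h2 h3
  have h4 : x + t • (chamberRetr d a x - x) ∉ walls :=
    fun h => h2 (mem_wall_of_mem_walls hd h1 h)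
  refine ⟨h4, ?_⟩
  rw [retr_eq hd h1 h4, chamberRetr, h3, chamberRetr]

theorem dist_retr_le {x : ℍ[ℝ]} (hx : x ∉ walls) : dist x (retr x) ≤ 4 := by
  obtain ⟨d, hd, a, hxa⟩ := exists_mem_chamber x
  rw [retr_eq hd hxa hx]
  have h1 := dist_le_two_of_mem_nearest (mem_nearest_of_mem_chamber hd hxa)
  have h2 := dist_le_two_of_mem_nearest
    (mem_nearest_of_mem_chamber hd (chamberRetr_mem hd hxa hx).1)
  have := dist_triangle_right x (chamberRetr d a x) d
  linarith

theorem wall_add (d e : ℍ[ℝ]) (a : Fin 4) {x : ℍ[ℝ]} : x + e ∈ wall (d + e) a ↔ x ∈ wall d a := by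
  change frame a * (x + e - (d + e)) ∈ basicLine ↔ frame a * (x - d) ∈ basicLine
  rw [add_sub_add_right_eq_sub]

theorem add_mem_walls {x e : ℍ[ℝ]} (he : e ∈ latticeD4) (hx : x ∈ walls) : x + e ∈ walls := by
  obtain ⟨d, hd, a, h⟩ := hx
  exact ⟨d + e, add_mem hd he, a, (wall_add d e a).2 h⟩

/-- Periodicity under the lattice later makes continuity at the vertices uniform. -/
theorem retr_add {x e : ℍ[ℝ]} (he : e ∈ latticeD4) (hx : x ∉ walls) :
    retr (x + e) = retr x + e := by
  obtain ⟨d, hd, a, hxa⟩ := exists_mem_chamber x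
  have h1 : x + e ∈ chamber (d + e) a := by
    change frame a * (x + e - (d + e)) ∈ ringCell
    rwa [add_sub_add_right_eq_sub]
  have h2 : x + e ∉ walls := fun h => hx (by simpa using add_mem_walls (neg_mem he) h)
  rw [retr_eq hd hxa hx, retr_eq (add_mem hd he) h1 h2, chamberRetr, chamberRetr,
    add_sub_add_right_eq_sub]
  abel

theorem continuous_frame_mul_sub (d : ℍ[ℝ]) (a : Fin 4) :
    Continuous fun x : ℍ[ℝ] => frame a * (x - d) :=
  continuous_const.mul (continuous_id.sub continuous_const)

theorem isClosed_chamber (d : ℍ[ℝ]) (a : Fin 4) : IsClosed (chamber d a) :=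
  isClosed_ringCell.preimage (continuous_frame_mul_sub d a)

theorem finite_latticeD4_inter_closedBall (x : ℍ[ℝ]) (r : ℝ) :
    (Metric.closedBall x r ∩ latticeD4).Finite := by
  have : DiscreteTopology (latticeD4 : Set ℍ[ℝ]) := by
    refine DiscreteTopology.of_forall_le_dist zero_lt_one fun d e hde => ?_
    exact pairwise_latticeD4 d.2 e.2 fun h => hde (Subtype.ext h)
  exact Metric.finite_isBounded_inter_isClosed ⟨this⟩ Metric.isBounded_closedBall isClosed_latticeD4

theorem locallyFinite_chamber :
    LocallyFinite fun p : latticeD4 × Fin 4 => chamber p.1 p.2 := by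
  intro x
  refine ⟨Metric.ball x 1, Metric.ball_mem_nhds x one_pos, ?_⟩
  have h := ((finite_latticeD4_inter_closedBall x 3).preimage
    Subtype.val_injective.injOn (f := ((↑) : latticeD4 → ℍ[ℝ]))).prod (finite_univ (α := Fin 4))
  refine h.subset ?_
  rintro ⟨⟨d, hd⟩, a⟩ ⟨y, hy, hyx⟩
  refine ⟨⟨?_, hd⟩, mem_univ _⟩
  have h1 := dist_le_two_of_mem_nearest (mem_nearest_of_mem_chamber hd hy)
  have h2 : dist y x < 1 := hyx
  have := dist_triangle_left d x y
  exact Metric.mem_closedBall.2 (by linarith)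

/-- The chambers form a locally finite closed cover, and on each of them `retr` is given by one
formula. -/
theorem continuousOn_retr : ContinuousOn retr wallsᶜ := by
  rw [continuousOn_iff_continuous_domRestrict]
  have hlf : LocallyFinite fun p : latticeD4 × Fin 4 =>
      (Subtype.val ⁻¹' chamber p.1 p.2 : Set (wallsᶜ : Set ℍ[ℝ])) :=
    locallyFinite_chamber.preimage_continuous continuous_subtype_val
  refine hlf.continuous (eq_univ_of_forall fun x => ?_)
    (fun p => (isClosed_chamber _ _).preimage continuous_subtype_val) fun p => ?_
  · obtain ⟨d, hd, a, h⟩ := exists_mem_chamber (x : ℍ[ℝ])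
    exact mem_iUnion.2 ⟨(⟨d, hd⟩, a), h⟩
  · have h1 : ContinuousOn (fun x : (wallsᶜ : Set ℍ[ℝ]) => chamberRetr p.1 p.2 x)
        (Subtype.val ⁻¹' chamber p.1 p.2) := by
      unfold chamberRetr
      refine continuousOn_const.add (continuousOn_const.mul ?_)
      refine continuousOn_ringRetr.comp
        ((continuous_frame_mul_sub _ _).comp continuous_subtype_val).continuousOn ?_
      intro x hx
      exact ⟨hx, notMem_basicLine_of_notMem_walls p.1.2 x.2⟩
    exact h1.congr fun x hx => retr_eq p.1.2 hx x.2

end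

end ReflG4

namespace ReflG4

noncomputable section

/-! ### The Hurwitz integers and the elements of the reflection group -/

theorem zeta_eq : zeta = quat (1/2) (1/2) (1/2) (1/2) := rfl

theorem omega_eq : omega = quat (-1/2) (1/2) (1/2) (1/2) := rfl

theorem quatI_eq : quatI = quat 0 1 0 0 := rfl

/-- The Hurwitz integers. -/
def hurwitz : AddSubgroup ℍ[ℝ] where
  carrier := {x | ∃ a b c d : ℤ,
    x.re = a / 2 ∧ x.imI = a / 2 + b ∧ x.imJ = a / 2 + c ∧ x.imK = a / 2 + d}
  zero_mem' := ⟨0, 0, 0, 0, by simp⟩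
  add_mem' := by
    rintro x y ⟨a, b, c, d, h1, h2, h3, h4⟩ ⟨a', b', c', d', h1', h2', h3', h4'⟩
    refine ⟨a + a', b + b', c + c', d + d', ?_⟩
    simp only [Quaternion.re_add, Quaternion.imI_add, Quaternion.imJ_add, Quaternion.imK_add,
      h1, h2, h3, h4, h1', h2', h3', h4']
    push_cast
    refine ⟨?_, ?_, ?_, ?_⟩ <;> ring
  neg_mem' := by
    rintro x ⟨a, b, c, d, h1, h2, h3, h4⟩
    refine ⟨-a, -b, -c, -d, ?_⟩
    simp only [Quaternion.re_neg, Quaternion.imI_neg, Quaternion.imJ_neg, Quaternion.imK_neg,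
      h1, h2, h3, h4]
    push_cast
    refine ⟨?_, ?_, ?_, ?_⟩ <;> ring

theorem frame_mul_mem_hurwitz (a : Fin 4) {x : ℍ[ℝ]} (hx : x ∈ hurwitz) :
    frame a * x ∈ hurwitz := by
  obtain ⟨p, q, r, s, h1, h2, h3, h4⟩ := hx
  fin_cases a
  · exact ⟨p, q, r, s, by simp [frame_zero_mul, *]⟩
  · refine ⟨-p - 2 * q, p + q, q - s, p + q + r, ?_⟩
    simp only [Fin.mk_one, frame_one_mul, re_quat, imI_quat, imJ_quat, imK_quat, h1, h2, h3, h4]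
    push_cast
    refine ⟨?_, ?_, ?_, ?_⟩ <;> ring
  · refine ⟨-p - 2 * r, p + r + s, p + r, r - q, ?_⟩
    simp only [Fin.reduceFinMk, frame_two_mul, re_quat, imI_quat, imJ_quat, imK_quat,
      h1, h2, h3, h4]
    push_cast
    refine ⟨?_, ?_, ?_, ?_⟩ <;> ring
  · refine ⟨-p - 2 * s, s - r, p + q + s, p + s, ?_⟩
    simp only [Fin.reduceFinMk, frame_three_mul, re_quat, imI_quat, imJ_quat, imK_quat,
      h1, h2, h3, h4]
    push_cast
    refine ⟨?_, ?_, ?_, ?_⟩ <;> ring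

theorem zeta_mul_mem_hurwitz {x : ℍ[ℝ]} (hx : x ∈ hurwitz) : zeta * x ∈ hurwitz := by
  obtain ⟨a, b, c, d, h1, h2, h3, h4⟩ := hx
  refine ⟨-a - b - c - d, a + b + d, a + b + c, a + c + d, ?_⟩
  simp only [zeta_eq, Quaternion.re_mul, Quaternion.imI_mul, Quaternion.imJ_mul,
    Quaternion.imK_mul, re_quat, imI_quat, imJ_quat, imK_quat, h1, h2, h3, h4]
  push_cast
  refine ⟨?_, ?_, ?_, ?_⟩ <;> ring

theorem mul_zeta_mem_hurwitz {x : ℍ[ℝ]} (hx : x ∈ hurwitz) : x * zeta ∈ hurwitz := by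
  obtain ⟨a, b, c, d, h1, h2, h3, h4⟩ := hx
  refine ⟨-a - b - c - d, a + b + c, a + c + d, a + b + d, ?_⟩
  simp only [zeta_eq, Quaternion.re_mul, Quaternion.imI_mul, Quaternion.imJ_mul,
    Quaternion.imK_mul, re_quat, imI_quat, imJ_quat, imK_quat, h1, h2, h3, h4]
  push_cast
  refine ⟨?_, ?_, ?_, ?_⟩ <;> ring

theorem zeta_pow_mul_mem_hurwitz (k : ℕ) {x : ℍ[ℝ]} (hx : x ∈ hurwitz) :
    zeta ^ k * x ∈ hurwitz := by
  induction k with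
  | zero => simpa using hx
  | succ k ih => rw [pow_succ', mul_assoc]; exact zeta_mul_mem_hurwitz ih

theorem mul_zeta_pow_mem_hurwitz (k : ℕ) {x : ℍ[ℝ]} (hx : x ∈ hurwitz) :
    x * zeta ^ k ∈ hurwitz := by
  induction k with
  | zero => simpa using hx
  | succ k ih => rw [pow_succ, ← mul_assoc]; exact mul_zeta_mem_hurwitz ih

theorem zeta_pow_three : zeta ^ 3 = -1 := by
  rw [pow_succ, sq]
  ext <;> simp only [zeta_eq, Quaternion.re_mul, Quaternion.imI_mul, Quaternion.imJ_mul,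
    Quaternion.imK_mul, re_quat, imI_quat, imJ_quat, imK_quat, Quaternion.re_neg,
    Quaternion.imI_neg, Quaternion.imJ_neg, Quaternion.imK_neg, Quaternion.re_one,
    Quaternion.imI_one, Quaternion.imJ_one, Quaternion.imK_one] <;> norm_num

theorem zeta_pow_six : zeta ^ 6 = 1 := by
  rw [show (6 : ℕ) = 3 * 2 by norm_num, pow_mul, zeta_pow_three]
  norm_num

/-- The quaternion group, as a set of quaternions. -/
def Q8 : Set ℍ[ℝ] := {q | ∃ a, q = frame a ∨ q = -frame a}

theorem neg_mem_Q8 {q : ℍ[ℝ]} (hq : q ∈ Q8) : -q ∈ Q8 := by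
  obtain ⟨a, rfl | rfl⟩ := hq
  · exact ⟨a, Or.inr rfl⟩
  · exact ⟨a, Or.inl (neg_neg _)⟩

theorem frame_mul_frame_mem_Q8 (a b : Fin 4) : frame a * frame b ∈ Q8 := by
  have h : ∃ c, (frame a * frame b = frame c ∨ frame a * frame b = -frame c) := by
    fin_cases a
    · exact ⟨b, Or.inl (frame_zero_mul _)⟩
    · fin_cases b
      · exact ⟨1, Or.inl (by simp [frame])⟩
      · exact ⟨0, Or.inr (by ext <;> simp [frame])⟩
      · exact ⟨3, Or.inl (by ext <;> simp [frame])⟩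
      · exact ⟨2, Or.inr (by ext <;> simp [frame])⟩
    · fin_cases b
      · exact ⟨2, Or.inl (by simp [frame])⟩
      · exact ⟨3, Or.inr (by ext <;> simp [frame])⟩
      · exact ⟨0, Or.inr (by ext <;> simp [frame])⟩
      · exact ⟨1, Or.inl (by ext <;> simp [frame])⟩
    · fin_cases b
      · exact ⟨3, Or.inl (by simp [frame])⟩
      · exact ⟨2, Or.inl (by ext <;> simp [frame])⟩
      · exact ⟨1, Or.inr (by ext <;> simp [frame])⟩
      · exact ⟨0, Or.inr (by ext <;> simp [frame])⟩
  exact h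

theorem mul_mem_Q8 {p q : ℍ[ℝ]} (hp : p ∈ Q8) (hq : q ∈ Q8) : p * q ∈ Q8 := by
  obtain ⟨a, rfl | rfl⟩ := hp <;> obtain ⟨b, rfl | rfl⟩ := hq
  · exact frame_mul_frame_mem_Q8 a b
  · rw [mul_neg]; exact neg_mem_Q8 (frame_mul_frame_mem_Q8 a b)
  · rw [neg_mul]; exact neg_mem_Q8 (frame_mul_frame_mem_Q8 a b)
  · rw [neg_mul_neg]; exact frame_mul_frame_mem_Q8 a b

theorem Q8_mul_mem_hurwitz {q x : ℍ[ℝ]} (hq : q ∈ Q8) (hx : x ∈ hurwitz) : q * x ∈ hurwitz := by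
  obtain ⟨a, rfl | rfl⟩ := hq
  · exact frame_mul_mem_hurwitz a hx
  · rw [neg_mul]; exact neg_mem (frame_mul_mem_hurwitz a hx)

theorem star_frame_mem_Q8 (a : Fin 4) : star (frame a) ∈ Q8 := by
  fin_cases a
  · exact ⟨0, Or.inl (by simp [frame])⟩
  · exact ⟨1, Or.inr (by ext <;> simp [frame])⟩
  · exact ⟨2, Or.inr (by ext <;> simp [frame])⟩
  · exact ⟨3, Or.inr (by ext <;> simp [frame])⟩

theorem exists_mul_eq_one_of_mem_Q8 {q : ℍ[ℝ]} (hq : q ∈ Q8) : ∃ p ∈ Q8, p * q = 1 := by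
  obtain ⟨a, rfl | rfl⟩ := hq
  · exact ⟨_, star_frame_mem_Q8 a, star_frame_mul_frame a⟩
  · exact ⟨_, neg_mem_Q8 (star_frame_mem_Q8 a), by rw [neg_mul_neg, star_frame_mul_frame]⟩

theorem zeta_mul_frame : zeta * frame 1 = frame 2 * zeta ∧ zeta * frame 2 = frame 3 * zeta ∧
    zeta * frame 3 = frame 1 * zeta := by
  refine ⟨?_, ?_, ?_⟩ <;> ext <;> simp [frame, zeta_eq]

theorem exists_zeta_mul_eq {q : ℍ[ℝ]} (hq : q ∈ Q8) : ∃ p ∈ Q8, zeta * q = p * zeta := by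
  have h : ∀ a, ∃ b, zeta * frame a = frame b * zeta := by
    obtain ⟨h1, h2, h3⟩ := zeta_mul_frame
    intro a
    fin_cases a
    · exact ⟨0, by simp [frame]⟩
    · exact ⟨2, h1⟩
    · exact ⟨3, h2⟩
    · exact ⟨1, h3⟩
  obtain ⟨a, rfl | rfl⟩ := hq
  · obtain ⟨b, hb⟩ := h a
    exact ⟨frame b, ⟨b, Or.inl rfl⟩, hb⟩
  · obtain ⟨b, hb⟩ := h a
    exact ⟨-frame b, ⟨b, Or.inr rfl⟩, by rw [mul_neg, hb, neg_mul]⟩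

theorem exists_zeta_pow_mul_eq (k : ℕ) {q : ℍ[ℝ]} (hq : q ∈ Q8) :
    ∃ p ∈ Q8, zeta ^ k * q = p * zeta ^ k := by
  induction k with
  | zero => exact ⟨q, hq, by simp⟩
  | succ k ih =>
    obtain ⟨p, hp, h⟩ := ih
    obtain ⟨p', hp', h'⟩ := exists_zeta_mul_eq hp
    exact ⟨p', hp', by rw [pow_succ', mul_assoc, h, ← mul_assoc, h', mul_assoc]⟩

/-- The normal form `x ↦ q ζᵏ x ζᵏ + 2h` of the elements of the reflection group. -/
def HasNormalForm (k : ℕ) (f : ℍ[ℝ] ≃ᵢ ℍ[ℝ]) : Prop :=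
  ∃ q ∈ Q8, ∃ h ∈ hurwitz, ∀ x, f x = q * zeta ^ k * x * zeta ^ k + 2 * h

theorem HasNormalForm.mul {k l : ℕ} {f g : ℍ[ℝ] ≃ᵢ ℍ[ℝ]} (hf : HasNormalForm k f)
    (hg : HasNormalForm l g) : HasNormalForm (k + l) (f * g) := by
  obtain ⟨q, hq, h, hh, hf⟩ := hf
  obtain ⟨q', hq', h', hh', hg⟩ := hg
  obtain ⟨p, hp, hpq⟩ := exists_zeta_pow_mul_eq k hq'
  refine ⟨q * p, mul_mem_Q8 hq hp, q * (zeta ^ k * h') * zeta ^ k + h, add_mem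
    (mul_zeta_pow_mem_hurwitz k (Q8_mul_mem_hurwitz hq (zeta_pow_mul_mem_hurwitz k hh'))) hh, ?_⟩
  intro x
  change f (g x) = _
  rw [hg, hf]
  have e1 : q * p * zeta ^ (k + l) * x * zeta ^ (k + l) =
      q * (p * zeta ^ k) * zeta ^ l * x * zeta ^ l * zeta ^ k := by
    rw [pow_add, (Commute.refl zeta).pow_pow k l |>.eq]
    rw [← (Commute.refl zeta).pow_pow k l |>.eq]
    nth_rewrite 2 [(Commute.refl zeta).pow_pow k l |>.eq]
    noncomm_ring
  rw [e1, ← hpq, two_mul, two_mul, two_mul]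
  noncomm_ring

/-- The exponent `5 * k` plays the role of `-k`, since `ζ ^ 6 = 1`. -/
theorem HasNormalForm.inv {k : ℕ} {f : ℍ[ℝ] ≃ᵢ ℍ[ℝ]} (hf : HasNormalForm k f) :
    HasNormalForm (5 * k) f⁻¹ := by
  obtain ⟨q, hq, h, hh, hf⟩ := hf
  obtain ⟨p, hp, hpq⟩ := exists_mul_eq_one_of_mem_Q8 hq
  obtain ⟨p', hp', hpp'⟩ := exists_zeta_pow_mul_eq (5 * k) hp
  have h1 : zeta ^ (5 * k) * zeta ^ k = 1 := by
    rw [← pow_add, show 5 * k + k = 6 * k by ring, pow_mul, zeta_pow_six, one_pow]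
  have h2 : zeta ^ k * zeta ^ (5 * k) = 1 := by
    rw [← pow_add, show k + 5 * k = 6 * k by ring, pow_mul, zeta_pow_six, one_pow]
  refine ⟨p', hp', -(p' * (zeta ^ (5 * k) * h) * zeta ^ (5 * k)), neg_mem
    (mul_zeta_pow_mem_hurwitz _ (Q8_mul_mem_hurwitz hp' (zeta_pow_mul_mem_hurwitz _ hh))), ?_⟩
  intro y
  obtain ⟨x, rfl⟩ := f.surjective y
  change f.symm (f x) = _
  rw [f.symm_apply_apply, hf, ← hpp']
  have e : zeta ^ (5 * k) * p * (q * zeta ^ k * x * zeta ^ k) * zeta ^ (5 * k) = x := by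
    calc zeta ^ (5 * k) * p * (q * zeta ^ k * x * zeta ^ k) * zeta ^ (5 * k)
        = zeta ^ (5 * k) * (p * q) * zeta ^ k * x * (zeta ^ k * zeta ^ (5 * k)) := by
          noncomm_ring
      _ = x := by rw [hpq, h2, mul_one, mul_one, h1, one_mul]
  rw [mul_add, add_mul, e, ← mul_assoc p', ← hpp', two_mul, two_mul]
  noncomm_ring

/-- The factors `ζ ^ 3 = -1` on the left and on the right cancel. -/
theorem HasNormalForm.of_add_three {k : ℕ} {f : ℍ[ℝ] ≃ᵢ ℍ[ℝ]} (hf : HasNormalForm (k + 3) f) :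
    HasNormalForm k f := by
  obtain ⟨q, hq, h, hh, hf⟩ := hf
  refine ⟨q, hq, h, hh, fun x => ?_⟩
  rw [hf, pow_add, zeta_pow_three]
  simp

theorem r1_apply (x : ℍ[ℝ]) : r1 x = zeta * x * zeta := add_zero _

theorem r1'_apply (x : ℍ[ℝ]) : r1' x = zeta * x * zeta + 2 := rfl

theorem ri_coe : ((iU⁻¹ * zetaU * iU : unitary ℍ[ℝ]) : ℍ[ℝ]) = -frame 3 * zeta := by
  change star quatI * zeta * quatI = _
  ext <;> simp [frame, zeta_eq, quatI_eq]

theorem ri_apply (x : ℍ[ℝ]) : ri x = -frame 3 * zeta * x * zeta := by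
  rw [← ri_coe]
  exact add_zero _

theorem one_mem_hurwitz : (1 : ℍ[ℝ]) ∈ hurwitz :=
  ⟨2, -1, -1, -1, by norm_num⟩

theorem exists_hasNormalForm {f : ℍ[ℝ] ≃ᵢ ℍ[ℝ]} (hf : f ∈ reflGroup) :
    ∃ k, HasNormalForm k f := by
  induction hf using Subgroup.closure_induction with
  | mem f hf =>
    refine ⟨1, ?_⟩
    have h0 : (1 : ℍ[ℝ]) ∈ Q8 := ⟨0, Or.inl rfl⟩
    rcases hf with rfl | rfl | rfl
    · exact ⟨1, h0, 0, zero_mem _, fun x => by rw [r1_apply]; simp⟩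
    · exact ⟨-frame 3, ⟨3, Or.inr rfl⟩, 0, zero_mem _, fun x => by rw [ri_apply]; simp⟩
    · exact ⟨1, h0, 1, one_mem_hurwitz, fun x => by rw [r1'_apply]; simp⟩
  | one => exact ⟨0, 1, ⟨0, Or.inl rfl⟩, 0, zero_mem _, fun x => by simp⟩
  | mul f g _ _ hf hg =>
    obtain ⟨k, hf⟩ := hf
    obtain ⟨l, hg⟩ := hg
    exact ⟨k + l, hf.mul hg⟩
  | inv f _ hf =>
    obtain ⟨k, hf⟩ := hf
    exact ⟨5 * k, hf.inv⟩

theorem HasNormalForm.mod {k : ℕ} {f : ℍ[ℝ] ≃ᵢ ℍ[ℝ]} (hf : HasNormalForm k f) :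
    HasNormalForm 0 f ∨ HasNormalForm 1 f ∨ HasNormalForm 2 f := by
  induction k using Nat.strong_induction_on with
  | _ k ih =>
    match k, hf, ih with
    | 0, hf, _ => exact Or.inl hf
    | 1, hf, _ => exact Or.inr (Or.inl hf)
    | 2, hf, _ => exact Or.inr (Or.inr hf)
    | k + 3, hf, ih => exact ih k (by omega) hf.of_add_three

/-! ### Fixed points -/

theorem zeta_mul_mul_zeta (y : ℍ[ℝ]) : zeta * y * zeta =
    quat (-y.re / 2 - (y.imI + y.imJ + y.imK) / 2)
      (y.imI - (y.imI + y.imJ + y.imK) / 2 + y.re / 2)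
      (y.imJ - (y.imI + y.imJ + y.imK) / 2 + y.re / 2)
      (y.imK - (y.imI + y.imJ + y.imK) / 2 + y.re / 2) := by
  ext <;> simp only [zeta_eq, Quaternion.re_mul, Quaternion.imI_mul, Quaternion.imJ_mul,
    Quaternion.imK_mul, re_quat, imI_quat, imJ_quat, imK_quat] <;> ring

theorem zeta_mul_mul_zeta_eq_self_iff {y : ℍ[ℝ]} : zeta * y * zeta = y ↔ y ∈ basicLine := by
  rw [zeta_mul_mul_zeta, mem_basicLine]
  constructor
  · intro h
    have h1 := congrArg (fun q : ℍ[ℝ] => q.re) h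
    have h2 := congrArg (fun q : ℍ[ℝ] => q.imI) h
    simp only [re_quat, imI_quat] at h1 h2
    constructor <;> linarith
  · rintro ⟨h1, h2⟩
    ext <;> simp [h1, h2]

theorem two_mul_coord (h : ℍ[ℝ]) : (2 * h).re = 2 * h.re ∧ (2 * h).imI = 2 * h.imI ∧
    (2 * h).imJ = 2 * h.imJ ∧ (2 * h).imK = 2 * h.imK := by
  rw [two_mul]
  refine ⟨?_, ?_, ?_, ?_⟩ <;> simp <;> ring

theorem exists_sub_mem_basicLine {y h : ℍ[ℝ]} (hh : h ∈ hurwitz)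
    (hy : zeta * y * zeta + 2 * h = y) : ∃ d ∈ latticeD4, y - d ∈ basicLine := by
  obtain ⟨a, b, c, d, k1, k2, k3, k4⟩ := hh
  rw [zeta_mul_mul_zeta] at hy
  obtain ⟨t1, t2, t3, t4⟩ := two_mul_coord h
  have e1 := congrArg (fun q : ℍ[ℝ] => q.re) hy
  have e2 := congrArg (fun q : ℍ[ℝ] => q.imI) hy
  have e3 := congrArg (fun q : ℍ[ℝ] => q.imJ) hy
  have e4 := congrArg (fun q : ℍ[ℝ] => q.imK) hy
  simp only [Quaternion.re_add, Quaternion.imI_add, Quaternion.imJ_add, Quaternion.imK_add,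
    re_quat, imI_quat, imJ_quat, imK_quat, t1, t2, t3, t4, k1, k2, k3, k4] at e1 e2 e3 e4
  -- Modulo the basic line, `y` is determined by its real part and the sum of its imaginary parts.
  -- The fixed-point equation gives them as `-b` and `2 * a + 3 * b`, whose total is even; the whole
  -- imaginary sum is placed in one coordinate.
  refine ⟨quat ((-b : ℤ) : ℝ) ((2 * a + 3 * b : ℤ) : ℝ) ((0 : ℤ) : ℝ) ((0 : ℤ) : ℝ),
    ⟨-b, 2 * a + 3 * b, 0, 0, ⟨rfl, rfl, rfl, rfl⟩, by grind⟩, ?_, ?_⟩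
  · simp only [Quaternion.re_sub, re_quat]
    push_cast; linarith
  · simp only [Quaternion.imI_sub, Quaternion.imJ_sub, Quaternion.imK_sub, imI_quat, imJ_quat,
      imK_quat]
    push_cast; linarith

theorem eq_quat_of_neg_fixed {y h : ℍ[ℝ]} (hy : -(zeta * y * zeta) + 2 * h = y) :
    y = quat (h.re + h.imI + h.imJ + h.imK) (h.imI - h.re) (h.imJ - h.re) (h.imK - h.re) := by
  rw [zeta_mul_mul_zeta] at hy
  obtain ⟨t1, t2, t3, t4⟩ := two_mul_coord h
  have e1 := congrArg (fun q : ℍ[ℝ] => q.re) hy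
  have e2 := congrArg (fun q : ℍ[ℝ] => q.imI) hy
  have e3 := congrArg (fun q : ℍ[ℝ] => q.imJ) hy
  have e4 := congrArg (fun q : ℍ[ℝ] => q.imK) hy
  simp only [Quaternion.re_add, Quaternion.imI_add, Quaternion.imJ_add, Quaternion.imK_add,
    Quaternion.re_neg, Quaternion.imI_neg, Quaternion.imJ_neg, Quaternion.imK_neg,
    re_quat, imI_quat, imJ_quat, imK_quat, t1, t2, t3, t4] at e1 e2 e3 e4
  ext <;> simp only [re_quat, imI_quat, imJ_quat, imK_quat] <;> linarith

theorem mem_hurwitz_of_neg_fixed {y h : ℍ[ℝ]} (hh : h ∈ hurwitz)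
    (hy : -(zeta * y * zeta) + 2 * h = y) : y ∈ hurwitz := by
  rw [eq_quat_of_neg_fixed hy]
  obtain ⟨a, b, c, d, k1, k2, k3, k4⟩ := hh
  refine ⟨2 * (2 * a + b + c + d), b - (2 * a + b + c + d), c - (2 * a + b + c + d),
    d - (2 * a + b + c + d), ?_⟩
  simp only [re_quat, imI_quat, imJ_quat, imK_quat, k1, k2, k3, k4]
  push_cast
  refine ⟨?_, ?_, ?_, ?_⟩ <;> ring

/-- The eight products are the four conjugates of `ζ` by the frame and their negatives. The sign
decides between a reflection and an isolated fixed point. -/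
theorem Q8_mul_zeta {q : ℍ[ℝ]} (hq : q ∈ Q8) : ∃ a, q * zeta = star (frame a) * zeta * frame a ∨
    q * zeta = -(star (frame a) * zeta * frame a) := by
  have h : ∀ b : Fin 4, ∃ a, frame b * zeta = star (frame a) * zeta * frame a ∨
      frame b * zeta = -(star (frame a) * zeta * frame a) := by
    intro b
    fin_cases b
    · exact ⟨0, Or.inl (by simp [frame])⟩
    · exact ⟨2, Or.inr (by ext <;> simp [frame, zeta_eq])⟩
    · exact ⟨3, Or.inr (by ext <;> simp [frame, zeta_eq])⟩
    · exact ⟨1, Or.inr (by ext <;> simp [frame, zeta_eq])⟩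
  obtain ⟨b, rfl | rfl⟩ := hq
  · exact h b
  · obtain ⟨a, ha | ha⟩ := h b
    · exact ⟨a, Or.inr (by rw [neg_mul, ha])⟩
    · exact ⟨a, Or.inl (by rw [neg_mul, ha, neg_neg])⟩

theorem star_frame_mul_mem_hurwitz (a : Fin 4) {x : ℍ[ℝ]} (hx : x ∈ hurwitz) :
    star (frame a) * x ∈ hurwitz := Q8_mul_mem_hurwitz (star_frame_mem_Q8 a) hx

theorem frame_mul_two_mul (a : Fin 4) (h : ℍ[ℝ]) : frame a * (2 * h) = 2 * (frame a * h) := by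
  rw [two_mul, two_mul, mul_add]

theorem frame_mul_conj (a : Fin 4) (y : ℍ[ℝ]) :
    frame a * (star (frame a) * zeta * frame a * y * zeta) = zeta * (frame a * y) * zeta := by
  simp only [mul_assoc, frame_mul_star_frame_mul]

theorem frame_mul_right_injective (a : Fin 4) : Function.Injective (frame a * ·) := fun x y e => by
  have := congrArg (star (frame a) * ·) e
  simpa only [star_frame_mul_frame_mul] using this

/-- Multiplying by `frame a` turns the fixed-point equation into `±ζ y ζ + 2h = y`. With the plus
sign the solutions form a translate of the basic line; with the minus sign the linear system has a
unique solution, and it is Hurwitz. -/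
theorem fixed_of_hasNormalForm_one {f : ℍ[ℝ] ≃ᵢ ℍ[ℝ]} (hf : HasNormalForm 1 f) {x : ℍ[ℝ]}
    (hx : f x = x) : (∃ d ∈ latticeD4, ∃ a, x ∈ wall d a ∧ ∀ y, f y = y ↔ y ∈ wall d a) ∨
      (x ∈ hurwitz ∧ ∀ y, f y = y → y = x) := by
  obtain ⟨q, hq, h, hh, hf⟩ := hf
  obtain ⟨a, ha | ha⟩ := Q8_mul_zeta hq
  · left
    have key : ∀ y, f y = y ↔ zeta * (frame a * y) * zeta + 2 * (frame a * h) = frame a * y := by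
      intro y
      rw [hf, pow_one, ha, ← frame_mul_two_mul, ← frame_mul_conj, ← mul_add]
      exact (frame_mul_right_injective a).eq_iff.symm
    obtain ⟨d, hd, hyd⟩ := exists_sub_mem_basicLine (frame_mul_mem_hurwitz a hh) ((key x).1 hx)
    have hxd : x ∈ wall (star (frame a) * d) a := by
      change frame a * (x - star (frame a) * d) ∈ basicLine
      rwa [mul_sub, frame_mul_star_frame_mul]
    refine ⟨_, star_frame_mul_mem_latticeD4 a hd, a, hxd, fun y => ?_⟩
    rw [wall_eq_of_mem hxd, key]
    change _ ↔ frame a * (y - x) ∈ basicLine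
    have hx' := (key x).1 hx
    rw [← zeta_mul_mul_zeta_eq_self_iff, mul_sub]
    have e : zeta * (frame a * y - frame a * x) * zeta =
        zeta * (frame a * y) * zeta + 2 * (frame a * h) -
          (zeta * (frame a * x) * zeta + 2 * (frame a * h)) := by noncomm_ring
    rw [e, hx', sub_left_inj]
  · right
    have key : ∀ y, f y = y →
        -(zeta * (frame a * y) * zeta) + 2 * (frame a * h) = frame a * y := by
      intro y e
      rw [hf, pow_one, ha, neg_mul, neg_mul] at e
      rw [← frame_mul_two_mul, ← frame_mul_conj, ← mul_neg, ← mul_add, e]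
    constructor
    · have := star_frame_mul_mem_hurwitz a
        (mem_hurwitz_of_neg_fixed (frame_mul_mem_hurwitz a hh) (key x hx))
      rwa [star_frame_mul_frame_mul] at this
    · intro y hy
      have e := (eq_quat_of_neg_fixed (key y hy)).trans (eq_quat_of_neg_fixed (key x hx)).symm
      rw [← star_frame_mul_frame_mul a y, e, star_frame_mul_frame_mul]

theorem two_mul_left_cancel {u v : ℍ[ℝ]} (e : 2 * u = 2 * v) : u = v := by
  obtain ⟨h1, h2, h3, h4⟩ := two_mul_coord u
  obtain ⟨k1, k2, k3, k4⟩ := two_mul_coord v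
  rw [e] at h1 h2 h3 h4
  ext <;> linarith

theorem eq_one_or_eq_neg_one_or_mul_self_of_mem_Q8 {q : ℍ[ℝ]} (hq : q ∈ Q8) :
    q = 1 ∨ q = -1 ∨ q * q = -1 := by
  have h : ∀ a, frame a = 1 ∨ frame a * frame a = -1 := by
    intro a
    fin_cases a
    · exact Or.inl rfl
    all_goals right; ext <;> simp [frame]
  obtain ⟨a, rfl | rfl⟩ := hq
  · exact (h a).imp id Or.inr
  · rcases h a with h | h
    · rw [h]; exact Or.inr (Or.inl rfl)
    · exact Or.inr (Or.inr (by rw [neg_mul_neg, h]))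

theorem fixed_of_hasNormalForm_zero {f : ℍ[ℝ] ≃ᵢ ℍ[ℝ]} (hf : HasNormalForm 0 f) (h1 : f ≠ 1)
    {x : ℍ[ℝ]} (hx : f x = x) : x ∈ hurwitz ∧ ∀ y, f y = y → y = x := by
  obtain ⟨q, hq, h, hh, hf⟩ := hf
  simp only [pow_zero, mul_one] at hf
  have key : ∃ c ∈ hurwitz, ∀ y, f y = y → y = c := by
    rcases eq_one_or_eq_neg_one_or_mul_self_of_mem_Q8 hq with rfl | rfl | hqq
    · refine absurd ?_ h1
      have h0 : 2 * h = 0 := by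
        have := hf x
        rwa [hx, one_mul, left_eq_add] at this
      ext1 y
      rw [hf, h0, one_mul, add_zero]
      rfl
    · refine ⟨h, hh, fun y hy => two_mul_left_cancel ?_⟩
      rw [hf] at hy
      rw [two_mul y]
      nth_rewrite 1 [← hy]
      rw [neg_one_mul]
      abel
    -- From `q * q = -1` one has `(1 + q) * (1 - q) = 2`, so `2 * h = (1 - q) * y` yields `y = (1 +
    -- q) * h`.
    · refine ⟨h + q * h, add_mem hh (Q8_mul_mem_hurwitz hq hh), fun y hy =>
        two_mul_left_cancel ?_⟩
      rw [hf] at hy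
      have e : 2 * h = y - q * y := eq_sub_of_add_eq' hy
      have e' : 2 * (q * h) = q * (2 * h) := by rw [two_mul, two_mul, mul_add]
      rw [mul_add, e', e, mul_sub, ← mul_assoc, hqq, two_mul, neg_one_mul]
      abel
  obtain ⟨c, hc, hfix⟩ := key
  exact ⟨hfix x hx ▸ hc, fun y hy => (hfix y hy).trans (hfix x hx).symm⟩

/-- The fixed points of a nontrivial element of the reflection group form a wall or consist of a
single Hurwitz integer. -/
theorem fixed_of_mem_reflGroup {f : ℍ[ℝ] ≃ᵢ ℍ[ℝ]} (hf : f ∈ reflGroup) (h1 : f ≠ 1) {x : ℍ[ℝ]}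
    (hx : f x = x) : (∃ d ∈ latticeD4, ∃ a, x ∈ wall d a ∧ ∀ y, f y = y ↔ y ∈ wall d a) ∨
      (x ∈ hurwitz ∧ ∀ y, f y = y → y = x) := by
  obtain ⟨k, hk⟩ := exists_hasNormalForm hf
  rcases hk.mod with h | h | h
  · exact Or.inr (fixed_of_hasNormalForm_zero h h1 hx)
  · exact fixed_of_hasNormalForm_one h hx
  -- The inverse has the same fixed points, and its exponent 10 is reduced to 1 modulo 3.
  · have hinv : HasNormalForm 1 f⁻¹ :=
      HasNormalForm.of_add_three (HasNormalForm.of_add_three (HasNormalForm.of_add_three h.inv))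
    have hfix : ∀ y, f⁻¹ y = y ↔ f y = y := fun y => by
      change f.symm y = y ↔ f y = y
      rw [f.symm_apply_eq, eq_comm]
    have := fixed_of_hasNormalForm_one hinv ((hfix x).2 hx)
    simpa only [hfix] using this

end

end ReflG4

namespace ReflG4

noncomputable section

/-! ### Translations, point reflections and reflections in the group -/

/-- The maps in the reflection group, as maps of quaternions. -/
def InGroup (φ : ℍ[ℝ] → ℍ[ℝ]) : Prop := ∃ f ∈ reflGroup, ∀ x, f x = φ x

theorem InGroup.comp {φ ψ : ℍ[ℝ] → ℍ[ℝ]} (hφ : InGroup φ) (hψ : InGroup ψ) :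
    InGroup (fun x => φ (ψ x)) := by
  obtain ⟨f, hf, hfφ⟩ := hφ
  obtain ⟨g, hg, hgψ⟩ := hψ
  exact ⟨f * g, mul_mem hf hg, fun x => by
    change f (g x) = _
    rw [hgψ, hfφ]⟩

theorem InGroup.of_leftInverse {φ ψ : ℍ[ℝ] → ℍ[ℝ]} (hφ : InGroup φ) (h : ∀ x, φ (ψ x) = x) :
    InGroup ψ := by
  obtain ⟨f, hf, hfφ⟩ := hφ
  exact ⟨f⁻¹, inv_mem hf, fun x => f.symm_apply_eq.2 (by rw [hfφ, h])⟩

theorem InGroup.congr {φ ψ : ℍ[ℝ] → ℍ[ℝ]} (hφ : InGroup φ) (h : ∀ x, φ x = ψ x) : InGroup ψ := by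
  rwa [← funext h]

theorem inGroup_r1 : InGroup fun x => zeta * x * zeta :=
  ⟨r1, Subgroup.subset_closure (by simp), r1_apply⟩

theorem inGroup_r1' : InGroup fun x => zeta * x * zeta + 2 :=
  ⟨r1', Subgroup.subset_closure (by simp), r1'_apply⟩

theorem inGroup_ri : InGroup fun x => -frame 3 * zeta * x * zeta :=
  ⟨ri, Subgroup.subset_closure (by simp), ri_apply⟩

theorem zeta_mul_sq : zeta * -zeta ^ 2 = 1 := by
  rw [mul_neg, ← pow_succ', zeta_pow_three, neg_neg]

theorem sq_mul_zeta : -zeta ^ 2 * zeta = 1 := by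
  rw [neg_mul, ← pow_succ, zeta_pow_three, neg_neg]

theorem inGroup_r1_inv : InGroup fun x => -zeta ^ 2 * x * -zeta ^ 2 :=
  inGroup_r1.of_leftInverse fun x => by
    calc zeta * (-zeta ^ 2 * x * -zeta ^ 2) * zeta
        = (zeta * -zeta ^ 2) * x * (-zeta ^ 2 * zeta) := by noncomm_ring
      _ = x := by rw [zeta_mul_sq, sq_mul_zeta, one_mul, mul_one]

theorem zeta_conj (q x : ℍ[ℝ]) : zeta * (q * (-zeta ^ 2 * x * -zeta ^ 2)) * zeta =
    zeta * q * -zeta ^ 2 * x := by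
  calc zeta * (q * (-zeta ^ 2 * x * -zeta ^ 2)) * zeta
      = zeta * q * -zeta ^ 2 * x * (-zeta ^ 2 * zeta) := by noncomm_ring
    _ = _ := by rw [sq_mul_zeta, mul_one]

/-- The composite of `ri` with the inverse of `r1` is left multiplication by `-k`, and conjugation
by `r1` permutes left multiplications by `i`, `j`, `k` cyclically. -/
theorem inGroup_frame_mul (a : Fin 4) : InGroup fun x => frame a * x := by
  obtain ⟨h1, h2, h3⟩ := zeta_mul_frame
  have neg : ∀ q : ℍ[ℝ], InGroup (fun x => q * x) → InGroup fun x => zeta * q * -zeta ^ 2 * x :=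
    fun q hq => (inGroup_r1.comp (hq.comp inGroup_r1_inv)).congr fun x => zeta_conj q x
  have hn3 : InGroup fun x => -frame 3 * x := (inGroup_ri.comp inGroup_r1_inv).congr fun x => by
    rw [mul_assoc (-frame 3) zeta, mul_assoc (-frame 3), ← mul_assoc zeta, ← mul_assoc zeta,
      zeta_mul_sq, one_mul, mul_assoc, sq_mul_zeta, mul_one]
  have f3 : InGroup fun x => frame 3 * x := hn3.of_leftInverse fun x => by
    rw [← mul_assoc, show -frame 3 * frame 3 = 1 by ext <;> simp [frame], one_mul]
  have f1 : InGroup fun x => frame 1 * x := (neg _ f3).congr fun x => by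
    rw [h3, mul_assoc (frame 1), zeta_mul_sq, mul_one]
  have f2 : InGroup fun x => frame 2 * x := (neg _ f1).congr fun x => by
    rw [h1, mul_assoc (frame 2), zeta_mul_sq, mul_one]
  fin_cases a
  · exact (hn3.comp f3).congr fun x => by
      rw [← mul_assoc, show -frame 3 * frame 3 = 1 by ext <;> simp [frame]]
      rfl
  · exact f1
  · exact f2
  · exact f3

theorem inGroup_neg : InGroup fun x => -x :=
  ((inGroup_frame_mul 1).comp (inGroup_frame_mul 1)).congr fun x => by
    rw [← mul_assoc, show frame 1 * frame 1 = -1 by ext <;> simp [frame], neg_one_mul]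

theorem inGroup_star_frame_mul (a : Fin 4) : InGroup fun x => star (frame a) * x :=
  (inGroup_frame_mul a).of_leftInverse fun x => frame_mul_star_frame_mul a x

/-- The vectors `h` such that the translation by `2h` belongs to the reflection group. -/
def halfTranslations : AddSubgroup ℍ[ℝ] where
  carrier := {h | InGroup fun x => x + 2 * h}
  zero_mem' := ⟨1, one_mem _, fun x => by simp⟩
  add_mem' := fun {h k} hh hk => (InGroup.comp hh hk).congr fun x => by
    rw [mul_add]; abel
  neg_mem' := fun {h} hh => InGroup.of_leftInverse hh fun x => by
    rw [mul_neg, neg_add_cancel_right]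

theorem one_mem_halfTranslations : (1 : ℍ[ℝ]) ∈ halfTranslations :=
  (inGroup_r1'.comp inGroup_r1_inv).congr fun x => by
    calc zeta * (-zeta ^ 2 * x * -zeta ^ 2) * zeta + 2
        = (zeta * -zeta ^ 2) * x * (-zeta ^ 2 * zeta) + 2 := by noncomm_ring
      _ = x + 2 * 1 := by rw [zeta_mul_sq, sq_mul_zeta, one_mul, mul_one, mul_one]

theorem frame_mul_mem_halfTranslations (a : Fin 4) {h : ℍ[ℝ]} (hh : h ∈ halfTranslations) :
    frame a * h ∈ halfTranslations :=
  ((inGroup_frame_mul a).comp (InGroup.comp hh (inGroup_star_frame_mul a))).congr fun x => by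
    rw [mul_add, frame_mul_star_frame_mul, frame_mul_two_mul]

theorem zeta_mul_mul_zeta_mem_halfTranslations {h : ℍ[ℝ]} (hh : h ∈ halfTranslations) :
    zeta * h * zeta ∈ halfTranslations :=
  (inGroup_r1.comp (InGroup.comp hh inGroup_r1_inv)).congr fun x => by
    calc zeta * (-zeta ^ 2 * x * -zeta ^ 2 + 2 * h) * zeta
        = (zeta * -zeta ^ 2) * x * (-zeta ^ 2 * zeta) + zeta * (2 * h) * zeta := by noncomm_ring
      _ = x + 2 * (zeta * h * zeta) := by
        rw [zeta_mul_sq, sq_mul_zeta, one_mul, mul_one, two_mul, two_mul]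
        noncomm_ring

/-- From 1 one obtains the frame, and `ζ = ζ * 1 * ζ + 1`; these elements generate the Hurwitz
integers. -/
theorem hurwitz_le_halfTranslations : hurwitz ≤ halfTranslations := by
  have e0 := one_mem_halfTranslations
  have e : ∀ a, frame a ∈ halfTranslations := fun a => by
    simpa using frame_mul_mem_halfTranslations a e0
  have ez : zeta ∈ halfTranslations := by
    have := add_mem (zeta_mul_mul_zeta_mem_halfTranslations e0) e0
    convert this using 1
    rw [zeta_mul_mul_zeta]
    ext <;> simp [zeta_eq]; norm_num
  rintro x ⟨a, b, c, d, h1, h2, h3, h4⟩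
  have hx : x = a • zeta + b • frame 1 + c • frame 2 + d • frame 3 := by
    ext <;> simp [h1, h2, h3, h4, zeta_eq, frame] <;> ring
  rw [hx]
  exact add_mem (add_mem (add_mem (zsmul_mem ez a) (zsmul_mem (e 1) b)) (zsmul_mem (e 2) c))
    (zsmul_mem (e 3) d)

theorem inGroup_point_reflection {h : ℍ[ℝ]} (hh : h ∈ hurwitz) : InGroup fun x => -x + 2 * h :=
  InGroup.comp (hurwitz_le_halfTranslations hh) inGroup_neg

/-- This is the translation part of the reflection in a wall through `e`. It is twice a Hurwitz
integer because the coordinate sum of `e` is even: with sum `2 * m` it is the quaternion with real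
part `a + m` and all imaginary parts `m - a`. -/
theorem exists_sub_zeta_mul_mul_zeta {e : ℍ[ℝ]} (he : e ∈ latticeD4) :
    ∃ h ∈ hurwitz, e - zeta * e * zeta = 2 * h := by
  obtain ⟨a, b, c, d, ⟨h1, h2, h3, h4⟩, hev⟩ := he
  obtain ⟨m, hm⟩ := hev
  have hm' : (a + b + c + d : ℝ) = 2 * m := by exact_mod_cast (by omega : a + b + c + d = 2 * m)
  refine ⟨quat ((a + m : ℤ) / 2) ((a + m : ℤ) / 2 + (-a : ℤ)) ((a + m : ℤ) / 2 + (-a : ℤ))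
    ((a + m : ℤ) / 2 + (-a : ℤ)), ⟨a + m, -a, -a, -a, rfl, rfl, rfl, rfl⟩, ?_⟩
  obtain ⟨k1, k2, k3, k4⟩ := two_mul_coord (quat ((a + m : ℤ) / 2) ((a + m : ℤ) / 2 + (-a : ℤ))
    ((a + m : ℤ) / 2 + (-a : ℤ)) ((a + m : ℤ) / 2 + (-a : ℤ)))
  rw [zeta_mul_mul_zeta]
  ext
  · rw [k1]; simp only [Quaternion.re_sub, re_quat, h1, h2, h3, h4]; push_cast; linarith
  · rw [k2]; simp only [Quaternion.imI_sub, imI_quat, h1, h2, h3, h4]; push_cast; linarith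
  · rw [k3]; simp only [Quaternion.imJ_sub, imJ_quat, h1, h2, h3, h4]; push_cast; linarith
  · rw [k4]; simp only [Quaternion.imK_sub, imK_quat, h1, h2, h3, h4]; push_cast; linarith

/-- The reflection with fixed line `wall d a`. -/
def wallReflection (d : ℍ[ℝ]) (a : Fin 4) (y : ℍ[ℝ]) : ℍ[ℝ] :=
  star (frame a) * (zeta * (frame a * (y - d)) * zeta) + d

theorem inGroup_wallReflection {d : ℍ[ℝ]} (hd : d ∈ latticeD4) (a : Fin 4) :
    InGroup (wallReflection d a) := by
  obtain ⟨h, hh, e⟩ := exists_sub_zeta_mul_mul_zeta (frame_mul_mem_latticeD4 a hd)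
  refine ((inGroup_star_frame_mul a).comp (InGroup.comp (hurwitz_le_halfTranslations hh)
    (inGroup_r1.comp (inGroup_frame_mul a)))).congr fun x => ?_
  rw [← e, wallReflection]
  apply frame_mul_right_injective a
  simp only [mul_add, frame_mul_star_frame_mul]
  noncomm_ring

theorem wallReflection_eq_self_iff {d : ℍ[ℝ]} {a : Fin 4} {y : ℍ[ℝ]} :
    wallReflection d a y = y ↔ y ∈ wall d a := by
  change _ ↔ frame a * (y - d) ∈ basicLine
  rw [← zeta_mul_mul_zeta_eq_self_iff, wallReflection, ← eq_sub_iff_add_eq,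
    ← (frame_mul_right_injective a).eq_iff]
  simp only [frame_mul_star_frame_mul]

/-- This exhibits `x ↦ ζ x ζ` as the complex reflection with `v = 1` and `z = ω`. -/
theorem sub_complexPart (u : ℍ[ℝ]) : u - (1 - omega) * complexPart u = zeta * u * zeta := by
  rw [zeta_mul_mul_zeta]
  have e : complexPart u = quat u.re ((u.imI + u.imJ + u.imK) / 3) ((u.imI + u.imJ + u.imK) / 3)
    ((u.imI + u.imJ + u.imK) / 3) := rfl
  rw [e, omega_eq]
  ext <;> simp <;> ring

theorem omega_pow_three : omega ^ 3 = 1 := by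
  rw [pow_succ, sq, omega_eq]
  ext <;> simp <;> norm_num

theorem isComplexReflection_wallReflection (d : ℍ[ℝ]) (a : Fin 4) :
    IsComplexReflection (wallReflection d a) := by
  refine ⟨d, star (frame a), omega, ?_, Submodule.subset_span (by simp), ?_,
    ⟨3, by norm_num, omega_pow_three⟩, fun w => ?_⟩
  · have := norm_star_frame_mul a 1
    rwa [mul_one, norm_one] at this
  · intro h
    have := congrArg (fun q : ℍ[ℝ] => q.imI) h
    simp [omega_eq] at this
  · rw [wallReflection, add_sub_cancel_left, ← sub_complexPart, hermitian, star_star, mul_sub,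
      star_frame_mul_frame_mul, ← mul_assoc, add_comm]

theorem IsComplexReflection.ne_id {f : ℍ[ℝ] → ℍ[ℝ]} (hf : IsComplexReflection f) :
    ∃ x, f x ≠ x := by
  obtain ⟨p, v, z, hv, -, hz, -, hf⟩ := hf
  refine ⟨p + v, fun h => ?_⟩
  rw [hf, add_right_inj, sub_eq_self, hermitian, Quaternion.star_mul_self] at h
  have e : complexPart ((Quaternion.normSq v : ℝ) : ℍ[ℝ]) = 1 := by
    rw [Quaternion.normSq_eq_norm_mul_self, hv]
    ext <;> simp [complexPart]
  rw [e, mul_one, mul_eq_zero, sub_eq_zero] at h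
  rcases h with h | h
  · rw [h, norm_zero] at hv
    exact zero_ne_one hv
  · exact hz h.symm

/-- The quaternion `i - j` has zero complex part, so `v * (i - j)` is orthogonal to `v`. Two fixed
points exclude the case of an isolated fixed point. -/
theorem IsComplexReflection.exists_fixed {f : ℍ[ℝ] → ℍ[ℝ]} (hf : IsComplexReflection f) :
    ∃ x y, x ≠ y ∧ f x = x ∧ f y = y := by
  obtain ⟨p, v, z, hv, -, -, -, hf⟩ := hf
  have hv0 : v ≠ 0 := fun h => by rw [h, norm_zero] at hv; exact zero_ne_one hv
  have c0 : complexPart 0 = 0 := by ext <;> simp [complexPart]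
  have c1 : complexPart (quat 0 1 (-1) 0) = 0 := by ext <;> simp [complexPart]
  have hu : quat 0 1 (-1) 0 ≠ 0 := fun h => by
    simpa using congrArg (fun q : ℍ[ℝ] => q.imI) h
  refine ⟨p + 0, p + v * quat 0 1 (-1) 0, ?_, ?_, ?_⟩
  · rw [Ne, add_right_inj]
    exact (mul_ne_zero hv0 hu).symm
  · rw [hf, hermitian, mul_zero, c0]
    simp
  · have e : star v * (v * quat 0 1 (-1) 0) = quat 0 1 (-1) 0 := by
      rw [← mul_assoc, Quaternion.star_mul_self, Quaternion.normSq_eq_norm_mul_self, hv]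
      simp
    rw [hf, hermitian, e, c1, mul_zero, sub_zero]

/-- The fixed points of a complex reflection in the group form a wall. -/
theorem exists_wall_of_isComplexReflection {f : ℍ[ℝ] ≃ᵢ ℍ[ℝ]} (hf : f ∈ reflGroup)
    (hr : IsComplexReflection f) : ∃ d ∈ latticeD4, ∃ a, ∀ y, f y = y ↔ y ∈ wall d a := by
  obtain ⟨x, y, hxy, hx, hy⟩ := hr.exists_fixed
  obtain ⟨z, hz⟩ := hr.ne_id
  have h1 : f ≠ 1 := fun h => hz (by rw [h]; rfl)
  rcases fixed_of_mem_reflGroup hf h1 hx with ⟨d, hd, a, -, h⟩ | ⟨-, h⟩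
  · exact ⟨d, hd, a, h⟩
  · exact absurd (h y hy).symm hxy

theorem exists_reflection {d : ℍ[ℝ]} (hd : d ∈ latticeD4) (a : Fin 4) :
    ∃ f ∈ reflGroup, IsComplexReflection f ∧ ∀ y, f y = y ↔ y ∈ wall d a := by
  obtain ⟨f, hf, h⟩ := inGroup_wallReflection hd a
  refine ⟨f, hf, ?_, fun y => by rw [h, wallReflection_eq_self_iff]⟩
  rw [show (f : ℍ[ℝ] → ℍ[ℝ]) = wallReflection d a from funext h]
  exact isComplexReflection_wallReflection d a

theorem hyperplaneUnion_reflGroup : hyperplaneUnion reflGroup = walls := by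
  ext x
  constructor
  · rintro ⟨f, hf, hr, hx⟩
    obtain ⟨d, hd, a, h⟩ := exists_wall_of_isComplexReflection hf hr
    exact ⟨d, hd, a, (h x).1 hx⟩
  · rintro ⟨d, hd, a, hx⟩
    obtain ⟨f, hf, hr, h⟩ := exists_reflection hd a
    exact ⟨f, hf, hr, (h x).2 hx⟩

theorem hyperplaneComplement_reflGroup : hyperplaneComplement reflGroup = wallsᶜ := by
  rw [hyperplaneComplement, hyperplaneUnion_reflGroup]

theorem regularPoints_reflGroup : regularPoints reflGroup = wallsᶜ \ hurwitz := by
  ext x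
  constructor
  · intro hx
    constructor
    · rintro ⟨d, hd, a, hxd⟩
      obtain ⟨f, hf, hr, h⟩ := exists_reflection hd a
      obtain ⟨z, hz⟩ := hr.ne_id
      exact hz (by rw [hx f hf ((h x).2 hxd)]; rfl)
    · intro hxh
      obtain ⟨f, hf, h⟩ := inGroup_point_reflection hxh
      have h1 := hx f hf ((h x).trans (by simp only [two_mul, neg_add_cancel_left]))
      have h2 := h (x + 1)
      rw [h1] at h2
      have h3 := congrArg (fun q : ℍ[ℝ] => q.re) (show x + 1 = -(x + 1) + 2 * x from h2)
      rw [two_mul] at h3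
      simp at h3
      linarith
  · rintro ⟨hx, hxh⟩ f hf hfx
    by_contra h1
    rcases fixed_of_mem_reflGroup hf h1 hfx with ⟨d, hd, a, h, -⟩ | ⟨h, -⟩
    · exact hx ⟨d, hd, a, h⟩
    · exact hxh h

theorem mem_wall_iff {d x : ℍ[ℝ]} {a : Fin 4} (hd : d ∈ latticeD4) (hx : x ∈ wall d a) :
    ∃ r n : ℤ, (frame a * x).re = n ∧
      (frame a * x).imI + (frame a * x).imJ + (frame a * x).imK = 2 * r - n := by
  obtain ⟨p, q, r, s, ⟨h1, h2, h3, h4⟩, m, hm⟩ := frame_mul_mem_latticeD4 a hd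
  obtain ⟨k1, k2⟩ : frame a * (x - d) ∈ basicLine := hx
  rw [mul_sub] at k1 k2
  simp only [Quaternion.re_sub, Quaternion.imI_sub, Quaternion.imJ_sub, Quaternion.imK_sub,
    h1, h2, h3, h4] at k1 k2
  have hm' : (p + q + r + s : ℝ) = m + m := by exact_mod_cast hm
  exact ⟨m, p, by linarith, by linarith⟩

/-- Each of the two walls prescribes two coordinate combinations as integers, with a parity
condition between them. For different directions these four equations solve to integral coordinates
of even sum. -/
theorem mem_latticeD4_of_mem_walls {d e x : ℍ[ℝ]} {a b : Fin 4} (hab : a ≠ b)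
    (hd : d ∈ latticeD4) (he : e ∈ latticeD4) (hx : x ∈ wall d a) (hx' : x ∈ wall e b) :
    x ∈ latticeD4 := by
  wlog h : a < b generalizing a b d e
  · exact this hab.symm he hd hx' hx (lt_of_le_of_ne (not_lt.1 h) hab.symm)
  obtain ⟨r, m, h1, h2⟩ := mem_wall_iff hd hx
  obtain ⟨r', m', h3, h4⟩ := mem_wall_iff he hx'
  have key : ∀ p q s t : ℤ, x.re = p → x.imI = q → x.imJ = s → x.imK = t →
      (Even (p + q + s + t)) → x ∈ latticeD4 :=
    fun p q s t e1 e2 e3 e4 e5 => ⟨p, q, s, t, ⟨e1, e2, e3, e4⟩, e5⟩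
  fin_cases a <;> fin_cases b <;> first | exact absurd h (by decide) | skip
  all_goals
    simp only [Fin.zero_eta, Fin.mk_one, Fin.reduceFinMk, frame_zero_mul, frame_one_mul,
      frame_two_mul, frame_three_mul, re_quat, imI_quat, imJ_quat, imK_quat] at h1 h2 h3 h4
  · refine key m (-m') (r + r' - m) (r - r' + m') ?_ ?_ ?_ ?_ ?_ <;>
      first | (push_cast; linarith) | skip
    exact ⟨r, by ring⟩
  · refine key m (r - r' + m') (-m') (r + r' - m) ?_ ?_ ?_ ?_ ?_ <;>
      first | (push_cast; linarith) | skip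
    exact ⟨r, by ring⟩
  · refine key m (r + r' - m) (r - r' + m') (-m') ?_ ?_ ?_ ?_ ?_ <;>
      first | (push_cast; linarith) | skip
    exact ⟨r, by ring⟩
  · refine key (r + r' - m) (-m) (-m') (r' - r - m') ?_ ?_ ?_ ?_ ?_ <;>
      first | (push_cast; linarith) | skip
    exact ⟨r' - m - m', by ring⟩
  · refine key (r + r' - m') (-m) (r - r' - m) (-m') ?_ ?_ ?_ ?_ ?_ <;>
      first | (push_cast; linarith) | skip
    exact ⟨r - m - m', by ring⟩
  · refine key (r + r' - m) (r' - r - m') (-m) (-m') ?_ ?_ ?_ ?_ ?_ <;>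
      first | (push_cast; linarith) | skip
    exact ⟨r' - m - m', by ring⟩

theorem add_mem_wall {d x t : ℍ[ℝ]} {a : Fin 4} (hx : x ∈ wall d a)
    (ht : frame a * t ∈ basicLine) : x + t ∈ wall d a := by
  have : frame a * (x - d) + frame a * t ∈ basicLine := basicLine.add_mem hx ht
  rwa [← mul_add, sub_add_eq_add_sub] at this

/-- A family of walls through a point outside D₄ has a single direction, so its intersection
contains a whole line direction. At a lattice point two of its four walls already intersect in that
point alone. -/
theorem isolatedIntersections_reflGroup : isolatedIntersections reflGroup = latticeD4 := by
  ext x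
  constructor
  · rintro ⟨R, hR, hx⟩
    have hxR : ∀ f ∈ R, f x = x := by
      have : x ∈ {y | ∀ f ∈ R, f y = y} := by rw [hx]; rfl
      exact this
    by_contra hxD
    have hall : ∃ a : Fin 4, ∀ f ∈ R, ∃ d ∈ latticeD4, ∀ y, f y = y ↔ y ∈ wall d a := by
      by_cases hne : R.Nonempty
      · obtain ⟨f, hf⟩ := hne
        obtain ⟨d, hd, a, h⟩ := exists_wall_of_isComplexReflection (hR f hf).1 (hR f hf).2
        refine ⟨a, fun g hg => ?_⟩
        obtain ⟨e, he, b, h'⟩ := exists_wall_of_isComplexReflection (hR g hg).1 (hR g hg).2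
        have hab : a = b := by
          by_contra hab
          exact hxD (mem_latticeD4_of_mem_walls hab hd he ((h x).1 (hxR f hf))
            ((h' x).1 (hxR g hg)))
        subst hab
        exact ⟨e, he, h'⟩
      -- For the empty family, whose intersection is the whole space, any direction will do.
      · exact ⟨0, fun f hf => absurd ⟨f, hf⟩ hne⟩
    obtain ⟨a, ha⟩ := hall
    have hu : quat 0 1 (-1) 0 ∈ basicLine := by simp [mem_basicLine]
    have hmem : x + star (frame a) * quat 0 1 (-1) 0 ∈ ({x} : Set ℍ[ℝ]) := by
      rw [← hx]
      intro f hf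
      obtain ⟨d, -, h⟩ := ha f hf
      rw [h]
      exact add_mem_wall ((h x).1 (hxR f hf)) (by rwa [frame_mul_star_frame_mul])
    have h0 : star (frame a) * quat 0 1 (-1) 0 = 0 := by
      simpa using hmem
    have h1 : quat 0 1 (-1) 0 = 0 := by
      rw [← frame_mul_star_frame_mul a (quat 0 1 (-1) 0), h0, mul_zero]
    simpa using congrArg (fun q : ℍ[ℝ] => q.imI) h1
  · intro hx
    obtain ⟨f, hf, hr, h⟩ := exists_reflection hx 0
    obtain ⟨g, hg, hr', h'⟩ := exists_reflection hx 1
    refine ⟨{f, g}, ?_, ?_⟩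
    · rintro φ (rfl | rfl)
      · exact ⟨hf, hr⟩
      · exact ⟨hg, hr'⟩
    · ext y
      simp only [Set.mem_insert_iff, Set.mem_singleton_iff, forall_eq_or_imp, forall_eq,
        Set.mem_ofPred_eq, h, h']
      constructor
      · rintro ⟨h0, h1⟩
        exact sub_eq_zero.1 (eq_zero_of_frame_mul_mem_basicLine (by decide) h0 h1)
      · rintro rfl
        exact ⟨self_mem_wall _ _, self_mem_wall _ _⟩

end

end ReflG4

namespace ReflG4

noncomputable section

open Set

/-! ### The cells of the complement complex -/

theorem mem_voronoiCell_isolated_iff {d x : ℍ[ℝ]} (hd : d ∈ latticeD4) :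
    x ∈ voronoiCell (isolatedIntersections reflGroup) d ↔ x - d ∈ cell24 := by
  rw [isolatedIntersections_reflGroup, mem_voronoiCell_latticeD4_iff hd]

theorem finite_nearest (x : ℍ[ℝ]) : (nearest x).Finite :=
  (finite_latticeD4_inter_closedBall x 2).subset fun d hd =>
    ⟨by rw [Metric.mem_closedBall, dist_comm]; exact dist_le_two_of_mem_nearest hd, hd.1⟩

/-- The functional is the inner product with the sum of `e - d` over the nearest points `e` of `x`.
On the cell each summand is maximal at `x`, so a maximiser of the sum maximises every summand, which
means that all nearest points of `x` are nearest to it too. -/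
theorem exists_isVoronoiFace {x d : ℍ[ℝ]} (hd : d ∈ nearest x) : ∃ F,
    IsVoronoiFace reflGroup F ∧ x ∈ F ∧ ∀ y ∈ F, nearest x ⊆ nearest y := by
  have hN := finite_nearest x
  set N := hN.toFinset
  set l : StrongDual ℝ ℍ[ℝ] := innerSL ℝ (∑ e ∈ N, (e - d))
  have hl : ∀ y, l y = ∑ e ∈ N, inner ℝ (y - d) (e - d) + l d := by
    intro y
    change inner ℝ (∑ e ∈ N, (e - d)) y = _ + inner ℝ (∑ e ∈ N, (e - d)) d
    rw [← inner_sum, inner_sub_left, real_inner_comm d, real_inner_comm y, sub_add_cancel]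
  have hle : ∀ e ∈ N, ∀ y, y - d ∈ cell24 → 2 * inner ℝ (y - d) (e - d) ≤ ‖e - d‖ ^ 2 :=
    fun e he y hy => two_mul_inner_le hy (sub_mem (hN.mem_toFinset.1 he).1 hd.1)
  have hge : ∀ e ∈ N, ∀ y, y - d ∈ cell24 →
      (e ∈ nearest y ↔ ‖e - d‖ ^ 2 ≤ 2 * inner ℝ (y - d) (e - d)) := by
    intro e he y hy
    have he' : e ∈ latticeD4 := (hN.mem_toFinset.1 he).1
    rw [← sub_mem_cell24_iff hy (sub_mem he' hd.1), sub_sub_sub_cancel_right]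
    exact and_iff_right he'
  have hxF : x ∈ l.toExposed (voronoiCell (isolatedIntersections reflGroup) d) := by
    refine ⟨(mem_voronoiCell_isolated_iff hd.1).2 hd.2, fun y hy => ?_⟩
    rw [mem_voronoiCell_isolated_iff hd.1] at hy
    rw [hl x, hl y, add_le_add_iff_right]
    refine Finset.sum_le_sum fun e he => ?_
    have h1 := hle e he y hy
    have h2 := (hge e he x hd.2).1 (hN.mem_toFinset.1 he)
    linarith
  refine ⟨_, ⟨⟨x, hxF⟩, d, ?_, ContinuousLinearMap.toExposed.isExposed⟩, hxF, ?_⟩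
  · rw [isolatedIntersections_reflGroup]
    exact hd.1
  · rintro y ⟨hy, hmax⟩ e he
    have h := hmax x hxF.1
    rw [mem_voronoiCell_isolated_iff hd.1] at hy
    rw [hl x, hl y, add_le_add_iff_right] at h
    have heN : e ∈ N := hN.mem_toFinset.2 he
    rw [hge e heN y hy]
    by_contra hlt
    refine h.not_gt (Finset.sum_lt_sum (fun f hf => ?_) ⟨e, heN, ?_⟩)
    · have h1 := hle f hf y hy
      have h2 := (hge f hf x hd.2).1 (hN.mem_toFinset.1 hf)
      linarith
    · have h2 := (hge e heN x hd.2).1 he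
      linarith

theorem notMem_walls_of_nearest_subset {x y : ℍ[ℝ]} (hx : x ∈ nearestComplex)
    (h : nearest x ⊆ nearest y) : y ∉ walls := by
  rintro ⟨d, hd, a, hy⟩
  exact hx d hd a (h.trans (nearest_subset_wall hd hy))

/-- Otherwise `x` lies inside a segment of the cell that starts on a wall: at `d` if the gauge is
less than 1, and at the projection of `x` to the line of its ring if the ratio exceeds 1. Applied to
an exposed face, which is extreme and so would contain that endpoint, this shows that a face
disjoint from the walls lies in the complex. -/
theorem mem_nearestComplex_of_extreme {d x : ℍ[ℝ]} (hd : d ∈ latticeD4) (hx : x ∉ walls)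
    (hxd : x - d ∈ cell24)
    (hext : ∀ p q, p - d ∈ cell24 → q - d ∈ cell24 → x ∈ openSegment ℝ p q → p ∉ walls) :
    x ∈ nearestComplex := by
  obtain ⟨a, hxa⟩ := exists_mem_chamber_of_mem_nearest (d := d) (x := x) ⟨hd, hxd⟩
  have hy : frame a * (x - d) ∈ ringCell := hxa
  have hy' := notMem_basicLine_of_notMem_walls (a := a) hd hx
  have hxw : x ∉ wall d a := hy'
  have hr := one_le_ringRatio hy hy'
  by_cases hg : ringU (frame a * (x - d)) + ringW (frame a * (x - d)) = 1
  · by_cases hc : ringRatio (frame a * (x - d)) = 1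
    · refine mem_nearestComplex_of_lateral hd hxa hg ?_
      refine (min_choice (ringW (frame a * (x - d)) / ringS (frame a * (x - d)))
        (ringU (frame a * (x - d)) / ringT (frame a * (x - d)))).imp (fun h => ?_) fun h => ?_
      · change ringRatio _ = _ at h
        rw [hc, eq_div_iff (ringS_pos hy').ne', one_mul] at h
        exact h
      · change ringRatio _ = _ at h
        rw [hc, eq_div_iff (ringT_pos hy').ne', one_mul] at h
        exact h
    · have hc1 := lt_of_le_of_ne hr (Ne.symm hc)
      have h1 := ringRatio_mul_ringS_le hy'
      have h2 := ringRatio_mul_ringT_le hy'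
      set c := ringRatio (frame a * (x - d))
      set y := frame a * (x - d) with hydef
      have hmem : ∀ z ∈ ringCell, d + star (frame a) * z - d ∈ cell24 := fun z hz => by
        rw [add_sub_cancel_left, ← frame_mul_mem_cell24 (a := a), frame_mul_star_frame_mul]
        exact ringCell_subset_cell24 hz
      refine absurd ⟨d, hd, a, ?_⟩ (hext (d + star (frame a) * mix 1 0 y)
        (d + star (frame a) * mix 1 c y)
        (hmem _ (mix_mem_ringCell_of_le hy' zero_le_one le_rfl (by simpa using zero_le_one.trans hr)
          (by rw [hg, one_mul])))
        (hmem _ (mix_mem_ringCell_of_le hy' zero_le_one (by linarith)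
          (mul_one (ringRatio y)).ge (by rw [hg, one_mul]))) ?_)
      · change frame a * (d + star (frame a) * mix 1 0 y - d) ∈ basicLine
        rw [add_sub_cancel_left, frame_mul_star_frame_mul]
        exact mix_zero_mem_basicLine _ _
      · have hc0 : 0 < c := by linarith
        refine ⟨1 - 1 / c, 1 / c, ?_, by positivity, by ring, ?_⟩
        · rw [sub_pos, div_lt_one hc0]
          exact hc1
        · have e : (1 - 1 / c) • mix 1 0 y + (1 / c) • mix 1 c y = y := by
            ext <;> simp [mix] <;> field_simp <;> ring
          rw [smul_add, smul_add, add_add_add_comm, ← add_smul, ← mul_smul_comm, ← mul_smul_comm,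
            ← mul_add, e, hydef, star_frame_mul_frame_mul, sub_add_cancel, one_smul,
            add_sub_cancel]
  · have hg1 := lt_of_le_of_ne hy.2.2 hg
    have hg0 := gauge_pos hy hy'
    obtain ⟨-, h1, -⟩ := scale_mem_chamber hxa hxw rfl
    have h2 := (mem_nearest_of_mem_chamber hd h1).2
    set g := ringU (frame a * (x - d)) + ringW (frame a * (x - d))
    refine absurd ⟨d, hd, 0, self_mem_wall d 0⟩ (hext d _ ?_ h2
      ⟨1 - g, g, by linarith, hg0, by ring, ?_⟩)
    · rw [sub_self]; simp [cell24]
    · rw [smul_add, smul_smul, mul_one_div_cancel hg0.ne', one_smul, ← add_assoc, ← add_smul,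
        sub_add_cancel, one_smul, add_sub_cancel]

theorem complementComplex_reflGroup : complementComplex reflGroup = nearestComplex := by
  ext x
  constructor
  · rintro ⟨F, ⟨⟨-, d, hd, hF⟩, hdisj⟩, hx⟩
    rw [hyperplaneUnion_reflGroup] at hdisj
    have hd' : d ∈ latticeD4 := by rwa [isolatedIntersections_reflGroup] at hd
    refine mem_nearestComplex_of_extreme hd' (disjoint_left.1 hdisj hx)
      ((mem_voronoiCell_isolated_iff hd').1 (hF.subset hx)) fun p q hp hq hseg => ?_
    exact disjoint_left.1 hdisj (hF.isExtreme.2 ((mem_voronoiCell_isolated_iff hd').2 hp)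
      ((mem_voronoiCell_isolated_iff hd').2 hq) hx hseg)
  · intro hx
    obtain ⟨d, hd⟩ := exists_mem_nearest x
    obtain ⟨F, hF, hxF, h⟩ := exists_isVoronoiFace hd
    refine ⟨F, ⟨hF, ?_⟩, hxF⟩
    rw [hyperplaneUnion_reflGroup]
    exact disjoint_left.2 fun y hy => notMem_walls_of_nearest_subset hx (h y hy)

/-! ### The vertices of the complement complex -/

theorem latticeD4_le_hurwitz : latticeD4 ≤ hurwitz := by
  rintro x ⟨a, b, c, d, ⟨h1, h2, h3, h4⟩, -⟩
  refine ⟨2 * a, b - a, c - a, d - a, ?_⟩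
  rw [h1, h2, h3, h4]
  push_cast
  refine ⟨?_, ?_, ?_, ?_⟩ <;> ring

theorem exists_norm_sq_eq_of_mem_hurwitz {x : ℍ[ℝ]} (hx : x ∈ hurwitz) :
    ∃ n : ℤ, ‖x‖ ^ 2 = n := by
  obtain ⟨a, b, c, d, h1, h2, h3, h4⟩ := hx
  refine ⟨a ^ 2 + a * (b + c + d) + b ^ 2 + c ^ 2 + d ^ 2, ?_⟩
  rw [norm_sq_eq, h1, h2, h3, h4]
  push_cast
  ring

theorem one_le_norm_of_mem_hurwitz {x : ℍ[ℝ]} (hx : x ∈ hurwitz) (h0 : x ≠ 0) : 1 ≤ ‖x‖ := by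
  obtain ⟨n, hn⟩ := exists_norm_sq_eq_of_mem_hurwitz hx
  have h1 : (0 : ℝ) < n := by rw [← hn]; have := norm_pos_iff.2 h0; positivity
  have h2 : (1 : ℤ) ≤ n := by exact_mod_cast h1
  have h3 : (1 : ℝ) ≤ ‖x‖ ^ 2 := by rw [hn]; exact_mod_cast h2
  exact (one_le_sq_iff₀ (norm_nonneg x)).1 h3

theorem norm_le_one_of_mem_hurwitz {x : ℍ[ℝ]} (hx : x ∈ hurwitz) (h : ‖x‖ ^ 2 < 2) :
    ‖x‖ ≤ 1 := by
  obtain ⟨n, hn⟩ := exists_norm_sq_eq_of_mem_hurwitz hx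
  rw [hn] at h
  have h2 : n < 2 := by exact_mod_cast h
  have h2' : n ≤ 1 := by omega
  have h3 : ‖x‖ ^ 2 ≤ 1 := by rw [hn]; exact_mod_cast h2'
  exact (sq_le_one_iff₀ (norm_nonneg x)).1 h3

theorem exists_frame_mul_max (y : ℍ[ℝ]) : ∃ a, |(frame a * y).imI| ≤ |(frame a * y).re| ∧
    |(frame a * y).imJ| ≤ |(frame a * y).re| ∧ |(frame a * y).imK| ≤ |(frame a * y).re| := by
  rcases le_total |y.re| |y.imI| with h1 | h1 <;> rcases le_total |y.imJ| |y.imK| with h2 | h2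
  · rcases le_total |y.imI| |y.imK| with h3 | h3
    · exact ⟨3, by
        simp only [frame_three_mul, re_quat, imI_quat, imJ_quat, imK_quat, abs_neg]
        exact ⟨h2, h3, h1.trans h3⟩⟩
    · exact ⟨1, by
        simp only [frame_one_mul, re_quat, imI_quat, imJ_quat, imK_quat, abs_neg]
        exact ⟨h1, h3, h2.trans h3⟩⟩
  · rcases le_total |y.imI| |y.imJ| with h3 | h3
    · exact ⟨2, by
        simp only [frame_two_mul, re_quat, imI_quat, imJ_quat, imK_quat, abs_neg]
        exact ⟨h2, h1.trans h3, h3⟩⟩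
    · exact ⟨1, by
        simp only [frame_one_mul, re_quat, imI_quat, imJ_quat, imK_quat, abs_neg]
        exact ⟨h1, h2.trans h3, h3⟩⟩
  · rcases le_total |y.re| |y.imK| with h3 | h3
    · exact ⟨3, by
        simp only [frame_three_mul, re_quat, imI_quat, imJ_quat, imK_quat, abs_neg]
        exact ⟨h2, h1.trans h3, h3⟩⟩
    · exact ⟨0, by simp only [frame_zero_mul]; exact ⟨h1, h2.trans h3, h3⟩⟩
  · rcases le_total |y.re| |y.imJ| with h3 | h3
    · exact ⟨2, by
        simp only [frame_two_mul, re_quat, imI_quat, imJ_quat, imK_quat, abs_neg]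
        exact ⟨h2, h3, h1.trans h3⟩⟩
    · exact ⟨0, by simp only [frame_zero_mul]; exact ⟨h1, h3, h2.trans h3⟩⟩

/-- Let `m` be the largest absolute value of a coordinate. If `m ≥ 1/2`, the squared norm is at most
`m ^ 2 + 3 * (1 - m) ^ 2`, which exceeds 1 by `2 * (2 * m - 1) * (m - 1) ≤ 0`. -/
theorem norm_le_one_of_mem_cell24 {y : ℍ[ℝ]} (hy : y ∈ cell24) : ‖y‖ ≤ 1 := by
  obtain ⟨a, h1, h2, h3⟩ := exists_frame_mul_max y
  rw [← frame_mul_mem_cell24 (a := a)] at hy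
  rw [← norm_frame_mul a, ← sq_le_one_iff₀ (norm_nonneg _), norm_sq_eq]
  obtain ⟨⟨c1, c2, c3⟩, -⟩ := hy
  rw [← sq_abs, ← sq_abs (frame a * y).imI, ← sq_abs (frame a * y).imJ,
    ← sq_abs (frame a * y).imK]
  have n0 := abs_nonneg (frame a * y).re
  have n1 := abs_nonneg (frame a * y).imI
  have n2 := abs_nonneg (frame a * y).imJ
  have n3 := abs_nonneg (frame a * y).imK
  generalize |(frame a * y).re| = m at *
  generalize |(frame a * y).imI| = p at *
  generalize |(frame a * y).imJ| = q at *
  generalize |(frame a * y).imK| = r at *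
  rcases le_total m (1/2) with h | h
  · nlinarith
  · have e : ∀ s : ℝ, 0 ≤ s → m + s ≤ 1 → s ^ 2 ≤ (1 - m) ^ 2 := fun s h0 h1 =>
      pow_le_pow_left₀ h0 (by linarith) 2
    nlinarith [e p n1 c1, e q n2 c2, e r n3 c3]

/-- No line segment centred at `y` is contained in the 24-cell. -/
def IsCellVertex (y : ℍ[ℝ]) : Prop :=
  y ∈ cell24 ∧ ∀ t, y + t ∈ cell24 → y - t ∈ cell24 → t = 0

theorem IsCellVertex.frame_mul {y : ℍ[ℝ]} (hy : IsCellVertex y) (a : Fin 4) :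
    IsCellVertex (frame a * y) := by
  refine ⟨frame_mul_mem_cell24.2 hy.1, fun t h1 h2 => ?_⟩
  rw [← frame_mul_star_frame_mul a t, ← mul_add, frame_mul_mem_cell24] at h1
  rw [← frame_mul_star_frame_mul a t, ← mul_sub, frame_mul_mem_cell24] at h2
  rw [← frame_mul_star_frame_mul a t, hy.2 _ h1 h2, mul_zero]

/-- Otherwise the real coordinate could be perturbed in both directions. Multiplication by the frame
gives the same for the other coordinates. -/
theorem IsCellVertex.re_tight {y : ℍ[ℝ]} (hy : IsCellVertex y) (h1 : |y.re| + |y.imI| < 1)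
    (h2 : |y.re| + |y.imJ| < 1) (h3 : |y.re| + |y.imK| < 1) : False := by
  obtain ⟨⟨⟨c1, c2, c3⟩, c4, c5, c6⟩, h⟩ := hy
  obtain ⟨η, hη, hη'⟩ := exists_between
    (lt_min (sub_pos.2 h1) (lt_min (sub_pos.2 h2) (sub_pos.2 h3)))
  have k1 := hη'.trans_le (min_le_left _ _)
  have k2 := (hη'.trans_le (min_le_right _ _)).trans_le (min_le_left _ _)
  have k3 := (hη'.trans_le (min_le_right _ _)).trans_le (min_le_right _ _)
  have p1 := abs_add_le y.re η
  have p2 := abs_sub y.re η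
  rw [abs_of_pos hη] at p1 p2
  have := h (quat η 0 0 0) (by
    simp only [cell24, mem_ofPred_eq, Quaternion.re_add, Quaternion.imI_add, Quaternion.imJ_add,
      Quaternion.imK_add, re_quat, imI_quat, imJ_quat, imK_quat, add_zero]
    refine ⟨⟨?_, ?_, ?_⟩, c4, c5, c6⟩ <;> linarith) (by
    simp only [cell24, mem_ofPred_eq, Quaternion.re_sub, Quaternion.imI_sub, Quaternion.imJ_sub,
      Quaternion.imK_sub, re_quat, imI_quat, imJ_quat, imK_quat, sub_zero]
    refine ⟨⟨?_, ?_, ?_⟩, c4, c5, c6⟩ <;> linarith)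
  exact hη.ne' (congrArg (fun q : ℍ[ℝ] => q.re) this)

/-- Let the real part have the largest absolute value `m`. Tightness in every coordinate forces `m ≥
1/2` and makes the other absolute values equal to `1 - m`. For `m = 1/2` or `m = 1` the point is
Hurwitz; in between, changing `m` to `m ± η` and the others to `1 - m ∓ η` gives a segment in the
cell centred at the point. -/
theorem IsCellVertex.mem_hurwitz {y : ℍ[ℝ]} (hy : IsCellVertex y) : y ∈ hurwitz := by
  suffices key : ∀ {y : ℍ[ℝ]}, IsCellVertex y → |y.imI| ≤ |y.re| → |y.imJ| ≤ |y.re| →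
      |y.imK| ≤ |y.re| → y ∈ hurwitz by
    obtain ⟨a, h1, h2, h3⟩ := exists_frame_mul_max y
    rw [← star_frame_mul_frame_mul a y]
    exact star_frame_mul_mem_hurwitz a (key (hy.frame_mul a) h1 h2 h3)
  intro y hy h1 h2 h3
  obtain ⟨⟨c1, c2, c3⟩, c4, c5, c6⟩ := hy.1
  have n1 := abs_nonneg y.imI
  have n2 := abs_nonneg y.imJ
  have n3 := abs_nonneg y.imK
  have t0 := hy.re_tight
  have t1 := (hy.frame_mul 1).re_tight
  have t2 := (hy.frame_mul 2).re_tight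
  have t3 := (hy.frame_mul 3).re_tight
  simp only [frame_one_mul, frame_two_mul, frame_three_mul, re_quat, imI_quat, imJ_quat,
    imK_quat, abs_neg] at t1 t2 t3
  have hm : 1 / 2 ≤ |y.re| := by
    by_contra hlt
    rw [not_le] at hlt
    exact t0 (by linarith) (by linarith) (by linarith)
  have e1 : |y.imI| = 1 - |y.re| := by
    by_contra hne
    have := lt_of_le_of_ne (show |y.imI| ≤ 1 - |y.re| by linarith) hne
    exact t1 (by linarith) (by linarith) (by linarith)
  have e2 : |y.imJ| = 1 - |y.re| := by
    by_contra hne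
    have := lt_of_le_of_ne (show |y.imJ| ≤ 1 - |y.re| by linarith) hne
    exact t2 (by linarith) (by linarith) (by linarith)
  have e3 : |y.imK| = 1 - |y.re| := by
    by_contra hne
    have := lt_of_le_of_ne (show |y.imK| ≤ 1 - |y.re| by linarith) hne
    exact t3 (by linarith) (by linarith) (by linarith)
  by_cases hhalf : |y.re| = 1 / 2
  · rw [hhalf] at e1 e2 e3
    have hs : ∀ z : ℝ, |z| = 1 / 2 → ∃ b : ℤ, z = 1 / 2 + b := fun z hz => by
      rcases abs_choice z with h | h
      · exact ⟨0, by rw [← h, hz]; simp⟩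
      · exact ⟨-1, by push_cast; linarith⟩
    obtain ⟨a, ha⟩ := hs _ hhalf
    obtain ⟨b, hb⟩ := hs _ (e1.trans (by norm_num))
    obtain ⟨c, hc⟩ := hs _ (e2.trans (by norm_num))
    obtain ⟨d, hd⟩ := hs _ (e3.trans (by norm_num))
    refine ⟨1 + 2 * a, b - a, c - a, d - a, ?_⟩
    rw [ha, hb, hc, hd]
    push_cast
    refine ⟨?_, ?_, ?_, ?_⟩ <;> ring
  by_cases hone : |y.re| = 1
  · rw [hone, sub_self, abs_eq_zero] at e1 e2 e3
    rcases abs_choice y.re with h | h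
    · refine ⟨2, -1, -1, -1, ?_⟩
      rw [e1, e2, e3, ← h, hone]
      norm_num
    · refine ⟨-2, 1, 1, 1, ?_⟩
      rw [e1, e2, e3, show y.re = -1 by linarith]
      norm_num
  exfalso
  have hm' := lt_of_le_of_ne hm (Ne.symm hhalf)
  have hm1 : |y.re| < 1 := lt_of_le_of_ne (by linarith) hone
  generalize hmdef : |y.re| = m at *
  obtain ⟨η, hη, hη'⟩ := exists_between (lt_min (sub_pos.2 hm1) (sub_pos.2 hm'))
  have k1 := hη'.trans_le (min_le_left _ _)
  have k2 := hη'.trans_le (min_le_right _ _)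
  have q1 : ∀ s, |y.re + s * (y.re * (η / m))| = |1 + s * (η / m)| * m := fun s => by
    rw [← hmdef, ← abs_mul]; congr 1; ring
  have q2 : ∀ z s, |z| = 1 - m →
      |z - s * (z * (η / (1 - m)))| = |1 - s * (η / (1 - m))| * (1 - m) :=
    fun z s hz => by
      rw [← hz, ← abs_mul]; congr 1; ring
  have hm0 : 0 < m := by linarith
  have hm1' : 0 < 1 - m := by linarith
  have r1 : η / m < 1 := by rw [div_lt_one hm0]; linarith
  have r2 : η / (1 - m) < 1 := by rw [div_lt_one hm1']; linarith
  have r1' : 0 < η / m := by positivity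
  have r2' : 0 < η / (1 - m) := by positivity
  have s1 : |1 + 1 * (η / m)| * m = m + η := by
    rw [abs_of_pos (by linarith)]; field_simp
  have s2 : |1 + (-1) * (η / m)| * m = m - η := by
    rw [abs_of_pos (by linarith)]; field_simp; ring
  have s3 : |1 - 1 * (η / (1 - m))| * (1 - m) = 1 - m - η := by
    rw [abs_of_pos (by linarith)]; field_simp
  have s4 : |1 - (-1) * (η / (1 - m))| * (1 - m) = 1 - m + η := by
    rw [abs_of_pos (by linarith)]; field_simp; ring
  have hmem : ∀ s, |1 + s * (η / m)| * m + |1 - s * (η / (1 - m))| * (1 - m) ≤ 1 →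
      2 * (|1 - s * (η / (1 - m))| * (1 - m)) ≤ 1 →
      y + s • quat (y.re * (η / m)) (-(y.imI * (η / (1 - m)))) (-(y.imJ * (η / (1 - m))))
        (-(y.imK * (η / (1 - m)))) ∈ cell24 := by
    intro s u1 u2
    simp only [cell24, mem_ofPred_eq, Quaternion.re_add, Quaternion.imI_add, Quaternion.imJ_add,
      Quaternion.imK_add, Quaternion.re_smul, Quaternion.imI_smul, Quaternion.imJ_smul,
      Quaternion.imK_smul, re_quat, imI_quat, imJ_quat, imK_quat, smul_eq_mul, mul_neg,
      ← sub_eq_add_neg, q1, q2 _ _ e1, q2 _ _ e2, q2 _ _ e3]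
    refine ⟨⟨u1, u1, u1⟩, ?_, ?_, ?_⟩ <;> linarith
  have hz := hy.2 _ (by have := hmem 1 (by linarith) (by linarith); rwa [one_smul] at this)
    (by have := hmem (-1) (by linarith) (by linarith); rwa [neg_one_smul, ← sub_eq_add_neg] at this)
  have hz0 := congrArg (fun q : ℍ[ℝ] => q.re) hz
  simp only [re_quat, Quaternion.re_zero, mul_eq_zero] at hz0
  rcases hz0 with h | h
  · rw [h, abs_zero] at hmdef
    linarith
  · exact r1'.ne' h

theorem sub_mem_hurwitz {v d : ℍ[ℝ]} (hv : v ∈ hurwitz) (hd : d ∈ latticeD4) :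
    v - d ∈ hurwitz := sub_mem hv (latticeD4_le_hurwitz hd)

theorem notMem_latticeD4_of_notMem_walls {v : ℍ[ℝ]} (hv : v ∉ walls) : v ∉ latticeD4 :=
  fun h => hv ⟨v, h, 0, self_mem_wall v 0⟩

/-- An exposed point is the centre of no nontrivial segment of the cell. Conversely, a Hurwitz
integer `v` off the walls has distance exactly 1 from a nearest lattice point `d`; as the cell lies
in the unit ball around `d`, the inner product with `v - d` exposes `v`. -/
theorem complexVertices_reflGroup : complexVertices reflGroup = (hurwitz : Set ℍ[ℝ]) \ walls := by
  ext v
  constructor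
  · rintro ⟨⟨-, d, hd, hF⟩, hdisj⟩
    rw [hyperplaneUnion_reflGroup, disjoint_singleton_left] at hdisj
    rw [isolatedIntersections_reflGroup] at hd
    refine ⟨?_, hdisj⟩
    have hvd := (mem_voronoiCell_isolated_iff hd).1 (hF.subset rfl)
    have hver : IsCellVertex (v - d) := by
      refine ⟨hvd, fun t h1 h2 => ?_⟩
      have h := hF.isExtreme.2 (x := v + t) (y := v - t) (z := v) 
        ((mem_voronoiCell_isolated_iff hd).2 (by rwa [add_sub_right_comm]))
        ((mem_voronoiCell_isolated_iff hd).2 (by rwa [sub_right_comm])) rfl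
        ⟨1/2, 1/2, by norm_num, by norm_num, by norm_num, by module⟩
      simpa using h
    have := add_mem hver.mem_hurwitz (latticeD4_le_hurwitz hd)
    rwa [sub_add_cancel] at this
  · rintro ⟨hv, hvw⟩
    obtain ⟨d, hd, hvd⟩ := exists_mem_nearest v
    have hu := sub_mem_hurwitz hv hd
    have hu0 : v - d ≠ 0 := fun h =>
      notMem_latticeD4_of_notMem_walls hvw (sub_eq_zero.1 h ▸ hd)
    have hn : ‖v - d‖ = 1 :=
      le_antisymm (norm_le_one_of_mem_cell24 hvd) (one_le_norm_of_mem_hurwitz hu hu0)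
    refine ⟨⟨singleton_nonempty v, d, by rwa [isolatedIntersections_reflGroup], fun _ =>
      ⟨innerSL ℝ (v - d), ?_⟩⟩, ?_⟩
    · have hle : ∀ y, y - d ∈ cell24 → inner ℝ (v - d) (y - d) ≤ 1 := fun y hy => by
        have h1 := real_inner_le_norm (v - d) (y - d)
        rw [hn, one_mul] at h1
        exact h1.trans (norm_le_one_of_mem_cell24 hy)
      have hself : inner ℝ (v - d) (v - d) = 1 := by
        rw [real_inner_self_eq_norm_sq, hn, one_pow]
      ext x
      rw [mem_singleton_iff]
      constructor
      · rintro rfl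
        refine ⟨(mem_voronoiCell_isolated_iff hd).2 hvd, fun y hy => ?_⟩
        have h1 := hle y ((mem_voronoiCell_isolated_iff hd).1 hy)
        rw [← hself, inner_sub_right, inner_sub_right] at h1
        exact (sub_le_sub_iff_right _).1 h1
      · rintro ⟨hx, hmax⟩
        rw [mem_voronoiCell_isolated_iff hd] at hx
        have h1 : inner ℝ (v - d) v ≤ inner ℝ (v - d) x :=
          hmax v ((mem_voronoiCell_isolated_iff hd).2 hvd)
        have h2 := sub_le_sub_right h1 (inner ℝ (v - d) d)
        rw [← inner_sub_right, ← inner_sub_right, hself] at h2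
        have h3 := norm_sub_sq_real (x - d) (v - d)
        rw [sub_sub_sub_cancel_right, real_inner_comm, hn] at h3
        have h4 := (sq_le_one_iff₀ (norm_nonneg _)).2 (norm_le_one_of_mem_cell24 hx)
        have h5 : ‖x - v‖ ^ 2 ≤ 0 := by linarith
        have h6 : ‖x - v‖ = 0 := by nlinarith [norm_nonneg (x - v)]
        exact sub_eq_zero.1 (norm_eq_zero.1 h6)
    · rwa [hyperplaneUnion_reflGroup, disjoint_singleton_left]

theorem complexVertices_subset_nearestComplex : (hurwitz : Set ℍ[ℝ]) \ walls ⊆ nearestComplex := by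
  rw [← complexVertices_reflGroup, ← complementComplex_reflGroup]
  exact fun v hv => ⟨{v}, hv, rfl⟩

theorem pairwise_hurwitz : (hurwitz : Set ℍ[ℝ]).Pairwise fun v w => 1 ≤ dist v w := by
  intro v hv w hw hvw
  rw [dist_eq_norm]
  exact one_le_norm_of_mem_hurwitz (sub_mem hv hw) (sub_ne_zero.2 hvw)

theorem one_notMem_walls : (1 : ℍ[ℝ]) ∉ walls := by
  rintro ⟨d, hd, a, h⟩
  obtain ⟨r, n, h1, h2⟩ := mem_wall_iff hd h
  fin_cases a <;> simp [frame] at h1 h2 <;> norm_cast at h1 h2 <;> omega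

/-- In the coordinates of the wall, the real part and the sum of the imaginary parts vanish on the
wall. At `v` either the real part is a nonzero half-integer multiple, of size at least 1/2, or it
vanishes and the sum is a nonzero integer, which puts `v` at distance at least `1/√3`. -/
theorem third_le_dist {v x : ℍ[ℝ]} (hv : v ∈ hurwitz) (hvw : v ∉ walls) (hx : x ∈ walls) :
    1 / 3 ≤ dist x v := by
  obtain ⟨d, hd, a, hxd⟩ := hx
  have hvd := notMem_basicLine_of_notMem_walls (a := a) hd hvw
  obtain ⟨p, q, r, s, e1, e2, e3, e4⟩ :=
    frame_mul_mem_hurwitz a (sub_mem_hurwitz hv hd)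
  obtain ⟨k1, k2⟩ : frame a * (x - d) ∈ basicLine := hxd
  by_contra hlt
  rw [not_le, dist_comm, dist_eq_norm, ← norm_frame_mul a, ← sub_sub_sub_cancel_right v x d,
    mul_sub] at hlt
  have hsq := pow_lt_pow_left₀ hlt (norm_nonneg _) two_ne_zero
  rw [norm_sq_eq] at hsq
  simp only [Quaternion.re_sub, Quaternion.imI_sub, Quaternion.imJ_sub, Quaternion.imK_sub,
    k1] at hsq
  have hp : p = 0 := by
    by_contra hp
    have h1 : (1 : ℝ) ≤ (p : ℝ) ^ 2 := by
      exact_mod_cast Order.one_le_iff_pos.2 (sq_pos_of_ne_zero hp)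
    rw [e1] at hsq
    nlinarith [sq_nonneg ((frame a * (v - d)).imI - (frame a * (x - d)).imI),
      sq_nonneg ((frame a * (v - d)).imJ - (frame a * (x - d)).imJ),
      sq_nonneg ((frame a * (v - d)).imK - (frame a * (x - d)).imK)]
  subst hp
  have hs : q + r + s ≠ 0 := by
    intro hs
    refine hvd ⟨by rw [e1]; simp, ?_⟩
    rw [e2, e3, e4]
    have : (q + r + s : ℝ) = 0 := by exact_mod_cast hs
    push_cast
    linarith
  have h1 : (1 : ℝ) ≤ ((q + r + s : ℤ) : ℝ) ^ 2 := by
    exact_mod_cast Order.one_le_iff_pos.2 (sq_pos_of_ne_zero hs)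
  rw [show ((q + r + s : ℤ) : ℝ) = ((frame a * (v - d)).imI - (frame a * (x - d)).imI) +
    ((frame a * (v - d)).imJ - (frame a * (x - d)).imJ) +
    ((frame a * (v - d)).imK - (frame a * (x - d)).imK) by
      rw [e2, e3, e4]; push_cast; linarith] at h1
  generalize (frame a * (v - d)).imI - (frame a * (x - d)).imI = A at *
  generalize (frame a * (v - d)).imJ - (frame a * (x - d)).imJ = B at *
  generalize (frame a * (v - d)).imK - (frame a * (x - d)).imK = C at *
  nlinarith [sq_nonneg (A - B), sq_nonneg (B - C), sq_nonneg (A - C),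
    sq_nonneg ((frame a * (v - d)).re - 0)]

theorem convex_cell24 : Convex ℝ cell24 := by
  intro x hx y hy s t hs ht hst
  rw [mem_cell24_iff_inner] at hx hy ⊢
  intro e he
  rw [inner_add_left, real_inner_smul_left, real_inner_smul_left]
  have h1 := mul_le_mul_of_nonneg_left (hx e he) hs
  have h2 := mul_le_mul_of_nonneg_left (hy e he) ht
  have h3 : ‖e‖ ^ 2 = s * ‖e‖ ^ 2 + t * ‖e‖ ^ 2 := by rw [← add_mul, hst, one_mul]
  linarith

/-- A lattice point nearest to `x` is within `1 + 1/4 < √2` of `v`. Squared norms of Hurwitz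
integers are integers, so that distance is at most 1, while every point of D₄ has distance at least
1 from `v`. -/
theorem nearest_subset_of_dist_le {v x : ℍ[ℝ]} (hv : v ∈ hurwitz) (hvw : v ∉ walls)
    (h : dist x v ≤ 1 / 4) : nearest x ⊆ nearest v := by
  rintro d ⟨hd, hxd⟩
  refine ⟨hd, (mem_voronoiCell_latticeD4_iff hd).1 fun t ht => ?_⟩
  have h1 := norm_le_one_of_mem_cell24 hxd
  rw [← dist_eq_norm] at h1
  have h2 := dist_triangle_left v d x
  have h3 : ‖v - d‖ ≤ 1 := by
    refine norm_le_one_of_mem_hurwitz (sub_mem_hurwitz hv hd) ?_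
    rw [← dist_eq_norm]
    nlinarith [dist_nonneg (x := v) (y := d)]
  rw [dist_eq_norm, dist_eq_norm]
  refine h3.trans (one_le_norm_of_mem_hurwitz (sub_mem_hurwitz hv ht) ?_)
  intro h0
  exact notMem_latticeD4_of_notMem_walls hvw (sub_eq_zero.1 h0 ▸ ht)

/-- The nearest points of `x` are nearest to `v` as well, hence to the whole segment by convexity of
the cells. Enlarging the set of nearest points cannot make it fit into a wall. -/
theorem segment_subset_nearestComplex {v x : ℍ[ℝ]} (hv : v ∈ hurwitz) (hvw : v ∉ walls)
    (hx : x ∈ nearestComplex) (h : dist x v ≤ 1 / 4) : segment ℝ v x ⊆ nearestComplex := by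
  rintro y ⟨s, t, hs, ht, hst, rfl⟩ d hd a hN
  have hsub : nearest x ⊆ nearest (s • v + t • x) := fun e he => by
    refine ⟨he.1, ?_⟩
    have h1 := convex_cell24 (nearest_subset_of_dist_le hv hvw h he).2 he.2 hs ht hst
    rwa [smul_sub, smul_sub, sub_add_sub_comm, ← add_smul, hst, one_smul] at h1
  exact hx d hd a (hsub.trans hN)

/-! ### Points near the vertices -/

/-- Four coset representatives reduce uniformity over all vertices to finitely many points. -/
theorem exists_sub_mem_latticeD4 {v : ℍ[ℝ]} (hv : v ∈ hurwitz) :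
    ∃ r : ℍ[ℝ], (r = 0 ∨ r = 1 ∨ r = zeta ∨ r = omega) ∧ v - r ∈ latticeD4 := by
  obtain ⟨a, b, c, d, h1, h2, h3, h4⟩ := hv
  rcases Int.even_or_odd' a with ⟨k, rfl | rfl⟩ <;>
    rcases Int.even_or_odd (b + c + d) with he | he
  · refine ⟨0, Or.inl rfl, k, k + b, k + c, k + d, ?_, by grind⟩
    simp [h1, h2, h3, h4]
  · refine ⟨1, Or.inr (Or.inl rfl), k - 1, k + b, k + c, k + d, ?_, by grind⟩
    simp [h1, h2, h3, h4]
  · refine ⟨zeta, Or.inr (Or.inr (Or.inl rfl)), k, k + b, k + c, k + d, ?_, by grind⟩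
    simp [h1, h2, h3, h4, zeta_eq]
    refine ⟨?_, ?_, ?_, ?_⟩ <;> ring
  · refine ⟨omega, Or.inr (Or.inr (Or.inr rfl)), k + 1, k + b, k + c, k + d, ?_, by grind⟩
    simp [h1, h2, h3, h4, omega_eq]
    refine ⟨?_, ?_, ?_, ?_⟩ <;> ring

theorem zeta_mem_hurwitz : zeta ∈ hurwitz := ⟨1, 0, 0, 0, by simp [zeta_eq]⟩

theorem omega_mem_hurwitz : omega ∈ hurwitz := ⟨-1, 1, 1, 1, by norm_num [omega_eq]⟩

theorem exists_dist_retr_le {r : ℍ[ℝ]} (hr : r ∈ hurwitz) {ε : ℝ} (hε : 0 < ε) :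
    ∃ δ > 0, r ∉ walls → ∀ x ∉ walls, dist x r ≤ δ → dist (retr x) r ≤ ε := by
  by_cases hrw : r ∈ walls
  · exact ⟨1, one_pos, fun h => absurd hrw h⟩
  · obtain ⟨δ, hδ, h⟩ := Metric.continuousOn_iff.1 continuousOn_retr r hrw ε hε
    rw [retr_eq_self (complexVertices_subset_nearestComplex ⟨hr, hrw⟩)] at h
    exact ⟨δ / 2, half_pos hδ, fun _ x hx hxr => (h x hx (by linarith)).le⟩

/-- The retraction is uniformly continuous at the vertices. -/
theorem exists_forall_dist_retr_le {ε : ℝ} (hε : 0 < ε) : ∃ δ > 0,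
    ∀ v ∈ (hurwitz : Set ℍ[ℝ]) \ walls, ∀ x ∈ wallsᶜ, dist x v ≤ δ → dist (retr x) v ≤ ε := by
  obtain ⟨δ₀, p0, h0⟩ := exists_dist_retr_le (zero_mem hurwitz) hε
  obtain ⟨δ₁, p1, h1⟩ := exists_dist_retr_le one_mem_hurwitz hε
  obtain ⟨δ₂, p2, h2⟩ := exists_dist_retr_le zeta_mem_hurwitz hε
  obtain ⟨δ₃, p3, h3⟩ := exists_dist_retr_le omega_mem_hurwitz hε
  have l0 := min_le_left (min δ₀ δ₁) (min δ₂ δ₃)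
  have l1 := min_le_right (min δ₀ δ₁) (min δ₂ δ₃)
  refine ⟨min (min δ₀ δ₁) (min δ₂ δ₃), by positivity, ?_⟩
  rintro v ⟨hv, hvw⟩ x hx hxv
  obtain ⟨r, hr, hvr⟩ := exists_sub_mem_latticeD4 hv
  have hrw : r ∉ walls := fun h => hvw (by simpa using add_mem_walls hvr h)
  have hx' : x - (v - r) ∉ walls := fun h => hx (by simpa using add_mem_walls hvr h)
  have e1 : dist (x - (v - r)) r = dist x v := by
    rw [dist_eq_norm, dist_eq_norm]; congr 1; abel
  have e2 : dist (retr (x - (v - r))) r = dist (retr x) v := by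
    have := retr_add hvr hx'
    rw [sub_add_cancel] at this
    rw [this, dist_eq_norm, dist_eq_norm]; congr 1; abel
  rw [← e2]
  rw [← e1] at hxv
  rcases hr with rfl | rfl | rfl | rfl
  · exact h0 hrw _ hx' (hxv.trans (l0.trans (min_le_left _ _)))
  · exact h1 hrw _ hx' (hxv.trans (l0.trans (min_le_right _ _)))
  · exact h2 hrw _ hx' (hxv.trans (l1.trans (min_le_left _ _)))
  · exact h3 hrw _ hx' (hxv.trans (l1.trans (min_le_right _ _)))

end

end ReflG4

/-! ### Assembly of the homotopy equivalences -/

namespace ReflG4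

theorem thickenedComplex_reflGroup (ε : ℝ) : thickenedComplex reflGroup ε =
    nearestComplex ∪ ⋃ v ∈ (hurwitz : Set ℍ[ℝ]) \ walls, Metric.closedBall v ε := by
  rw [thickenedComplex, complementComplex_reflGroup, complexVertices_reflGroup]

theorem modifiedComplex_reflGroup (ε : ℝ) : modifiedComplex reflGroup ε =
    (nearestComplex ∪ ⋃ v ∈ (hurwitz : Set ℍ[ℝ]) \ walls, Metric.closedBall v ε) \
      ⋃ v ∈ (hurwitz : Set ℍ[ℝ]) \ walls, Metric.ball v ε := by
  rw [modifiedComplex, thickenedComplex_reflGroup, complexVertices_reflGroup]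

theorem puncturedThickenedComplex_reflGroup (ε : ℝ) : puncturedThickenedComplex reflGroup ε =
    (nearestComplex ∪ ⋃ v ∈ (hurwitz : Set ℍ[ℝ]) \ walls, Metric.closedBall v ε) \
      ((hurwitz : Set ℍ[ℝ]) \ walls) := by
  rw [puncturedThickenedComplex, thickenedComplex_reflGroup, complexVertices_reflGroup]

theorem regularPoints_eq_diff : regularPoints reflGroup =
    wallsᶜ \ ((hurwitz : Set ℍ[ℝ]) \ walls) := by
  rw [regularPoints_reflGroup]
  ext x
  simp only [Set.mem_sdiff, Set.mem_compl_iff]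
  tauto

end ReflG4

theorem mainTheorem7 :
    ∃ ε₀ : ℝ, 0 < ε₀ ∧ ∀ ε : ℝ, 0 < ε → ε < ε₀ →
      (Nonempty (ReflG4.complementComplex ReflG4.reflGroup ≃ₕ
          ReflG4.thickenedComplex ReflG4.reflGroup ε) ∧
        Nonempty (ReflG4.thickenedComplex ReflG4.reflGroup ε ≃ₕ
          ReflG4.hyperplaneComplement ReflG4.reflGroup)) ∧
      (Nonempty (ReflG4.modifiedComplex ReflG4.reflGroup ε ≃ₕ
          ReflG4.puncturedThickenedComplex ReflG4.reflGroup ε) ∧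
        Nonempty (ReflG4.puncturedThickenedComplex ReflG4.reflGroup ε ≃ₕ
          ReflG4.regularPoints ReflG4.reflGroup)) := by
  -- Any bound of at most 1/8 works: then `2 * ε ≤ 1/4` gives star-shapedness near the vertices, and
  -- `ε < 1/3` keeps the balls off the walls.
  refine ⟨1 / 16, by norm_num, fun ε hε hε₀ => ?_⟩
  rw [ReflG4.complementComplex_reflGroup, ReflG4.thickenedComplex_reflGroup,
    ReflG4.modifiedComplex_reflGroup, ReflG4.puncturedThickenedComplex_reflGroup,
    ReflG4.hyperplaneComplement_reflGroup, ReflG4.regularPoints_eq_diff]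
  have hε' : ε < 1 / 8 := by linarith
  have hVK := ReflG4.complexVertices_subset_nearestComplex
  have hKX : ReflG4.nearestComplex ⊆ ReflG4.wallsᶜ :=
    fun x hx => ReflG4.disjoint_nearestComplex_walls hx
  have hV := ReflG4.pairwise_hurwitz.mono
    (Set.sdiff_subset : (ReflG4.hurwitz : Set ℍ[ℝ]) \ ReflG4.walls ⊆ _)
  have hVne : ((ReflG4.hurwitz : Set ℍ[ℝ]) \ ReflG4.walls).Nonempty :=
    ⟨1, ReflG4.one_mem_hurwitz, ReflG4.one_notMem_walls⟩
  have hstar : ∀ v ∈ (ReflG4.hurwitz : Set ℍ[ℝ]) \ ReflG4.walls, ∀ x ∈ ReflG4.nearestComplex,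
      dist x v ≤ 2 * ε → segment ℝ v x ⊆ ReflG4.nearestComplex := fun v hv x hx h =>
    ReflG4.segment_subset_nearestComplex hv.1 hv.2 hx (by linarith)
  have hball : ∀ v ∈ (ReflG4.hurwitz : Set ℍ[ℝ]) \ ReflG4.walls,
      Metric.closedBall v ε ⊆ ReflG4.wallsᶜ := fun v hv x hx hxw => by
    have h1 := ReflG4.third_le_dist hv.1 hv.2 hxw
    have h2 := Metric.mem_closedBall.1 hx
    linarith
  have hρK : ∀ x ∈ ReflG4.wallsᶜ, ReflG4.retr x ∈ ReflG4.nearestComplex :=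
    fun x hx => ReflG4.retr_mem hx
  have hfix : ∀ x ∈ ReflG4.nearestComplex, ReflG4.retr x = x :=
    fun x hx => ReflG4.retr_eq_self hx
  have hseg : ∀ x ∈ ReflG4.wallsᶜ, ∀ t ∈ Set.Icc (0 : ℝ) 1,
      x + t • (ReflG4.retr x - x) ∈ ReflG4.wallsᶜ := fun x hx t ht => (ReflG4.retr_segment hx ht).1
  obtain ⟨δ, hδ, hnear⟩ := ReflG4.exists_forall_dist_retr_le hε
  have h1 := ReflG4.nonempty_homotopyEquiv_thickening hVK hV hε hε' hstar
  have h2 := ReflG4.nonempty_homotopyEquiv_of_retraction hKX ReflG4.retr ReflG4.continuousOn_retr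
    hρK hfix hseg
  refine ⟨⟨h1, ?_⟩, ReflG4.nonempty_homotopyEquiv_punctured hVne hV hε hε',
    ReflG4.nonempty_homotopyEquiv_of_retraction_punctured hVK hKX hVne hV hε hε' hstar hball
      ReflG4.retr ReflG4.continuousOn_retr hρK hfix hseg
      (fun x hx t ht => (ReflG4.retr_segment hx ht).2)
      (fun x hx => ReflG4.dist_retr_le hx) hδ hnear⟩
  obtain ⟨e1⟩ := h1
  obtain ⟨e2⟩ := h2
  exact ⟨e1.symm.trans e2⟩
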